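/- Let $G$ be a compact connected Lie group with Lie algebra $\mathfrak g$, let $\langle\cdot,\cdot\rangle_{\mathfrak g}$ be an $\mathrm{Ad}(G)$-invariant inner product on $\mathfrak g$, and let $g_G$ be the bi-invariant Riemannian metric on $G$ that it induces. Let $s\ge 0$ be an integer and let $H^s([0,1],\mathfrak g)$ be the Sobolev space of maps $[0,1]\to\mathfrak g$ with weak derivatives up to order $s$ in $L^2$. For each $u\in H^s([0,1],\mathfrak g)$ there is a unique $\mathbf g_u\in H^{s+1}([0,1],G)$ with $\mathbf g_u(0)=e$ and $(R_{\mathbf g_u(t)})_*^{-1}(\mathbf g_u'(t))=u(t)$ for almost every $t\in[0,1]$, where $R_a$ is right translation by $a$. The parallel transport map is $\phi(u):=\mathbf g_u(1)$. For $u\in H^s([0,1],\mathfrak g)$ let $\nabla_u\xi:=\xi'-[u,\xi]$ be the covariant derivative of the connection determined by $u$, i.e. the one whose parallel sections are the curves $\mathrm{Ad}(\mathbf g_u(t))v$ with $v\in\mathfrak g$. For $\xi,\zeta\in H^s([0,1],\mathfrak g)$ set $$(g_s^o)_u(\xi,\zeta):=\sum_{k=0}^{s}\binom sk\int_0^1\big\langle(\nabla_u^k\xi)(t),(\nabla_u^k\zeta)(t)\big\rangle_{\mathfrak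 g}\,dt ,$$ the symmetric form of the $L^2_s$-inner product $\langle\xi,(\nabla_u^*\nabla_u+\mathrm{id})^s\zeta\rangle_{L^2}$. **Proposition 3.3.** For every integer $s\ge 0$, $g_s^o$ is a smooth Riemannian metric on the Hilbert manifold $H^s([0,1],\mathfrak g)$, and the parallel transport map $$\phi:(H^s([0,1],\mathfrak g),g_s^o)\to(G,g_G)$$ is a Riemannian submersion onto $G$: it is smooth and surjective, and for every $u$ the differential $d\phi_u$ maps the $(g_s^o)_u$-orthogonal complement of $\ker d\phi_u$ isometrically onto $(T_{\phi(u)}G,g_G)$. -/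

import Mathlib

open MeasureTheory Set
open scoped Manifold ContDiff

noncomputable section

/-! ### Riemannian submersions -/

section RiemannianSubmersion

variable {EM : Type*} [NormedAddCommGroup EM] [NormedSpace ℝ EM]
  {HM : Type*} [TopologicalSpace HM] {IM : ModelWithCorners ℝ EM HM}
  {M : Type*} [TopologicalSpace M] [ChartedSpace HM M] [IsManifold IM ∞ M]
  {EN : Type*} [NormedAddCommGroup EN] [NormedSpace ℝ EN]
  {HN : Type*} [TopologicalSpace HN] {IN : ModelWithCorners ℝ EN HN}
  {N : Type*} [TopologicalSpace N] [ChartedSpace HN N] [IsManifold IN ∞ N]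

/-- The horizontal space of `f : M → N` at `x`: the orthogonal complement, for the Riemannian
metric of `M`, of the kernel of the differential of `f` at `x`. -/
def horizontalSpace
    (gM : Bundle.ContMDiffRiemannianMetric IM ∞ EM (fun x : M => TangentSpace IM x))
    (IN : ModelWithCorners ℝ EN HN) (f : M → N) (x : M) : Set (TangentSpace IM x) :=
  {v | ∀ k : TangentSpace IM x, mfderiv IM IN f x k = 0 → gM.inner x v k = 0}

/-- A Riemannian submersion of `(M, gM)` onto `(N, gN)`: a smooth surjection whose differential at
every point maps the horizontal space isometrically onto the tangent space of the target. -/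
structure IsRiemannianSubmersion
    (gM : Bundle.ContMDiffRiemannianMetric IM ∞ EM (fun x : M => TangentSpace IM x))
    (gN : Bundle.ContMDiffRiemannianMetric IN ∞ EN (fun y : N => TangentSpace IN y))
    (f : M → N) : Prop where
  contMDiff : ContMDiff IM IN ∞ f
  surjective : Function.Surjective f
  exists_horizontal : ∀ (x : M) (w : TangentSpace IN (f x)),
    ∃ v ∈ horizontalSpace gM IN f x, mfderiv IM IN f x v = w
  isometry : ∀ (x : M), ∀ v ∈ horizontalSpace gM IN f x, ∀ w ∈ horizontalSpace gM IN f x,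
    gN.inner (f x) (mfderiv IM IN f x v) (mfderiv IM IN f x w) = gM.inner x v w

end RiemannianSubmersion

/-! ### Sobolev spaces on an interval -/

section Sobolev

variable (F : Type*) [NormedAddCommGroup F] [NormedSpace ℝ F]

/-- Lebesgue measure on `[0,1]`. -/
abbrev unitVol : Measure ℝ := volume.restrict (Icc (0 : ℝ) 1)

/-- The Sobolev space `H^s([0,1], F)`. An element is recorded together with its weak derivatives:
it is a tuple `(u₀, …, u_s)` of classes in `L²([0,1], F)` in which each `u_k`, `k < s`, is (almost
everywhere) absolutely continuous with derivative `u_{k+1}`. The whole tuple is determined by `u₀`.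
The norm `max_k ‖u_k‖_{L²}` induced from the product is equivalent to the usual Sobolev norm. -/
def SobolevSpace (s : ℕ) : Submodule ℝ (Fin (s + 1) → Lp F 2 unitVol) where
  carrier := {u | ∀ k : Fin s, ∃ c : F, ∀ᵐ t ∂unitVol,
    u k.castSucc t = c + ∫ τ in (0 : ℝ)..t, u k.succ τ}
  zero_mem' := by
    intro k
    refine ⟨0, ?_⟩
    have h0 : ((0 : Lp F 2 unitVol) : ℝ → F) =ᵐ[unitVol] 0 := Lp.coeFn_zero F 2 unitVol
    filter_upwards [h0, ae_restrict_mem measurableSet_Icc] with t ht hm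
    have hI : ∫ τ in (0 : ℝ)..t, ((0 : Lp F 2 unitVol) : ℝ → F) τ = ∫ _ in (0 : ℝ)..t, (0 : F) := by
      apply intervalIntegral.integral_congr_ae_restrict
      rw [uIoc_of_le hm.1]
      exact ae_restrict_of_ae_restrict_of_subset
        (Ioc_subset_Icc_self.trans (Icc_subset_Icc_right hm.2)) h0
    simp only [Pi.zero_apply] at ht ⊢
    rw [hI, ht]
    simp
  add_mem' := by
    intro u v hu hv k
    obtain ⟨c, hc⟩ := hu k
    obtain ⟨d, hd⟩ := hv k
    refine ⟨c + d, ?_⟩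
    have h1 := Lp.coeFn_add (u k.castSucc) (v k.castSucc)
    have h2 := Lp.coeFn_add (u k.succ) (v k.succ)
    filter_upwards [hc, hd, h1, ae_restrict_mem measurableSet_Icc] with t htc htd ht hm
    have hs : Ioc (0 : ℝ) t ⊆ Icc 0 1 :=
      Ioc_subset_Icc_self.trans (Icc_subset_Icc_right hm.2)
    have hI : ∫ τ in (0 : ℝ)..t, (u k.succ + v k.succ : Lp F 2 unitVol) τ
        = ∫ τ in (0 : ℝ)..t, (u k.succ τ + v k.succ τ) := by
      apply intervalIntegral.integral_congr_ae_restrict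
      rw [uIoc_of_le hm.1]
      exact ae_restrict_of_ae_restrict_of_subset hs h2
    have hint : ∀ w : Lp F 2 unitVol, IntervalIntegrable w volume 0 t := fun w =>
      (intervalIntegrable_iff_integrableOn_Ioc_of_le hm.1).2
        (IntegrableOn.mono_set ((Lp.memLp w).integrable (by norm_num)) hs)
    simp only [Pi.add_apply] at ht ⊢
    rw [hI, ht, htc, htd, intervalIntegral.integral_add (hint _) (hint _)]
    abel
  smul_mem' := by
    intro a u hu k
    obtain ⟨c, hc⟩ := hu k
    refine ⟨a • c, ?_⟩
    have h1 := Lp.coeFn_smul a (u k.castSucc)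
    have h2 := Lp.coeFn_smul a (u k.succ)
    filter_upwards [hc, h1, ae_restrict_mem measurableSet_Icc] with t htc ht hm
    have hs : Ioc (0 : ℝ) t ⊆ Icc 0 1 :=
      Ioc_subset_Icc_self.trans (Icc_subset_Icc_right hm.2)
    have hI : ∫ τ in (0 : ℝ)..t, (a • u k.succ : Lp F 2 unitVol) τ
        = ∫ τ in (0 : ℝ)..t, a • u k.succ τ := by
      apply intervalIntegral.integral_congr_ae_restrict
      rw [uIoc_of_le hm.1]
      exact ae_restrict_of_ae_restrict_of_subset hs h2
    simp only [Pi.smul_apply] at ht ⊢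
    rw [hI, ht, htc, intervalIntegral.integral_smul, smul_add]

variable {F}

/-- `f` restricted to `[a,b]` is of class `H^k`: it is square integrable if `k = 0`; and for
`k + 1` it is absolutely continuous with derivative of class `H^k`. -/
def MemSobolev : ℕ → ℝ → ℝ → (ℝ → F) → Prop
  | 0, a, b, f => MemLp f 2 (volume.restrict (Icc a b))
  | k + 1, a, b, f => ∃ f' : ℝ → F, MemSobolev k a b f' ∧
      ∀ t ∈ Icc a b, f t = f a + ∫ τ in a..t, f' τ

end Sobolev

/-! ### Lie groups -/

section Lie

variable {E : Type*} [NormedAddCommGroup E] [NormedSpace ℝ E]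
  {G : Type*} [TopologicalSpace G] [ChartedSpace E G] [Group G]

/-- The restriction to `[0,1]` of `γ` belongs to `H^k([0,1], G)`, `k ≥ 1`: it is continuous, and
near every point of `[0,1]` it is of class `H^k` when read in a chart of `G`. -/
def MemSobolevPath (k : ℕ) (γ : ℝ → G) : Prop :=
  ContinuousOn γ (Icc 0 1) ∧ ∀ t₀ ∈ Icc (0 : ℝ) 1, ∃ δ > 0,
    (∀ t ∈ Icc (max 0 (t₀ - δ)) (min 1 (t₀ + δ)), γ t ∈ (extChartAt 𝓘(ℝ, E) (γ t₀)).source) ∧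
    MemSobolev k (max 0 (t₀ - δ)) (min 1 (t₀ + δ)) (fun t => extChartAt 𝓘(ℝ, E) (γ t₀) (γ t))

/-- The adjoint representation of `G` on its Lie algebra. -/
def lieAd (a : G) (v : GroupLieAlgebra 𝓘(ℝ, E) G) : GroupLieAlgebra 𝓘(ℝ, E) G :=
  (mfderiv 𝓘(ℝ, E) 𝓘(ℝ, E) (fun x : G => a * x * a⁻¹) 1 v :
    TangentSpace 𝓘(ℝ, E) (a * 1 * a⁻¹))

/-- The image `(R_a)_* v` in `T_a G` of `v ∈ 𝔤` under the right translation `R_a`. -/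
def rightTranslate (v : GroupLieAlgebra 𝓘(ℝ, E) G) (a : G) : TangentSpace 𝓘(ℝ, E) a :=
  (mfderiv 𝓘(ℝ, E) 𝓘(ℝ, E) (fun x : G => x * a) 1 v : TangentSpace 𝓘(ℝ, E) (1 * a))

/-- An `Ad(G)`-invariant inner product on the Lie algebra of `G`. -/
structure IsAdInvariantInner (B : LinearMap.BilinForm ℝ (GroupLieAlgebra 𝓘(ℝ, E) G)) :
    Prop where
  symm : ∀ v w, B v w = B w v
  pos : ∀ v, v ≠ 0 → 0 < B v v
  ad_invariant : ∀ (a : G) (v w), B (lieAd a v) (lieAd a w) = B v w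

/-- `g` is the bi-invariant Riemannian metric on `G` induced by the inner product `B` on `𝔤`. -/
structure IsBiInvariantMetric [IsManifold 𝓘(ℝ, E) ∞ G]
    (B : LinearMap.BilinForm ℝ (GroupLieAlgebra 𝓘(ℝ, E) G))
    (g : Bundle.ContMDiffRiemannianMetric 𝓘(ℝ, E) ∞ E (fun x : G => TangentSpace 𝓘(ℝ, E) x)) :
    Prop where
  inner_one : ∀ v w : GroupLieAlgebra 𝓘(ℝ, E) G, g.inner 1 v w = B v w
  left : ∀ (a x : G) (v w : TangentSpace 𝓘(ℝ, E) x),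
    g.inner (a * x) (mfderiv 𝓘(ℝ, E) 𝓘(ℝ, E) (fun y : G => a * y) x v)
      (mfderiv 𝓘(ℝ, E) 𝓘(ℝ, E) (fun y : G => a * y) x w) = g.inner x v w
  right : ∀ (a x : G) (v w : TangentSpace 𝓘(ℝ, E) x),
    g.inner (x * a) (mfderiv 𝓘(ℝ, E) 𝓘(ℝ, E) (fun y : G => y * a) x v)
      (mfderiv 𝓘(ℝ, E) 𝓘(ℝ, E) (fun y : G => y * a) x w) = g.inner x v w

/-! ### The parallel transport map

The Lie algebra `𝔤 = T_1 G` is, as a vector space with its topology, the model space `E`; it is `E`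
that carries a norm, so that `H^s([0,1], 𝔤)` is `SobolevSpace E s`. -/

/-- The path `γ` in `G` is the element `g_u` of `H^{s+1}([0,1], G)` with `g_u(0) = 1` and
`(R_{g_u(t)})_*⁻¹ (g_u'(t)) = u(t)` for almost every `t`. -/
structure IsParallelPath {s : ℕ} (u : SobolevSpace E s) (γ : ℝ → G) : Prop where
  mem : MemSobolevPath (E := E) (s + 1) γ
  start : γ 0 = 1
  deriv : ∀ᵐ t ∂unitVol, HasMFDerivAt 𝓘(ℝ, ℝ) 𝓘(ℝ, E) γ t
    (ContinuousLinearMap.toSpanSingleton ℝ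
      (rightTranslate (u.1 0 t : GroupLieAlgebra 𝓘(ℝ, E) G) (γ t)))

variable (G) in
open Classical in
/-- The parallel transport map `φ(u) = g_u(1)`. (The value `1` when no `g_u` exists is a dummy.) -/
def parallelTransport (s : ℕ) (u : SobolevSpace E s) : G :=
  if h : ∃ γ : ℝ → G, IsParallelPath u γ then h.choose 1 else 1

/-! ### The metric on `H^s([0,1], 𝔤)` -/

variable (G) in
/-- The jet `(ξ(t), ξ'(t), …, ξ^{(s)}(t), 0, 0, …)` of `ξ ∈ H^s([0,1], 𝔤)`. -/
def sobolevJet {s : ℕ} (ξ : SobolevSpace E s) (t : ℝ) : ℕ → GroupLieAlgebra 𝓘(ℝ, E) G :=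
  fun k => if h : k < s + 1 then (ξ.1 ⟨k, h⟩ t : E) else (0 : E)

/-- The covariant derivative `∇_u ξ = ξ' - [u, ξ]` on jets: by the Leibniz rule,
`(∇_u ξ)^{(j)} = ξ^{(j+1)} - ∑_{i ≤ j} (j choose i) [u^{(i)}, ξ^{(j-i)}]`. -/
def covJet (u ξ : ℕ → GroupLieAlgebra 𝓘(ℝ, E) G) : ℕ → GroupLieAlgebra 𝓘(ℝ, E) G :=
  fun j => ξ (j + 1) - ∑ i ∈ Finset.range (j + 1), (j.choose i) • ⁅u i, ξ (j - i)⁆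

/-- The value at `t` of the `k`-th covariant derivative `∇_u^k ξ`, for `k ≤ s`. It involves
derivatives of `ξ` of order at most `k` and of `u` of order at most `k - 1` only. -/
def covDeriv (G : Type*) [TopologicalSpace G] [ChartedSpace E G] [Group G] {s : ℕ}
    (k : ℕ) (u ξ : SobolevSpace E s) (t : ℝ) : GroupLieAlgebra 𝓘(ℝ, E) G :=
  (covJet (sobolevJet G u t))^[k] (sobolevJet G ξ t) 0

/-- The metric `g_s^o` at `u`: the `L²_s`-inner product `⟨ξ, (∇_u^* ∇_u + id)^s ζ⟩_{L²}` in its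
symmetric form
`∑_{k ≤ s} (s choose k) ∫_0^1 ⟨∇_u^k ξ, ∇_u^k ζ⟩ dt`. -/
def sobolevForm (B : LinearMap.BilinForm ℝ (GroupLieAlgebra 𝓘(ℝ, E) G)) (s : ℕ)
    (u ξ ζ : SobolevSpace E s) : ℝ :=
  ∑ k ∈ Finset.range (s + 1),
    (s.choose k : ℝ) * ∫ t in (0 : ℝ)..1, B (covDeriv G k u ξ t) (covDeriv G k u ζ t)

end Lie

end

/-!
A path `γ` in `G` with `γ' = (R_γ)_* u` is treated as an absolutely continuous solution, read in
charts, of an equation with a control `u` that is merely of class `L²` (`IsTransport`); if `u` is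
of class `H^s`, then `γ` is of class `H^{s+1}` by bootstrapping (`IsTransport.isParallelPath`).

*Existence and smoothness.* In a chart at `1` the equation reads `x' = A(x) u` with `A = id` at the
centre. The implicit function theorem in `L²`, applied to the unknown `y = x'`, solves it for small
`u`, smoothly in `u` (`exists_smooth_solution`, `exists_smooth_endpoint`). If `γ₀` belongs to `u₀`
and `γ` to `Ad(γ₀⁻¹)(u - u₀)`, then `γ₀ γ` belongs to `u` (`IsTransport.mul_of_adInvLp`). As `G` is
compact, `Ad` is bounded, so solvability propagates in steps of uniform length to all of `L²`. The
same gauge transformation moves smoothness from `0` to any `u₀` and gives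
`dφ_u ξ = (L_{γ(1)})_* ∫ Ad(γ⁻¹) ξ` (`tderiv_parallelTransport`). The image of `φ` is closed under
multiplication and contains a neighbourhood of `1`, hence is all of the connected group `G`
(`surjective_parallelTransport`).

*The metric.* The bracket of `𝔤` is the differential of `Ad` (`bracket_eq_adL`). The iterated
covariant derivatives are operators from `H^s` to `L²` that are polynomial in `u`, since the
derivatives of `u` of order less than `s` depend on `u` through continuous curves; so `g_s^o` is
smooth (`contDiff_sobolevInner`). Conversely the derivatives of `ξ` are recovered from its
covariant derivatives, so `g_s^o` is equivalent to the Sobolev norm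
(`exists_norm_sq_le_sobolevInner`).

*Horizontal vectors.* For `v ∈ 𝔤` the parallel section `ξ_v = Ad(γ) v` is of class `H^s` and all its
covariant derivatives of positive order vanish (`IsTransport.covOperator_eq_zero`). Hence only the
term `k = 0` of `g_s^o(ξ_v, ζ)` survives, and by `Ad`-invariance it is `⟨v, ∫ Ad(γ⁻¹) ζ⟩`
(`IsTransport.sobolevInner_parallelSection`). So `ξ_v` is orthogonal to the kernel of `dφ_u`, while
`dφ_u ξ_v = (L_{γ(1)})_* v`; conversely, by definiteness every horizontal vector is some `ξ_v`
(`IsTransport.ae_eq_of_horizontal`). Taking `ζ = ξ_w` shows that `dφ_u` is isometric on horizontal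
vectors.
-/

open Filter Topology

noncomputable section

/-! ### Absolutely continuous functions on an interval -/

section Primitive

variable {E F : Type*} [NormedAddCommGroup E] [NormedSpace ℝ E]
  [NormedAddCommGroup F] [NormedSpace ℝ F]

/-- A function on `[a,b]` that does not change near any point is constant. -/
theorem eq_of_locally_eq {X : Type*} {h : ℝ → X} {a b : ℝ}
    (H : ∀ t₀ ∈ Icc a b, ∃ δ > 0, ∀ t ∈ Icc (max a (t₀ - δ)) (min b (t₀ + δ)), h t = h t₀)
    {s t : ℝ} (hs : s ∈ Icc a b) (ht : t ∈ Icc a b) : h s = h t := by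
  refine isPreconnected_Icc.induction₂ (fun x y => h x = h y) ?_
    (fun _ _ _ _ _ _ h₁ h₂ => h₁.trans h₂) (fun _ _ _ _ h => h.symm) hs ht
  intro x hx
  obtain ⟨δ, hδ, hh⟩ := H x hx
  filter_upwards [self_mem_nhdsWithin,
    mem_nhdsWithin_of_mem_nhds (Icc_mem_nhds (sub_lt_self x hδ) (lt_add_of_pos_right x hδ))]
    with y hy hy'
  exact (hh y ⟨max_le hy.1 hy'.1, le_min hy.2 hy'.2⟩).symm

/-- `f` is absolutely continuous on `[a,b]` with derivative `f'`. -/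
def IsPrimitiveOn (f f' : ℝ → F) (a b : ℝ) : Prop :=
  IntervalIntegrable f' volume a b ∧ ∀ t ∈ Icc a b, f t = f a + ∫ τ in a..t, f' τ

namespace IsPrimitiveOn

variable {f f' g' : ℝ → F} {a b c d : ℝ}

theorem intervalIntegrable_of_mem (h : IsPrimitiveOn f f' a b) {s t : ℝ} (hs : s ∈ Icc a b)
    (ht : t ∈ Icc a b) : IntervalIntegrable f' volume s t :=
  h.1.mono_set (by
    rw [uIcc_of_le (hs.1.trans hs.2)]
    exact uIcc_subset_Icc hs ht)

theorem sub_eq (h : IsPrimitiveOn f f' a b) {s t : ℝ} (hs : s ∈ Icc a b) (ht : t ∈ Icc a b) :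
    f t - f s = ∫ τ in s..t, f' τ := by
  have ha : a ∈ Icc a b := left_mem_Icc.2 (hs.1.trans hs.2)
  rw [h.2 t ht, h.2 s hs, add_sub_add_left_eq_sub, intervalIntegral.integral_interval_sub_left
    (h.intervalIntegrable_of_mem ha ht) (h.intervalIntegrable_of_mem ha hs)]

theorem mono (h : IsPrimitiveOn f f' a b) (hac : a ≤ c) (hcd : c ≤ d) (hdb : d ≤ b) :
    IsPrimitiveOn f f' c d := by
  have hc : c ∈ Icc a b := ⟨hac, hcd.trans hdb⟩
  refine ⟨h.intervalIntegrable_of_mem hc ⟨hac.trans hcd, hdb⟩, fun t ht => ?_⟩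
  rw [← h.sub_eq hc ⟨hac.trans ht.1, ht.2.trans hdb⟩]
  abel

theorem congr_ae (h : IsPrimitiveOn f f' a b) (hab : a ≤ b)
    (hfg : f' =ᵐ[volume.restrict (Icc a b)] g') : IsPrimitiveOn f g' a b := by
  refine ⟨h.1.congr_ae ?_, fun t ht => ?_⟩
  · rw [uIoc_of_le hab]
    exact ae_mono (Measure.restrict_mono Ioc_subset_Icc_self le_rfl) hfg
  · rw [h.2 t ht]
    congr 1
    apply intervalIntegral.integral_congr_ae_restrict
    rw [uIoc_of_le ht.1]
    exact ae_mono (Measure.restrict_mono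
      (Ioc_subset_Icc_self.trans (Icc_subset_Icc_right ht.2)) le_rfl) hfg

theorem congr_fun {g : ℝ → F} (h : IsPrimitiveOn f f' a b) (hab : a ≤ b)
    (hfg : EqOn f g (Icc a b)) :
    IsPrimitiveOn g f' a b :=
  ⟨h.1, fun t ht => by rw [← hfg ht, ← hfg (left_mem_Icc.2 hab), h.2 t ht]⟩

theorem continuousOn (h : IsPrimitiveOn f f' a b) (hab : a ≤ b) : ContinuousOn f (Icc a b) := by
  have h1 : ContinuousOn (fun t => f a + ∫ τ in a..t, f' τ) (Icc a b) := by
    refine continuousOn_const.add ?_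
    have := intervalIntegral.continuousOn_primitive_interval (μ := volume) (f := f')
      (a := a) (b := b) (by
        rw [uIcc_of_le hab, integrableOn_Icc_iff_integrableOn_Ioc]
        exact (intervalIntegrable_iff_integrableOn_Ioc_of_le hab).1 h.1)
    rwa [uIcc_of_le hab] at this
  exact h1.congr h.2

theorem ae_hasDerivAt [CompleteSpace F] (h : IsPrimitiveOn f f' a b) (hab : a ≤ b) :
    ∀ᵐ t ∂volume.restrict (Icc a b), HasDerivAt f (f' t) t := by
  have h1 := h.1.ae_hasDerivAt_integral
  rw [← restrict_Ioo_eq_restrict_Icc, ae_restrict_iff' measurableSet_Ioo]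
  filter_upwards [h1] with t ht hm
  rw [uIcc_of_le hab] at ht
  have := (ht ⟨hm.1.le, hm.2.le⟩ a (left_mem_Icc.2 hab)).const_add (f a)
  refine this.congr_of_eventuallyEq ?_
  filter_upwards [Ioo_mem_nhds hm.1 hm.2] with x hx
  exact h.2 x ⟨hx.1.le, hx.2.le⟩

/-- The derivative of an absolutely continuous function is unique almost everywhere. -/
theorem ae_unique [CompleteSpace F] (h : IsPrimitiveOn f f' a b) (h' : IsPrimitiveOn f g' a b)
    (hab : a ≤ b) : f' =ᵐ[volume.restrict (Icc a b)] g' := by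
  filter_upwards [h.ae_hasDerivAt hab, h'.ae_hasDerivAt hab] with t h1 h2
  exact h1.unique h2

theorem prodMk {g : ℝ → E} {g' : ℝ → E} [CompleteSpace E] [CompleteSpace F]
    (hf : IsPrimitiveOn f f' a b)
    (hg : IsPrimitiveOn g g' a b) (hab : a ≤ b) :
    IsPrimitiveOn (fun t => (f t, g t)) (fun t => (f' t, g' t)) a b := by
  have hint : IntervalIntegrable (fun t => (f' t, g' t)) volume a b := by
    rw [intervalIntegrable_iff_integrableOn_Ioc_of_le hab]
    exact ((intervalIntegrable_iff_integrableOn_Ioc_of_le hab).1 hf.1).prodMk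
      ((intervalIntegrable_iff_integrableOn_Ioc_of_le hab).1 hg.1)
  refine ⟨hint, fun t ht => ?_⟩
  have hi : IntegrableOn (fun t => (f' t, g' t)) (Ioc a t) :=
    (intervalIntegrable_iff_integrableOn_Ioc_of_le ht.1).1
      (hint.mono_set (by rw [uIcc_of_le ht.1, uIcc_of_le hab]; exact Icc_subset_Icc_right ht.2))
  dsimp only
  rw [intervalIntegral.integral_of_le ht.1]
  refine Prod.ext ?_ ?_
  · rw [Prod.fst_add, fst_integral hi, hf.2 t ht, intervalIntegral.integral_of_le ht.1]
  · rw [Prod.snd_add, snd_integral hi, hg.2 t ht, intervalIntegral.integral_of_le ht.1]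

/-- Being absolutely continuous with integrable derivative `f'` is a local property. -/
theorem of_locally (hint : IntervalIntegrable f' volume a b)
    (H : ∀ t₀ ∈ Icc a b, ∃ δ > 0, IsPrimitiveOn f f' (max a (t₀ - δ)) (min b (t₀ + δ))) :
    IsPrimitiveOn f f' a b := by
  refine ⟨hint, fun t ht => ?_⟩
  have ha : a ∈ Icc a b := left_mem_Icc.2 (ht.1.trans ht.2)
  have hII : ∀ s ∈ Icc a b, IntervalIntegrable f' volume a s := fun s hs =>
    hint.mono_set (by rw [uIcc_of_le (hs.1.trans hs.2)]; exact uIcc_subset_Icc ha hs)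
  have key : ∀ s ∈ Icc a b, ∃ δ > 0, ∀ r ∈ Icc (max a (s - δ)) (min b (s + δ)),
      f r - ∫ τ in a..r, f' τ = f s - ∫ τ in a..s, f' τ := by
    intro s hs
    obtain ⟨δ, hδ, hh⟩ := H s hs
    refine ⟨δ, hδ, fun r hr => ?_⟩
    have hs' : s ∈ Icc (max a (s - δ)) (min b (s + δ)) :=
      ⟨max_le hs.1 (by linarith), le_min hs.2 (by linarith)⟩
    have hr' : r ∈ Icc a b := ⟨(le_max_left _ _).trans hr.1, hr.2.trans (min_le_left _ _)⟩
    have := hh.sub_eq hs' hr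
    rw [← intervalIntegral.integral_interval_sub_left (hII r hr') (hII s hs)] at this
    rw [sub_eq_sub_iff_sub_eq_sub, this]
  have := eq_of_locally_eq key ha ht
  simp only [intervalIntegral.integral_same, sub_zero] at this
  rw [this]; abel

end IsPrimitiveOn

/-- A function whose increments are dominated by those of a real absolutely continuous function is
absolutely continuous. -/
theorem absolutelyContinuousOnInterval_of_dist_le {X : Type*} [PseudoMetricSpace X] {h : ℝ → X}
    {n : ℝ → ℝ} {a b K : ℝ} (hn : AbsolutelyContinuousOnInterval n a b)
    (hh : ∀ s ∈ uIcc a b, ∀ t ∈ uIcc a b, dist (h s) (h t) ≤ K * dist (n s) (n t)) :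
    AbsolutelyContinuousOnInterval h a b := by
  have h0 : Tendsto (fun E : ℕ × (ℕ → ℝ × ℝ) =>
      K * ∑ i ∈ Finset.range E.1, dist (n (E.2 i).1) (n (E.2 i).2))
      (AbsolutelyContinuousOnInterval.totalLengthFilter ⊓
        𝓟 (AbsolutelyContinuousOnInterval.disjWithin a b)) (𝓝 0) := by
    simpa using Tendsto.const_mul K hn
  refine squeeze_zero' (Eventually.of_forall fun E => Finset.sum_nonneg fun _ _ =>
      dist_nonneg) ?_ h0
  refine eventually_inf_principal.2 (Eventually.of_forall fun E hE => ?_)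
  rw [Finset.mul_sum]
  exact Finset.sum_le_sum fun i hi => hh _ (hE.1 i hi).1 _ (hE.1 i hi).2

namespace IsPrimitiveOn

variable {f f' : ℝ → F} {a b : ℝ}

theorem absolutelyContinuousOnInterval_comp {X : Type*} [PseudoMetricSpace X] {Φ : F → X}
    {K : NNReal}
    (h : IsPrimitiveOn f f' a b) (hab : a ≤ b) (hΦ : LipschitzOnWith K Φ (f '' Icc a b)) :
    AbsolutelyContinuousOnInterval (fun t => Φ (f t)) a b := by
  have hn := (h.1.norm).absolutelyContinuousOnInterval_intervalIntegral (c := a) left_mem_uIcc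
  refine absolutelyContinuousOnInterval_of_dist_le (K := K) hn ?_
  rw [uIcc_of_le hab]
  intro s hs t ht
  refine (hΦ.dist_le_mul _ (mem_image_of_mem f hs) _ (mem_image_of_mem f ht)).trans ?_
  gcongr
  have ha : a ∈ Icc a b := left_mem_Icc.2 hab
  rw [dist_comm, dist_comm (∫ v in a..s, _), dist_eq_norm, dist_eq_norm, h.sub_eq hs ht,
    intervalIntegral.integral_interval_sub_left
      (h.intervalIntegrable_of_mem ha ht).norm (h.intervalIntegrable_of_mem ha hs).norm]
  exact intervalIntegral.norm_integral_le_abs_integral_norm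

/-- The fundamental theorem of calculus for absolutely continuous functions. -/
theorem of_absolutelyContinuousOnInterval [CompleteSpace F] (hab : a ≤ b)
    (h : AbsolutelyContinuousOnInterval f a b) (hf' : IntervalIntegrable f' volume a b)
    (hd : ∀ᵐ t ∂volume.restrict (Icc a b), HasDerivAt f (f' t) t) : IsPrimitiveOn f f' a b := by
  have hI : IsPrimitiveOn (fun t => ∫ τ in a..t, f' τ) f' a b := ⟨hf', fun t _ => by simp⟩
  have hIa : AbsolutelyContinuousOnInterval (fun t => ∫ τ in a..t, f' τ) a b :=
    hI.absolutelyContinuousOnInterval_comp hab (Φ := id) (K := 1) LipschitzWith.id.lipschitzOnWith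
  obtain ⟨C, hC⟩ := (h.sub hIa).const_of_ae_hasDerivAt_zero (by
    rw [uIcc_of_le hab, ← ae_restrict_iff' measurableSet_Icc]
    filter_upwards [hd, hI.ae_hasDerivAt hab] with t h1 h2
    simpa using h1.sub h2)
  rw [uIcc_of_le hab] at hC
  refine ⟨hf', fun t ht => ?_⟩
  have h1 := hC t ht
  have h2 := hC a (left_mem_Icc.2 hab)
  simp only [Pi.sub_apply, intervalIntegral.integral_same, sub_zero] at h1 h2
  rw [h2, ← h1]; abel

theorem intervalIntegrable_clm_apply {L : ℝ → F →L[ℝ] E} (hL : ContinuousOn L (Icc a b))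
    (hf' : IntervalIntegrable f' volume a b) (hab : a ≤ b) :
    IntervalIntegrable (fun t => L t (f' t)) volume a b := by
  rw [intervalIntegrable_iff_integrableOn_Icc_of_le hab] at hf' ⊢
  obtain ⟨C, hC⟩ := isCompact_Icc.exists_bound_of_continuousOn hL
  exact (ContinuousLinearMap.id ℝ (F →L[ℝ] E)).integrable_of_bilin_of_bdd_left C
    (hL.aestronglyMeasurable measurableSet_Icc)
    ((ae_restrict_iff' measurableSet_Icc).2 (Eventually.of_forall hC)) hf'

/-- The chain rule for absolutely continuous functions. -/
theorem comp [CompleteSpace E] [CompleteSpace F] (h : IsPrimitiveOn f f' a b) (hab : a ≤ b)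
    {U : Set F} (hU : IsOpen U) {Φ : F → E} (hΦ : ContDiffOn ℝ 1 Φ U) (hfU : MapsTo f (Icc a b) U) :
    IsPrimitiveOn (fun t => Φ (f t)) (fun t => fderiv ℝ Φ (f t) (f' t)) a b := by
  have hcf := h.continuousOn hab
  have hΦd : ContinuousOn (fun t => fderiv ℝ Φ (f t)) (Icc a b) :=
    (hΦ.continuousOn_fderiv_of_isOpen hU le_rfl).comp hcf hfU
  have hLip : LocallyLipschitzOn (f '' Icc a b) Φ := by
    rintro _ ⟨t, ht, rfl⟩
    obtain ⟨K, s, hs, hK⟩ := (hΦ.contDiffAt (hU.mem_nhds (hfU ht))).exists_lipschitzOnWith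
    exact ⟨K, s, mem_nhdsWithin_of_mem_nhds hs, hK⟩
  obtain ⟨K, hK⟩ := hLip.exists_lipschitzOnWith_of_compact (isCompact_Icc.image_of_continuousOn hcf)
  refine of_absolutelyContinuousOnInterval hab (h.absolutelyContinuousOnInterval_comp hab hK)
    (intervalIntegrable_clm_apply hΦd h.1 hab) ?_
  filter_upwards [h.ae_hasDerivAt hab, ae_restrict_mem measurableSet_Icc] with t h1 ht
  exact (((hΦ.contDiffAt (hU.mem_nhds (hfU ht))).differentiableAt
    (by simp)).hasFDerivAt).comp_hasDerivAt t h1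

end IsPrimitiveOn

end Primitive

/-! ### Sobolev functions on an interval -/

section MemSobolev

theorem ContinuousOn.memLp_Icc {F : Type*} [NormedAddCommGroup F] {f : ℝ → F} {a b : ℝ}
    (hf : ContinuousOn f (Icc a b)) :
    MemLp f 2 (volume.restrict (Icc a b)) := by
  obtain ⟨C, hC⟩ := isCompact_Icc.exists_bound_of_continuousOn hf
  exact MemLp.of_bound (hf.aestronglyMeasurable measurableSet_Icc) C
    ((ae_restrict_iff' measurableSet_Icc).2 (Eventually.of_forall hC))

theorem MeasureTheory.MemLp.intervalIntegrable_Icc {F : Type*} [NormedAddCommGroup F] {f : ℝ → F}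
    {a b : ℝ}
    (hf : MemLp f 2 (volume.restrict (Icc a b))) (hab : a ≤ b) : IntervalIntegrable f volume a b :=
  (intervalIntegrable_iff_integrableOn_Icc_of_le hab).2 (hf.integrable (by norm_num))

variable {E F : Type*} [NormedAddCommGroup E] [NormedSpace ℝ E]
  [NormedAddCommGroup F] [NormedSpace ℝ F]

theorem MeasureTheory.MemLp.clm_apply_Icc {f : ℝ → F} {L : ℝ → F →L[ℝ] E} {a b : ℝ}
    (hL : ContinuousOn L (Icc a b)) (hf : MemLp f 2 (volume.restrict (Icc a b))) :
    MemLp (fun t => L t (f t)) 2 (volume.restrict (Icc a b)) := by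
  obtain ⟨C, hC⟩ := isCompact_Icc.exists_bound_of_continuousOn hL
  exact (ContinuousLinearMap.id ℝ (F →L[ℝ] E)).memLp_of_bilin 2
    (memLp_top_of_bound (hL.aestronglyMeasurable measurableSet_Icc) C
      ((ae_restrict_iff' measurableSet_Icc).2 (Eventually.of_forall hC))) hf

namespace MemSobolev

variable {f : ℝ → F} {a b c d : ℝ} {k : ℕ}

theorem memLp (h : MemSobolev k a b f) (hab : a ≤ b) : MemLp f 2 (volume.restrict (Icc a b)) := by
  induction k generalizing f with
  | zero => exact h
  | succ k ih =>
    obtain ⟨f', h', hf⟩ := h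
    exact (IsPrimitiveOn.continuousOn ⟨(ih h').intervalIntegrable_Icc hab, hf⟩ hab).memLp_Icc

theorem exists_primitive (h : MemSobolev (k + 1) a b f) (hab : a ≤ b) :
    ∃ f' : ℝ → F, MemSobolev k a b f' ∧ IsPrimitiveOn f f' a b := by
  obtain ⟨f', h', hf⟩ := h
  exact ⟨f', h', (h'.memLp hab).intervalIntegrable_Icc hab, hf⟩

theorem of_primitive {f' : ℝ → F} (h : MemSobolev k a b f') (hf : IsPrimitiveOn f f' a b) :
    MemSobolev (k + 1) a b f :=
  ⟨f', h, hf.2⟩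

theorem continuousOn (h : MemSobolev (k + 1) a b f) (hab : a ≤ b) : ContinuousOn f (Icc a b) := by
  obtain ⟨f', -, hf⟩ := h.exists_primitive hab
  exact hf.continuousOn hab

theorem of_succ (h : MemSobolev (k + 1) a b f) (hab : a ≤ b) : MemSobolev k a b f := by
  induction k generalizing f with
  | zero => exact (h.continuousOn hab).memLp_Icc
  | succ k ih =>
    obtain ⟨f', h', hf⟩ := h
    exact ⟨f', ih h', hf⟩

theorem of_le {l : ℕ} (h : MemSobolev k a b f) (hab : a ≤ b) (hlk : l ≤ k) :
    MemSobolev l a b f := by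
  induction hlk with
  | refl => exact h
  | step _ ih => exact ih (h.of_succ hab)

theorem mono (h : MemSobolev k a b f) (hac : a ≤ c) (hcd : c ≤ d) (hdb : d ≤ b) :
    MemSobolev k c d f := by
  induction k generalizing f with
  | zero => exact MemLp.mono_measure (Measure.restrict_mono (Icc_subset_Icc hac hdb) le_rfl) h
  | succ k ih =>
    obtain ⟨f', h', hf⟩ := h.exists_primitive (hac.trans (hcd.trans hdb))
    exact of_primitive (ih h') (hf.mono hac hcd hdb)

theorem const (k : ℕ) (a b : ℝ) (v : F) : MemSobolev k a b (fun _ => v) := by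
  cases k with
  | zero => exact memLp_const v
  | succ k =>
    refine ⟨fun _ => 0, ?_, fun t _ => by simp⟩
    induction k with
    | zero => exact memLp_const 0
    | succ k ih => exact ⟨fun _ => 0, ih, fun t _ => by simp⟩

theorem prodMk [CompleteSpace E] [CompleteSpace F] {g : ℝ → E} (hf : MemSobolev k a b f)
    (hg : MemSobolev k a b g) (hab : a ≤ b) :
    MemSobolev k a b (fun t => (f t, g t)) := by
  induction k generalizing f g with
  | zero =>
    have h1 := (ContinuousLinearMap.inl ℝ F E).comp_memLp' hf
    have h2 := (ContinuousLinearMap.inr ℝ F E).comp_memLp' hg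
    refine (h1.add h2).ae_eq (Eventually.of_forall fun t => ?_)
    simp
  | succ k ih =>
    obtain ⟨f', h₁, hf'⟩ := hf.exists_primitive hab
    obtain ⟨g', h₂, hg'⟩ := hg.exists_primitive hab
    exact of_primitive (ih h₁ h₂) (hf'.prodMk hg' hab)

end MemSobolev

theorem ContDiffOn.fderiv_apply_prod {E F : Type*} [NormedAddCommGroup E] [NormedSpace ℝ E]
    [NormedAddCommGroup F] [NormedSpace ℝ F] {U : Set F} (hU : IsOpen U) {Φ : F → E}
    (hΦ : ContDiffOn ℝ ∞ Φ U) :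
    ContDiffOn ℝ ∞ (fun p : F × F => fderiv ℝ Φ p.1 p.2) (U ×ˢ univ) := by
  have h1 : ContDiffOn ℝ ∞ (fderiv ℝ Φ) U := hΦ.fderiv_of_isOpen hU (by simp)
  exact (h1.comp contDiff_fst.contDiffOn (fun p hp => hp.1)).clm_apply contDiff_snd.contDiffOn

namespace MemSobolev

/-- Sobolev functions of positive order are stable under composition with smooth maps. -/
theorem comp [CompleteSpace E] {F : Type*} [NormedAddCommGroup F] [NormedSpace ℝ F]
    [CompleteSpace F] {a b : ℝ}
    (hab : a ≤ b) {k : ℕ} {f : ℝ → F} (h : MemSobolev (k + 1) a b f) {U : Set F} (hU : IsOpen U)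
    {Φ : F → E} (hΦ : ContDiffOn ℝ ∞ Φ U) (hfU : MapsTo f (Icc a b) U) :
    MemSobolev (k + 1) a b (fun t => Φ (f t)) := by
  induction k generalizing F with
  | zero =>
    obtain ⟨f', h', hf⟩ := h.exists_primitive hab
    refine of_primitive ?_ (hf.comp hab hU (hΦ.of_le (by exact_mod_cast le_top)) hfU)
    exact MemLp.clm_apply_Icc ((hΦ.continuousOn_fderiv_of_isOpen hU (by simp)).comp
      (hf.continuousOn hab) hfU) h'
  | succ k ih =>
    obtain ⟨f', h', hf⟩ := h.exists_primitive hab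
    refine of_primitive ?_ (hf.comp hab hU (hΦ.of_le (by exact_mod_cast le_top)) hfU)
    exact ih (f := fun t => (f t, f' t)) ((h.of_succ hab).prodMk h' hab) (hU.prod isOpen_univ)
      (hΦ.fderiv_apply_prod hU) (fun t ht => ⟨hfU ht, mem_univ _⟩)

/-- The product of a function of class `H^{k+1}` with a function of class `H^k` is of
class `H^k`. -/
theorem clm_apply [CompleteSpace E] [CompleteSpace F] {k : ℕ} {a b : ℝ} (hab : a ≤ b)
    {L : ℝ → F →L[ℝ] E} {f : ℝ → F}
    (hL : MemSobolev (k + 1) a b L) (hf : MemSobolev k a b f) :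
    MemSobolev k a b (fun t => L t (f t)) := by
  cases k with
  | zero => exact MemLp.clm_apply_Icc (hL.continuousOn hab) hf
  | succ k =>
    exact ((hL.of_succ hab).prodMk hf hab).comp hab (U := univ) isOpen_univ
      (Φ := fun p : (F →L[ℝ] E) × F => p.1 p.2)
      (contDiff_fst.clm_apply contDiff_snd).contDiffOn (mapsTo_univ _ _)

/-- Bootstrapping for the equation `x' = Ψ(x, u)`: if `u` is of class `H^s`, then `x` is of class
`H^{s+1}`. -/
theorem of_ode [CompleteSpace E] [CompleteSpace F] {s : ℕ} {a b : ℝ} (hab : a ≤ b) {x : ℝ → F}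
    {u : ℝ → E} {U : Set F} (hU : IsOpen U)
    {Ψ : F × E → F} (hΨ : ContDiffOn ℝ ∞ Ψ (U ×ˢ univ)) (hxU : MapsTo x (Icc a b) U)
    (hu : MemSobolev s a b u) (hx : IsPrimitiveOn x (fun t => Ψ (x t, u t)) a b)
    (h2 : MemLp (fun t => Ψ (x t, u t)) 2 (volume.restrict (Icc a b))) :
    MemSobolev (s + 1) a b x := by
  suffices ∀ k ≤ s, MemSobolev (k + 1) a b x from this s le_rfl
  intro k
  induction k with
  | zero => exact fun _ => of_primitive (k := 0) h2 hx
  | succ k ih =>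
    intro hk
    exact of_primitive (((ih (by omega)).prodMk (hu.of_le hab hk) hab).comp hab
      (hU.prod isOpen_univ) hΨ (fun t ht => ⟨hxU ht, mem_univ _⟩)) hx

end MemSobolev

end MemSobolev

section SobolevSpace

variable {F : Type*} [NormedAddCommGroup F] [NormedSpace ℝ F]

namespace SobolevSpace

variable {s : ℕ}

/-- The absolutely continuous representative of a derivative of order less than `s` of an element
of `H^s`. -/
theorem exists_isPrimitiveOn (u : SobolevSpace F s) (k : Fin s) :
    ∃ f : ℝ → F, IsPrimitiveOn f (u.1 k.succ) 0 1 ∧ f =ᵐ[unitVol] u.1 k.castSucc := by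
  obtain ⟨c, hc⟩ := u.2 k
  refine ⟨fun t => c + ∫ τ in (0 : ℝ)..t, u.1 k.succ τ, ⟨?_, fun t _ => by simp⟩, ?_⟩
  · exact (Lp.memLp (u.1 k.succ)).intervalIntegrable_Icc zero_le_one
  · filter_upwards [hc] with t ht using ht.symm

/-- Every element of the Sobolev space is represented by a Sobolev function. -/
theorem exists_memSobolev (u : SobolevSpace F s) :
    ∃ f : ℝ → F, MemSobolev s 0 1 f ∧ f =ᵐ[unitVol] u.1 0 := by
  suffices ∀ (j : ℕ) (i : Fin (s + 1)), i.1 + j = s →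
      ∃ f : ℝ → F, MemSobolev j 0 1 f ∧ f =ᵐ[unitVol] u.1 i from this s 0 (by simp)
  intro j
  induction j with
  | zero => exact fun i _ => ⟨u.1 i, Lp.memLp (u.1 i), EventuallyEq.rfl⟩
  | succ j ih =>
    intro i hi
    obtain ⟨f', hf', hfu⟩ := ih ⟨i.1 + 1, by omega⟩ (by simp; omega)
    obtain ⟨f, hf, hfi⟩ := exists_isPrimitiveOn u ⟨i.1, by omega⟩
    exact ⟨f, MemSobolev.of_primitive hf' (hf.congr_ae zero_le_one hfu.symm), hfi⟩

/-- A Sobolev function determines an element of the Sobolev space. -/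
theorem exists_of_memSobolev {f : ℝ → F} (hf : MemSobolev s 0 1 f) :
    ∃ u : SobolevSpace F s, u.1 0 =ᵐ[unitVol] f := by
  induction s generalizing f with
  | zero =>
    have hfm : MemLp f 2 unitVol := hf
    exact ⟨⟨fun _ => hfm.toLp f, fun k => k.elim0⟩, hfm.coeFn_toLp⟩
  | succ s ih =>
    obtain ⟨f', h', hp⟩ := hf.exists_primitive zero_le_one
    obtain ⟨u, hu⟩ := ih h'
    have hp' := hp.congr_ae zero_le_one hu.symm
    have hfm := hf.memLp zero_le_one
    refine ⟨⟨Fin.cons (hfm.toLp f) u.1, fun k => ?_⟩, hfm.coeFn_toLp⟩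
    refine Fin.cases ?_ (fun k => ?_) k
    · refine ⟨f 0, ?_⟩
      filter_upwards [hfm.coeFn_toLp, ae_restrict_mem measurableSet_Icc] with t h1 h2
      have := hp'.2 t h2
      simpa [h1] using this
    · simpa using u.2 k

end SobolevSpace

end SobolevSpace

/-! ### Operators on curves of class `L²` -/

section Operators

variable {E F H : Type*} [NormedAddCommGroup E] [NormedSpace ℝ E]
  [NormedAddCommGroup F] [NormedSpace ℝ F] [NormedAddCommGroup H] [NormedSpace ℝ H]

instance : IsProbabilityMeasure unitVol := ⟨by simp⟩

theorem integral_norm_le_norm_Lp {F : Type*} [NormedAddCommGroup F] (u : Lp F 2 unitVol) :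
    ∫ t, ‖u t‖ ∂unitVol ≤ ‖u‖ := by
  have h2 := Lp.memLp u
  rw [integral_norm_eq_lintegral_enorm h2.1, ← eLpNorm_one_eq_lintegral_enorm, Lp.norm_def]
  exact ENNReal.toReal_mono h2.2.ne (eLpNorm_le_eLpNorm_of_exponent_le (by norm_num) h2.1)

theorem norm_intervalIntegral_le_norm_Lp (u : Lp F 2 unitVol) {t : ℝ} (ht : t ∈ Icc (0 : ℝ) 1) :
    ‖∫ τ in (0 : ℝ)..t, u τ‖ ≤ ‖u‖ := by
  rw [intervalIntegral.integral_of_le ht.1]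
  refine (norm_integral_le_integral_norm _).trans (le_trans ?_ (integral_norm_le_norm_Lp u))
  exact setIntegral_mono_set ((Lp.memLp u).integrable (by norm_num)).norm
    (Eventually.of_forall fun _ => norm_nonneg _)
    (LE.le.eventuallyLE (Ioc_subset_Icc_self.trans (Icc_subset_Icc_right ht.2)))

theorem isPrimitiveOn_integral_Lp (u : Lp F 2 unitVol) (c : F) :
    IsPrimitiveOn (fun t => c + ∫ τ in (0 : ℝ)..t, u τ) u 0 1 :=
  ⟨(Lp.memLp u).intervalIntegrable_Icc zero_le_one, fun t _ => by simp⟩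

theorem intervalIntegral_congr_unitVol {f g : ℝ → F} (h : f =ᵐ[unitVol] g) {t : ℝ}
    (ht : t ∈ Icc (0 : ℝ) 1) : ∫ τ in (0 : ℝ)..t, f τ = ∫ τ in (0 : ℝ)..t, g τ := by
  apply intervalIntegral.integral_congr_ae_restrict
  rw [uIoc_of_le ht.1]
  exact ae_mono (Measure.restrict_mono
    (Ioc_subset_Icc_self.trans (Icc_subset_Icc_right ht.2)) le_rfl) h

theorem intervalIntegrable_Lp (u : Lp F 2 unitVol) {t : ℝ} (ht : t ∈ Icc (0 : ℝ) 1) :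
    IntervalIntegrable u volume 0 t :=
  (isPrimitiveOn_integral_Lp u 0).intervalIntegrable_of_mem (left_mem_Icc.2 zero_le_one) ht

/-- The operator sending `u ∈ L²([0,1], F)` to the curve `t ↦ ∫_0^t u`. -/
def integralPath : Lp F 2 unitVol →L[ℝ] C(Icc (0 : ℝ) 1, F) :=
  LinearMap.mkContinuous
    { toFun := fun u => ⟨fun t => ∫ τ in (0 : ℝ)..t, u τ, by
        have := ((isPrimitiveOn_integral_Lp u 0).continuousOn zero_le_one).domRestrict
        simpa [Function.comp_def, Set.domRestrict_def] using this⟩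
      map_add' := fun u v => by
        ext t
        simp only [ContinuousMap.coe_mk, ContinuousMap.add_apply]
        rw [intervalIntegral_congr_unitVol (Lp.coeFn_add u v) t.2,
          ← intervalIntegral.integral_add (intervalIntegrable_Lp u t.2)
            (intervalIntegrable_Lp v t.2)]
        rfl
      map_smul' := fun c u => by
        ext t
        simp only [ContinuousMap.coe_mk, ContinuousMap.smul_apply, RingHom.id_apply]
        rw [intervalIntegral_congr_unitVol (Lp.coeFn_smul c u) t.2,
          ← intervalIntegral.integral_smul]
        rfl } 1 (fun u => by
        rw [one_mul, ContinuousMap.norm_le _ (norm_nonneg _)]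
        exact fun t => norm_intervalIntegral_le_norm_Lp u t.2)

/-- The integral over `[0,1]` as a continuous functional on `L²([0,1], F)`. -/
def integralLp : Lp F 2 unitVol →L[ℝ] F :=
  (ContinuousMap.evalCLM ℝ (⟨1, right_mem_Icc.2 zero_le_one⟩ : Icc (0 : ℝ) 1)).comp integralPath

theorem integralLp_apply (u : Lp F 2 unitVol) : integralLp u = ∫ τ in (0 : ℝ)..1, u τ := rfl

/-- The class in `L^∞([0,1], F)` of a continuous curve. -/
def curveToLp : C(Icc (0 : ℝ) 1, F) →L[ℝ] Lp F ⊤ unitVol :=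
  (BoundedContinuousFunction.toLp ⊤ unitVol ℝ).comp
    ((BoundedContinuousFunction.compContinuousCLM F ℝ
        (ContinuousMap.projIccCM (a := (0 : ℝ)) (b := 1))).comp
      ((ContinuousMap.linearIsometryBoundedOfCompact (Icc (0 : ℝ) 1) F
        ℝ).toContinuousLinearEquiv : C(Icc (0 : ℝ) 1, F) →L[ℝ] _))

theorem coeFn_curveToLp (x : C(Icc (0 : ℝ) 1, F)) :
    curveToLp x =ᵐ[unitVol] IccExtend zero_le_one x :=
  BoundedContinuousFunction.coeFn_toLp _ _ _ _

/-- Multiplication of a continuous curve with a curve of class `L²` by means of a bilinear map. -/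
def mulLp (b : E →L[ℝ] F →L[ℝ] H) :
    C(Icc (0 : ℝ) 1, E) →L[ℝ] Lp F 2 unitVol →L[ℝ] Lp H 2 unitVol :=
  (b.holderL unitVol ⊤ 2 2).comp curveToLp

theorem coeFn_mulLp (b : E →L[ℝ] F →L[ℝ] H) (x : C(Icc (0 : ℝ) 1, E)) (u : Lp F 2 unitVol) :
    mulLp b x u =ᵐ[unitVol] fun t => b (IccExtend zero_le_one x t) (u t) := by
  have h1 : mulLp b x u =ᵐ[unitVol] _ := b.coeFn_holder (r := 2) (curveToLp x) u
  filter_upwards [h1, coeFn_curveToLp x] with t h1 h2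
  rw [h1, h2]

/-- The curve in `C([0,1], F)` defined by a function which is continuous on `[0,1]`. -/
def curveOfContinuousOn {F : Type*} [NormedAddCommGroup F] {f : ℝ → F}
    (hf : ContinuousOn f (Icc 0 1)) : C(Icc (0 : ℝ) 1, F) :=
  ⟨(Icc 0 1).domRestrict f, hf.domRestrict⟩

theorem IccExtend_curveOfContinuousOn {F : Type*} [NormedAddCommGroup F] {f : ℝ → F}
    (hf : ContinuousOn f (Icc 0 1)) {t : ℝ}
    (ht : t ∈ Icc (0 : ℝ) 1) : IccExtend zero_le_one (curveOfContinuousOn hf) t = f t := by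
  rw [IccExtend_of_mem _ _ ht]
  rfl

/-- Multiplication of `u ∈ L²([0,1], F)` by a continuous operator valued function. -/
theorem coeFn_mulLp_curveOfContinuousOn {L : ℝ → F →L[ℝ] H} (hL : ContinuousOn L (Icc 0 1))
    (u : Lp F 2 unitVol) :
    mulLp (ContinuousLinearMap.id ℝ (F →L[ℝ] H)) (curveOfContinuousOn hL) u =ᵐ[unitVol]
      fun t => L t (u t) := by
  filter_upwards [coeFn_mulLp (ContinuousLinearMap.id ℝ (F →L[ℝ] H)) (curveOfContinuousOn hL) u,
    ae_restrict_mem measurableSet_Icc] with t h1 ht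
  rw [h1, IccExtend_curveOfContinuousOn hL ht]
  rfl

end Operators

/-! ### Smoothness of composition operators -/

universe u

section Nemytskii

variable {K : Type*} [TopologicalSpace K] [CompactSpace K]

/-- Pointwise application of a continuous family of operators. -/
def applyCurve (K : Type*) [TopologicalSpace K] [CompactSpace K]
    (E F : Type*) [NormedAddCommGroup E] [NormedSpace ℝ E]
    [NormedAddCommGroup F] [NormedSpace ℝ F] : C(K, E →L[ℝ] F) →L[ℝ] C(K, E) →L[ℝ] C(K, F) :=
  LinearMap.mkContinuous₂
    (LinearMap.mk₂ ℝ (fun (L : C(K, E →L[ℝ] F)) (x : C(K, E)) =>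
      (⟨fun t => L t (x t), by fun_prop⟩ : C(K, F)))
      (fun _ _ _ => by ext; simp) (fun _ _ _ => by ext; simp)
      (fun _ _ _ => by ext; simp) (fun _ _ _ => by ext; simp)) 1 (fun L x => by
    rw [ContinuousMap.norm_le _ (by positivity), one_mul]
    exact fun t => (L t).le_of_opNorm_le_of_le (L.norm_coe_le_norm t) (x.norm_coe_le_norm t))

variable {E F : Type*} [NormedAddCommGroup E] [NormedSpace ℝ E]
    [NormedAddCommGroup F] [NormedSpace ℝ F]

theorem hasFDerivAt_postcomp {A : C(E, F)} {A' : C(E, E →L[ℝ] F)}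
    (hA : ∀ x, HasFDerivAt A (A' x) x) (x : C(K, E)) :
    HasFDerivAt (fun y : C(K, E) => A.comp y) (applyCurve K E F (A'.comp x)) x := by
  rw [hasFDerivAt_iff_isLittleO_nhds_zero, Asymptotics.isLittleO_iff]
  intro ε hε
  have hc : ContinuousAt (fun y : C(K, E) => A'.comp y) x :=
    (ContinuousMap.continuous_postcomp A').continuousAt
  obtain ⟨δ, hδ, hx⟩ := (Metric.continuousAt_iff (f := fun y : C(K, E) => A'.comp y)).1 hc ε hε
  filter_upwards [Metric.ball_mem_nhds 0 hδ] with h hh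
  rw [mem_ball_zero_iff] at hh
  rw [ContinuousMap.norm_le _ (by positivity)]
  intro t
  -- the segment from `x t` to `x t + h t` is controlled by evaluating `A'` along `x + θ h`
  have hseg : ∀ y ∈ segment ℝ (x t) (x t + h t), ‖A' y - A' (x t)‖ ≤ ε := by
    intro y hy
    rw [segment_eq_image'] at hy
    obtain ⟨θ, hθ, rfl⟩ := hy
    have h1 : dist (x + θ • h) x < δ := by
      rw [dist_eq_norm, add_sub_cancel_left, norm_smul, Real.norm_of_nonneg hθ.1]
      exact (mul_le_of_le_one_left (norm_nonneg _) hθ.2).trans_lt hh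
    have h3 : ‖A'.comp (x + θ • h) - A'.comp x‖ ≤ ε :=
      (dist_eq_norm (A'.comp (x + θ • h)) (A'.comp x)).symm.trans_le (hx h1).le
    have h2 := (ContinuousMap.norm_coe_le_norm (A'.comp (x + θ • h) - A'.comp x) t).trans h3
    simpa using h2
  have := (convex_segment (𝕜 := ℝ) (x t) (x t + h t)).norm_image_sub_le_of_norm_hasFDerivWithin_le'
    (fun y _ => (hA y).hasFDerivWithinAt) hseg (left_mem_segment ℝ _ _) (right_mem_segment ℝ _ _)
  simp only [add_sub_cancel_left] at this
  exact this.trans (mul_le_mul_of_nonneg_left (h.norm_coe_le_norm t) hε.le)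

/-- Composition with a smooth map is a smooth operator on continuous curves. -/
theorem contDiff_postcomp {E F : Type u} [NormedAddCommGroup E] [NormedSpace ℝ E]
    [NormedAddCommGroup F] [NormedSpace ℝ F] (A : C(E, F)) (hA : ContDiff ℝ ∞ A) :
    ContDiff ℝ ∞ (fun y : C(K, E) => A.comp y) := by
  rw [contDiff_infty]
  intro n
  induction n generalizing F with
  | zero => exact contDiff_zero.2 (ContinuousMap.continuous_postcomp A)
  | succ n ih =>
    have h' := (contDiff_infty_iff_fderiv.1 hA).2
    let A' : C(E, E →L[ℝ] F) := ⟨fderiv ℝ A, h'.continuous⟩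
    exact contDiff_succ_iff_hasFDerivAt.2 ⟨fun x => applyCurve K E F (A'.comp x),
      ContDiff.comp (g := applyCurve K E F) (ContinuousLinearMap.contDiff _) (ih A' h'),
      hasFDerivAt_postcomp fun x => (hA.differentiable (by simp) x).hasFDerivAt⟩

end Nemytskii

/-! ### Solving a differential equation with square integrable controls -/

section LocalODE

variable {E : Type*} [NormedAddCommGroup E] [NormedSpace ℝ E] [FiniteDimensional ℝ E]

/-- A smooth map on an open set agrees near a given point with a globally defined smooth map. -/
theorem exists_contDiff_eventuallyEq {F : Type*} [NormedAddCommGroup F] [NormedSpace ℝ F]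
    {U : Set E} (hU : IsOpen U) {p : E} (hp : p ∈ U) {A : E → F} (hA : ContDiffOn ℝ ∞ A U) :
    ∃ A' : E → F, ContDiff ℝ ∞ A' ∧ A' =ᶠ[𝓝 p] A := by
  obtain ⟨r, hr, hrU⟩ := Metric.nhds_basis_closedBall.mem_iff.1 (hU.mem_nhds hp)
  let f : ContDiffBump p := ⟨r / 2, r, half_pos hr, half_lt_self hr⟩
  refine ⟨fun x => f x • A x, contDiff_iff_contDiffAt.2 fun x => ?_, ?_⟩
  · by_cases hx : x ∈ tsupport f
    · rw [f.tsupport_eq] at hx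
      exact f.contDiff.contDiffAt.smul (hA.contDiffAt (hU.mem_nhds (hrU hx)))
    · refine (contDiffAt_const (c := (0 : F))).congr_of_eventuallyEq ?_
      filter_upwards [notMem_tsupport_iff_eventuallyEq.1 hx] with z hz
      simp [hz]
  · filter_upwards [f.eventuallyEq_one] with x hx
    simp [hx]

/-- The controlled equation `x' = A(x) u`, `x(0) = p`, with `A(p) = id`, has a solution for every
small `u ∈ L²`, and the solution depends smoothly on `u` at `0`. The unknown is the derivative
`y = x'` of the solution, to which the implicit function theorem in `L²` applies. -/
theorem exists_smooth_solution {U : Set E} (hU : IsOpen U) {p : E} (hp : p ∈ U)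
    {A : E → E →L[ℝ] E} (hA : ContDiffOn ℝ ∞ A U) (hAp : A p = ContinuousLinearMap.id ℝ E) :
    ∃ y : Lp E 2 unitVol → Lp E 2 unitVol, ContDiffAt ℝ ∞ y 0 ∧
      HasFDerivAt y (ContinuousLinearMap.id ℝ (Lp E 2 unitVol)) 0 ∧ y 0 = 0 ∧
      ∀ᶠ u in 𝓝 0, (∀ t ∈ Icc (0 : ℝ) 1, p + ∫ τ in (0 : ℝ)..t, y u τ ∈ U) ∧
        y u =ᵐ[unitVol] fun t => A (p + ∫ τ in (0 : ℝ)..t, y u τ) (u t) := by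
  obtain ⟨A', hA', hAA'⟩ := exists_contDiff_eventuallyEq hU hp hA
  let A₀ : C(E, E →L[ℝ] E) := ⟨A', hA'.continuous⟩
  let path : Lp E 2 unitVol → C(Icc (0 : ℝ) 1, E) := fun y =>
    ContinuousMap.const _ p + integralPath y
  have hpath : ContDiff ℝ ∞ path :=
    contDiff_const.add (ContinuousLinearMap.contDiff (integralPath (F := E)))
  let N : Lp E 2 unitVol → (Lp E 2 unitVol →L[ℝ] Lp E 2 unitVol) := fun y =>
    mulLp (ContinuousLinearMap.id ℝ (E →L[ℝ] E)) (A₀.comp (path y))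
  have hN : ContDiff ℝ ∞ N :=
    ContDiff.comp (g := mulLp (ContinuousLinearMap.id ℝ (E →L[ℝ] E)))
      (ContinuousLinearMap.contDiff _) ((contDiff_postcomp A₀ hA').comp hpath)
  have hN0 : N 0 = ContinuousLinearMap.id ℝ _ := by
    ext1 u
    refine Lp.ext ?_
    filter_upwards [coeFn_mulLp (ContinuousLinearMap.id ℝ (E →L[ℝ] E)) (A₀.comp (path 0)) u,
      ae_restrict_mem measurableSet_Icc] with t ht hm
    rw [ht, IccExtend_of_mem _ _ hm]
    simp [A₀, path, hAA'.self_of_nhds, hAp]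
  let Ψ : Lp E 2 unitVol × Lp E 2 unitVol → Lp E 2 unitVol := fun q => q.2 - N q.2 q.1
  have hΨ : ContDiff ℝ ∞ Ψ := contDiff_snd.sub ((hN.comp contDiff_snd).clm_apply contDiff_fst)
  have hΨ' : HasFDerivAt Ψ (ContinuousLinearMap.snd ℝ (Lp E 2 unitVol) (Lp E 2 unitVol) -
      ContinuousLinearMap.fst ℝ (Lp E 2 unitVol) (Lp E 2 unitVol)) (0, 0) := by
    have h1 : HasFDerivAt (fun q : Lp E 2 unitVol × Lp E 2 unitVol => N q.2)
        ((fderiv ℝ N 0).comp (ContinuousLinearMap.snd ℝ _ _)) (0, 0) :=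
      HasFDerivAt.comp (f := Prod.snd) ((0, 0) : Lp E 2 unitVol × Lp E 2 unitVol)
        ((hN.differentiable (by simp)) 0).hasFDerivAt hasFDerivAt_snd
    have h2 := hasFDerivAt_snd.sub (h1.clm_apply hasFDerivAt_fst)
    refine h2.congr_fderiv ?_
    refine ContinuousLinearMap.ext fun q => ?_
    simp [hN0]
  have hfd := hΨ'.fderiv
  have hinr : fderiv ℝ Ψ (0, 0) ∘L .inr ℝ _ _ = ContinuousLinearMap.id ℝ (Lp E 2 unitVol) := by
    rw [hfd]; ext1 y; simp
  have hinl : fderiv ℝ Ψ (0, 0) ∘L .inl ℝ _ _ = -ContinuousLinearMap.id ℝ (Lp E 2 unitVol) := by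
    rw [hfd]; ext1 y; simp
  have hinv : (fderiv ℝ Ψ (0, 0) ∘L .inr ℝ _ _).IsInvertible := by
    rw [hinr]; exact ⟨ContinuousLinearEquiv.refl ℝ _, rfl⟩
  have hc : ContDiffAt ℝ ∞ Ψ (0, 0) := hΨ.contDiffAt
  have hn : (∞ : WithTop ℕ∞) ≠ 0 := by simp
  have hys : ContDiffAt ℝ ∞ (hc.implicitFunction hn hinv) 0 :=
      hc.contDiffAt_implicitFunction hn hinv
  have hy0 : hc.implicitFunction hn hinv 0 = 0 := hc.implicitFunction_apply_self hn hinv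
  refine ⟨hc.implicitFunction hn hinv, hys, ?_, hy0, ?_⟩
  · have := (hc.hasStrictFDerivAt_implicitFunction hn hinv).hasFDerivAt
    refine this.congr_fderiv ?_
    rw [hinl, hinr]
    ext1 u
    simp
  · have hev := hc.eventually_apply_implicitFunction hn hinv
    obtain ⟨V, hV, hVo, hpV⟩ := mem_nhds_iff.1 (hAA'.and (hU.mem_nhds hp))
    obtain ⟨r, hr, hrV⟩ := Metric.mem_nhds_iff.1 (hVo.mem_nhds hpV)
    have hball : ∀ᶠ u in 𝓝 (0 : Lp E 2 unitVol), ‖hc.implicitFunction hn hinv u‖ < r := by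
      have := hys.continuousAt.norm
      rw [ContinuousAt, hy0, norm_zero] at this
      exact this.eventually (gt_mem_nhds hr)
    filter_upwards [hev, hball] with u hu hub
    have hmem : ∀ t ∈ Icc (0 : ℝ) 1, p + ∫ τ in (0 : ℝ)..t, hc.implicitFunction hn hinv u τ ∈ V :=
      fun t ht => hrV (by
        rw [mem_ball_iff_norm, add_sub_cancel_left]
        exact (norm_intervalIntegral_le_norm_Lp _ ht).trans_lt hub)
    refine ⟨fun t ht => (hV (hmem t ht)).2, ?_⟩
    have hu' : hc.implicitFunction hn hinv u = N (hc.implicitFunction hn hinv u) u := by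
      have : Ψ (u, hc.implicitFunction hn hinv u) = 0 := by rw [hu]; simp [Ψ]
      exact sub_eq_zero.1 this
    have hae : hc.implicitFunction hn hinv u =ᵐ[unitVol] N (hc.implicitFunction hn hinv u) u := by
      rw [← hu']
    filter_upwards [hae, coeFn_mulLp (ContinuousLinearMap.id ℝ (E →L[ℝ] E))
      (A₀.comp (path (hc.implicitFunction hn hinv u))) u,
      ae_restrict_mem measurableSet_Icc] with t h1 h2 hm
    rw [h1]
    refine h2.trans ?_
    rw [IccExtend_of_mem _ _ hm, ← (hV (hmem t hm)).1]
    rfl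

end LocalODE

/-! ### Calculus on a Lie group -/

section TangentDerivative

variable {E₁ H₁ M₁ E₂ H₂ M₂ E₃ H₃ M₃ : Type*}
  [NormedAddCommGroup E₁] [NormedSpace ℝ E₁] [TopologicalSpace H₁] {I₁ : ModelWithCorners ℝ E₁ H₁}
  [TopologicalSpace M₁] [ChartedSpace H₁ M₁]
  [NormedAddCommGroup E₂] [NormedSpace ℝ E₂] [TopologicalSpace H₂] {I₂ : ModelWithCorners ℝ E₂ H₂}
  [TopologicalSpace M₂] [ChartedSpace H₂ M₂]
  [NormedAddCommGroup E₃] [NormedSpace ℝ E₃] [TopologicalSpace H₃] {I₃ : ModelWithCorners ℝ E₃ H₃}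
  [TopologicalSpace M₃] [ChartedSpace H₃ M₃]

variable (I₁ I₂) in
/-- The differential of `f` at `x`, as a map between the model spaces. All tangent spaces are copies
of the model space; forgetting the base points makes it possible to rewrite them. -/
def tderiv (f : M₁ → M₂) (x : M₁) : E₁ →L[ℝ] E₂ := mfderiv I₁ I₂ f x

theorem tderiv_comp {g : M₂ → M₃} {f : M₁ → M₂} (x : M₁) (hg : MDifferentiableAt I₂ I₃ g (f x))
    (hf : MDifferentiableAt I₁ I₂ f x) :
    tderiv I₁ I₃ (fun y => g (f y)) x = (tderiv I₂ I₃ g (f x)).comp (tderiv I₁ I₂ f x) :=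
  mfderiv_comp x hg hf

theorem tderiv_id (x : M₁) : tderiv I₁ I₁ (fun y => y) x = ContinuousLinearMap.id ℝ E₁ :=
  mfderiv_id

theorem tderiv_const (x : M₁) (c : M₂) : tderiv I₁ I₂ (fun _ => c) x = 0 :=
  mfderiv_const

theorem tderiv_congr {f g : M₁ → M₂} {x : M₁} (h : f =ᶠ[𝓝 x] g) :
    tderiv I₁ I₂ f x = tderiv I₁ I₂ g x :=
  h.mfderiv_eq

end TangentDerivative

section LieCalculus

variable {E : Type*} [NormedAddCommGroup E] [NormedSpace ℝ E]
  {G : Type*} [TopologicalSpace G] [ChartedSpace E G]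

theorem tderiv_vectorSpace {F : Type*} [NormedAddCommGroup F] [NormedSpace ℝ F] (f : E → F)
    (x : E) :
    tderiv 𝓘(ℝ, E) 𝓘(ℝ, F) f x = fderiv ℝ f x :=
  mfderiv_eq_fderiv

theorem isOpen_chart_target (a : G) : IsOpen (extChartAt 𝓘(ℝ, E) a).target :=
  isOpen_extChartAt_target a

variable [IsManifold 𝓘(ℝ, E) ∞ G]

theorem contMDiffAt_chart {c a : G} (ha : a ∈ (extChartAt 𝓘(ℝ, E) c).source) :
    ContMDiffAt 𝓘(ℝ, E) 𝓘(ℝ, E) ∞ (extChartAt 𝓘(ℝ, E) c) a :=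
  contMDiffAt_extChartAt' (by rwa [extChartAt_source] at ha)

theorem contMDiffAt_chart_symm {c : G} {x : E} (hx : x ∈ (extChartAt 𝓘(ℝ, E) c).target) :
    ContMDiffAt 𝓘(ℝ, E) 𝓘(ℝ, E) ∞ (extChartAt 𝓘(ℝ, E) c).symm x :=
  (contMDiffOn_extChartAt_symm c).contMDiffAt ((isOpen_chart_target c).mem_nhds hx)

/-- A smooth map on `G × G` is smooth when read in charts. -/
theorem contDiffAt_chart_comp₂ {Φ : G × G → G}
    (hΦ : ContMDiff (𝓘(ℝ, E).prod 𝓘(ℝ, E)) 𝓘(ℝ, E) ∞ Φ) {a b c : G} {z : E × E}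
    (hz₁ : z.1 ∈ (extChartAt 𝓘(ℝ, E) a).target) (hz₂ : z.2 ∈ (extChartAt 𝓘(ℝ, E) b).target)
    (hc : Φ ((extChartAt 𝓘(ℝ, E) a).symm z.1, (extChartAt 𝓘(ℝ, E) b).symm z.2) ∈
      (extChartAt 𝓘(ℝ, E) c).source) :
    ContDiffAt ℝ ∞ (fun w : E × E => extChartAt 𝓘(ℝ, E) c
      (Φ ((extChartAt 𝓘(ℝ, E) a).symm w.1, (extChartAt 𝓘(ℝ, E) b).symm w.2))) z := by
  have h1 : ContMDiffAt 𝓘(ℝ, E × E) 𝓘(ℝ, E) ∞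
      (fun w : E × E => (extChartAt 𝓘(ℝ, E) a).symm w.1) z :=
    ContMDiffAt.comp (f := Prod.fst) z
      (contMDiffAt_chart_symm hz₁) contDiff_fst.contMDiff.contMDiffAt
  have h2 : ContMDiffAt 𝓘(ℝ, E × E) 𝓘(ℝ, E) ∞
      (fun w : E × E => (extChartAt 𝓘(ℝ, E) b).symm w.2) z :=
    ContMDiffAt.comp (f := Prod.snd) z
      (contMDiffAt_chart_symm hz₂) contDiff_snd.contMDiff.contMDiffAt
  have h3 := ContMDiffAt.comp z hΦ.contMDiffAt (h1.prodMk h2)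
  exact (ContMDiffAt.comp z (contMDiffAt_chart hc) h3).contDiffAt

/-- The differential at a point `b`, read in charts. -/
theorem tderiv_chart_comp {b c : G} {f : G → G} (hf : MDifferentiableAt 𝓘(ℝ, E) 𝓘(ℝ, E) f b)
    (hc : f b ∈ (extChartAt 𝓘(ℝ, E) c).source) (w : E) :
    tderiv 𝓘(ℝ, E) 𝓘(ℝ, E) (extChartAt 𝓘(ℝ, E) c) (f b) (tderiv 𝓘(ℝ, E) 𝓘(ℝ, E) f b w) =
      fderiv ℝ (fun x => extChartAt 𝓘(ℝ, E) c (f ((extChartAt 𝓘(ℝ, E) b).symm x)))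
        (extChartAt 𝓘(ℝ, E) b b) w := by
  have hd := (contMDiffAt_chart hc).mdifferentiableAt (by simp)
  have h1 := tderiv_comp b hd hf
  rw [← ContinuousLinearMap.comp_apply, ← h1]
  have h2 : MDifferentiableAt 𝓘(ℝ, E) 𝓘(ℝ, E) (fun y => extChartAt 𝓘(ℝ, E) c (f y)) b :=
    hd.comp b hf
  have h3 : tderiv 𝓘(ℝ, E) 𝓘(ℝ, E) (fun y => extChartAt 𝓘(ℝ, E) c (f y)) b = fderivWithin ℝ
      (fun x => extChartAt 𝓘(ℝ, E) c (f ((extChartAt 𝓘(ℝ, E) b).symm x))) univ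
      (extChartAt 𝓘(ℝ, E) b b) := by
    have := h2.mfderiv
    rw [modelWithCornersSelf_coe, range_id] at this
    exact this
  rw [h3, fderivWithin_univ]

end LieCalculus

section LieGroupCalculus

variable {E : Type*} [NormedAddCommGroup E] [NormedSpace ℝ E]
  {G : Type*} [TopologicalSpace G] [ChartedSpace E G] [Group G]

/-- The differential of the left translation by `a` at `b`. -/
def dLeft (a b : G) : E →L[ℝ] E := tderiv 𝓘(ℝ, E) 𝓘(ℝ, E) (fun x : G => a * x) b

/-- The differential of the right translation by `a` at `b`. -/
def dRight (a b : G) : E →L[ℝ] E := tderiv 𝓘(ℝ, E) 𝓘(ℝ, E) (fun x : G => x * a) b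

/-- The adjoint representation with values in the endomorphisms of the model space. -/
def AdL (a : G) : E →L[ℝ] E := tderiv 𝓘(ℝ, E) 𝓘(ℝ, E) (fun x : G => a * x * a⁻¹) 1

theorem dLeft_one (b : G) : dLeft (1 : G) b = ContinuousLinearMap.id ℝ E := by
  simp only [dLeft, one_mul, tderiv_id]

theorem dRight_one (b : G) : dRight (1 : G) b = ContinuousLinearMap.id ℝ E := by
  simp only [dRight, mul_one, tderiv_id]

theorem AdL_one : AdL (1 : G) = ContinuousLinearMap.id ℝ E := by
  simp [AdL, tderiv_id]

variable [LieGroup 𝓘(ℝ, E) ∞ G]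

theorem contMDiff_mul_prod : ContMDiff (𝓘(ℝ, E).prod 𝓘(ℝ, E)) 𝓘(ℝ, E) ∞
    (fun q : G × G => q.1 * q.2) :=
  contMDiff_mul 𝓘(ℝ, E) ∞

theorem contMDiff_inv_mul_prod :
    ContMDiff (𝓘(ℝ, E).prod 𝓘(ℝ, E)) 𝓘(ℝ, E) ∞ (fun q : G × G => q.1⁻¹ * q.2) :=
  (contMDiff_fst.inv).mul contMDiff_snd

theorem mdifferentiableAt_leftMul (a b : G) :
    MDifferentiableAt 𝓘(ℝ, E) 𝓘(ℝ, E) (fun x : G => a * x) b :=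
  (contMDiff_mul_left (I := 𝓘(ℝ, E)) (n := ∞)).contMDiffAt.mdifferentiableAt (by simp)

theorem mdifferentiableAt_rightMul (a b : G) :
    MDifferentiableAt 𝓘(ℝ, E) 𝓘(ℝ, E) (fun x : G => x * a) b :=
  (contMDiff_mul_right (I := 𝓘(ℝ, E)) (n := ∞)).contMDiffAt.mdifferentiableAt (by simp)

theorem mdifferentiableAt_conj (a b : G) :
    MDifferentiableAt 𝓘(ℝ, E) 𝓘(ℝ, E) (fun x : G => a * x * a⁻¹) b :=
  (mdifferentiableAt_rightMul a⁻¹ (a * b)).comp b (mdifferentiableAt_leftMul a b)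

theorem dLeft_mul (a b c : G) : dLeft (E := E) (a * b) c = (dLeft a (b * c)).comp (dLeft b c) := by
  rw [dLeft, dLeft, dLeft, ← tderiv_comp c (mdifferentiableAt_leftMul a _)
    (mdifferentiableAt_leftMul b c)]
  simp only [mul_assoc]

theorem dRight_mul (a b c : G) : dRight (E := E) (a * b) c =
    (dRight b (c * a)).comp (dRight a c) := by
  rw [dRight, dRight, dRight, ← tderiv_comp c (mdifferentiableAt_rightMul b _)
    (mdifferentiableAt_rightMul a c)]
  simp only [mul_assoc]

theorem dLeft_comp_dRight (a b c : G) :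
    (dLeft (E := E) a (c * b)).comp (dRight b c) = (dRight b (a * c)).comp (dLeft a c) := by
  rw [dLeft, dRight, dRight, dLeft, ← tderiv_comp c (mdifferentiableAt_leftMul a _)
    (mdifferentiableAt_rightMul b c), ← tderiv_comp c (mdifferentiableAt_rightMul b _)
    (mdifferentiableAt_leftMul a c)]
  simp only [mul_assoc]

theorem AdL_eq (a : G) : AdL (E := E) a = (dRight a⁻¹ a).comp (dLeft a 1) := by
  have := tderiv_comp 1 (mdifferentiableAt_rightMul (E := E) a⁻¹ (a * 1))
    (mdifferentiableAt_leftMul a 1)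
  rw [mul_one] at this
  exact this

theorem dLeft_inv_comp (a b : G) :
    (dLeft (E := E) a⁻¹ (a * b)).comp (dLeft a b) = ContinuousLinearMap.id ℝ E := by
  rw [← dLeft_mul, inv_mul_cancel, dLeft_one]

theorem dRight_inv_comp (a b : G) :
    (dRight (E := E) a⁻¹ (b * a)).comp (dRight a b) = ContinuousLinearMap.id ℝ E := by
  rw [← dRight_mul, mul_inv_cancel, dRight_one]

/-- `(L_a)_* = (R_a)_* ∘ Ad(a)` on the Lie algebra. -/
theorem dRight_comp_AdL (a : G) : (dRight (E := E) a 1).comp (AdL a) = dLeft a 1 := by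
  have h := dRight_inv_comp (E := E) a⁻¹ a
  rw [inv_inv, mul_inv_cancel] at h
  rw [AdL_eq, ← ContinuousLinearMap.comp_assoc, h, ContinuousLinearMap.id_comp]

theorem AdL_mul (a b : G) : AdL (E := E) (a * b) = (AdL a).comp (AdL b) := by
  have h := tderiv_comp 1 (mdifferentiableAt_conj (E := E) a (b * 1 * b⁻¹))
    (mdifferentiableAt_conj b 1)
  rw [mul_one, mul_inv_cancel] at h
  rw [AdL, AdL, AdL, ← h]
  simp only [mul_assoc, mul_inv_rev]

theorem AdL_comp_inv (a : G) : (AdL (E := E) a).comp (AdL a⁻¹) = ContinuousLinearMap.id ℝ E := by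
  rw [← AdL_mul, mul_inv_cancel, AdL_one]

theorem AdL_inv_comp (a : G) : (AdL (E := E) a⁻¹).comp (AdL a) = ContinuousLinearMap.id ℝ E := by
  rw [← AdL_mul, inv_mul_cancel, AdL_one]

/-- The differential of the multiplication on a pair of right-translated vectors. -/
theorem tderiv_mul_apply (a b : G) (u w : E) :
    tderiv (𝓘(ℝ, E).prod 𝓘(ℝ, E)) 𝓘(ℝ, E) (fun q : G × G => q.1 * q.2) (a, b)
      (dRight a 1 u, dRight b 1 w) = dRight (a * b) 1 (u + AdL a w) := by
  have h : tderiv (𝓘(ℝ, E).prod 𝓘(ℝ, E)) 𝓘(ℝ, E) (fun q : G × G => q.1 * q.2) (a, b)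
      (dRight a 1 u, dRight b 1 w) = dRight b a (dRight a 1 u) + dLeft a b (dRight b 1 w) :=
    mfderiv_prod_eq_add_apply (contMDiff_mul_prod.contMDiffAt.mdifferentiableAt (by simp))
  rw [h, map_add]
  congr 1
  · rw [dRight_mul a b, one_mul]; rfl
  · have h1 := dLeft_comp_dRight (E := E) a b 1
    rw [one_mul, mul_one, ← dRight_comp_AdL a] at h1
    have h2 := dRight_mul (E := E) a b 1
    rw [one_mul] at h2
    rw [h2, ← ContinuousLinearMap.comp_apply, h1]
    rfl

/-- The map `(a, b) ↦ a⁻¹ b` is constant along simultaneous right translation. -/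
theorem tderiv_inv_mul_apply (a b : G) (u : E) :
    tderiv (𝓘(ℝ, E).prod 𝓘(ℝ, E)) 𝓘(ℝ, E) (fun q : G × G => q.1⁻¹ * q.2) (a, b)
      (dRight a 1 u, dRight b 1 u) = 0 := by
  have ha := mdifferentiableAt_rightMul (E := E) a 1
  have hb := mdifferentiableAt_rightMul (E := E) b 1
  have h1 : tderiv 𝓘(ℝ, E) 𝓘(ℝ, E) (fun x : G => (x * a)⁻¹ * (x * b)) 1 = _ :=
    tderiv_comp (g := fun q : G × G => q.1⁻¹ * q.2) (f := fun x : G => (x * a, x * b))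
      (I₂ := 𝓘(ℝ, E).prod 𝓘(ℝ, E)) 1
      (contMDiff_inv_mul_prod.contMDiffAt.mdifferentiableAt (by simp)) (ha.prodMk hb)
  have h2 : (fun x : G => (x * a)⁻¹ * (x * b)) = fun _ => a⁻¹ * b := by
    ext x; group
  have h3 : tderiv 𝓘(ℝ, E) (𝓘(ℝ, E).prod 𝓘(ℝ, E)) (fun x : G => (x * a, x * b)) 1 =
      (dRight a 1).prod (dRight b 1) := ha.mfderiv_prod hb
  rw [h2, tderiv_const, h3, one_mul, one_mul] at h1
  exact (congrArg (fun L => L u) h1).symm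

end LieGroupCalculus

/-! ### The adjoint representation and the Lie bracket -/

section Charts

variable {E : Type*} [NormedAddCommGroup E] [NormedSpace ℝ E]
  {G : Type*} [TopologicalSpace G] [ChartedSpace E G] [IsManifold 𝓘(ℝ, E) ∞ G]

/-- Partial derivatives, read in charts, of a smooth map on `G × G` are smooth. -/
theorem contDiffOn_fderiv_chart {Φ : G × G → G}
    (hΦ : ContMDiff (𝓘(ℝ, E).prod 𝓘(ℝ, E)) 𝓘(ℝ, E) ∞ Φ) {a b c : G} {z₀ : E → E}
    (hz₀ : ContDiffOn ℝ ∞ z₀ (extChartAt 𝓘(ℝ, E) b).target)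
    (ha : ∀ x ∈ (extChartAt 𝓘(ℝ, E) b).target, z₀ x ∈ (extChartAt 𝓘(ℝ, E) a).target)
    (hc : ∀ x ∈ (extChartAt 𝓘(ℝ, E) b).target, Φ ((extChartAt 𝓘(ℝ, E) a).symm (z₀ x),
      (extChartAt 𝓘(ℝ, E) b).symm x) ∈ (extChartAt 𝓘(ℝ, E) c).source) :
    ContDiffOn ℝ ∞ (fun x => fderiv ℝ (fun z => extChartAt 𝓘(ℝ, E) c
      (Φ ((extChartAt 𝓘(ℝ, E) a).symm z, (extChartAt 𝓘(ℝ, E) b).symm x))) (z₀ x))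
      (extChartAt 𝓘(ℝ, E) b).target := by
  intro x hx
  have h1 := contDiffAt_chart_comp₂ hΦ (z := (z₀ x, x)) (ha x hx) hx (hc x hx)
  refine (ContDiffAt.fderiv (n := ∞) (m := ∞) (f := fun x z => extChartAt 𝓘(ℝ, E) c
    (Φ ((extChartAt 𝓘(ℝ, E) a).symm z, (extChartAt 𝓘(ℝ, E) b).symm x))) ?_
    ((hz₀ x hx).contDiffAt ((isOpen_chart_target b).mem_nhds hx)) (by simp)).contDiffWithinAt
  have h2 : ContDiffAt ℝ ∞ (fun w : E × E => (w.2, w.1)) (x, z₀ x) :=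
    contDiffAt_snd.prodMk contDiffAt_fst
  exact ContDiffAt.comp (g := fun w : E × E => extChartAt 𝓘(ℝ, E) c
      (Φ ((extChartAt 𝓘(ℝ, E) a).symm w.1, (extChartAt 𝓘(ℝ, E) b).symm w.2))) (x, z₀ x) h1 h2

/-- The differential of a chart at its centre is the identity. -/
theorem tderiv_extChartAt_self (b : G) :
    tderiv 𝓘(ℝ, E) 𝓘(ℝ, E) (extChartAt 𝓘(ℝ, E) b) b = ContinuousLinearMap.id ℝ E := by
  refine ContinuousLinearMap.ext fun w => ?_
  have h := tderiv_chart_comp (E := E) (b := b) (c := b) (f := fun x => x) mdifferentiableAt_id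
    (mem_extChartAt_source b) w
  rw [tderiv_id] at h
  refine h.trans ?_
  have h2 : (fun x => extChartAt 𝓘(ℝ, E) b ((extChartAt 𝓘(ℝ, E) b).symm x))
      =ᶠ[𝓝 (extChartAt 𝓘(ℝ, E) b b)] fun x => x := by
    filter_upwards [(isOpen_chart_target b).mem_nhds (mem_extChartAt_target b)] with x hx
    exact (extChartAt 𝓘(ℝ, E) b).right_inv hx
  rw [h2.fderiv_eq, fderiv_fun_id]

end Charts

section Ad

variable {E : Type*} [NormedAddCommGroup E] [NormedSpace ℝ E]
  {G : Type*} [TopologicalSpace G] [ChartedSpace E G] [Group G]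

/-- The chart `c` turns the right-invariant vector field of `v` into `x ↦ rightChart c x v`. -/
def rightChart (c : G) (x : E) : E →L[ℝ] E :=
  fderiv ℝ (fun z => extChartAt 𝓘(ℝ, E) c
    ((extChartAt 𝓘(ℝ, E) (1 : G)).symm z * (extChartAt 𝓘(ℝ, E) c).symm x))
    (extChartAt 𝓘(ℝ, E) (1 : G) 1)

/-- The chart `c` turns the left-invariant vector field of `v` into `x ↦ leftChart c x v`. -/
def leftChart (c : G) (x : E) : E →L[ℝ] E :=
  fderiv ℝ (fun z => extChartAt 𝓘(ℝ, E) c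
    ((extChartAt 𝓘(ℝ, E) c).symm x * (extChartAt 𝓘(ℝ, E) (1 : G)).symm z))
    (extChartAt 𝓘(ℝ, E) (1 : G) 1)

variable (E G) in
/-- The differential at `1` of the adjoint representation. -/
def adL : E →L[ℝ] E →L[ℝ] E :=
  fderiv ℝ (fun x => AdL (E := E) ((extChartAt 𝓘(ℝ, E) (1 : G)).symm x))
    (extChartAt 𝓘(ℝ, E) (1 : G) 1)

variable [LieGroup 𝓘(ℝ, E) ∞ G]

theorem contDiffOn_rightChart (c : G) :
    ContDiffOn ℝ ∞ (rightChart c) (extChartAt 𝓘(ℝ, E) c).target := by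
  refine contDiffOn_fderiv_chart (a := (1 : G)) contMDiff_mul_prod contDiffOn_const
    (fun _ _ => mem_extChartAt_target _) fun x hx => ?_
  rw [extChartAt_to_inv, one_mul]
  exact (extChartAt 𝓘(ℝ, E) c).map_target hx

theorem contDiffOn_leftChart (c : G) :
    ContDiffOn ℝ ∞ (leftChart c) (extChartAt 𝓘(ℝ, E) c).target := by
  refine contDiffOn_fderiv_chart (Φ := fun q : G × G => q.2 * q.1) (a := (1 : G))
    (contMDiff_snd.mul contMDiff_fst) contDiffOn_const
    (fun _ _ => mem_extChartAt_target _) fun x hx => ?_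
  simp only [extChartAt_to_inv, mul_one]
  exact (extChartAt 𝓘(ℝ, E) c).map_target hx

theorem tderiv_chart_dRight {c a : G} (ha : a ∈ (extChartAt 𝓘(ℝ, E) c).source) (v : E) :
    tderiv 𝓘(ℝ, E) 𝓘(ℝ, E) (extChartAt 𝓘(ℝ, E) c) a (dRight a 1 v) =
      rightChart c (extChartAt 𝓘(ℝ, E) c a) v := by
  have h := tderiv_chart_comp (E := E) (b := (1 : G)) (c := c) (mdifferentiableAt_rightMul a 1)
    (by rwa [one_mul]) v
  rw [one_mul] at h
  rw [rightChart, (extChartAt 𝓘(ℝ, E) c).left_inv ha]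
  exact h

theorem tderiv_chart_dLeft {c a : G} (ha : a ∈ (extChartAt 𝓘(ℝ, E) c).source) (v : E) :
    tderiv 𝓘(ℝ, E) 𝓘(ℝ, E) (extChartAt 𝓘(ℝ, E) c) a (dLeft a 1 v) =
      leftChart c (extChartAt 𝓘(ℝ, E) c a) v := by
  have h := tderiv_chart_comp (E := E) (b := (1 : G)) (c := c) (mdifferentiableAt_leftMul a 1)
    (by rwa [mul_one]) v
  rw [mul_one] at h
  rw [leftChart, (extChartAt 𝓘(ℝ, E) c).left_inv ha]
  exact h

theorem rightChart_one : rightChart (1 : G) (extChartAt 𝓘(ℝ, E) (1 : G) 1) =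
    ContinuousLinearMap.id ℝ E := by
  refine ContinuousLinearMap.ext fun v => ?_
  rw [← tderiv_chart_dRight (mem_extChartAt_source _), tderiv_extChartAt_self, dRight_one]
  rfl

theorem leftChart_one : leftChart (1 : G) (extChartAt 𝓘(ℝ, E) (1 : G) 1) =
    ContinuousLinearMap.id ℝ E := by
  refine ContinuousLinearMap.ext fun v => ?_
  rw [← tderiv_chart_dLeft (mem_extChartAt_source _), tderiv_extChartAt_self, dLeft_one]
  rfl

theorem rightChart_AdL {c : G} {x : E} (hx : x ∈ (extChartAt 𝓘(ℝ, E) c).target) (v : E) :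
    rightChart c x (AdL (E := E) ((extChartAt 𝓘(ℝ, E) c).symm x) v) = leftChart c x v := by
  have hs := (extChartAt 𝓘(ℝ, E) c).map_target hx
  have h1 := tderiv_chart_dRight hs (AdL (E := E) ((extChartAt 𝓘(ℝ, E) c).symm x) v)
  have h2 := tderiv_chart_dLeft hs v
  rw [(extChartAt 𝓘(ℝ, E) c).right_inv hx] at h1 h2
  rw [← h1, ← h2, ← dRight_comp_AdL]
  rfl

/-- The adjoint representation is smooth. -/
theorem contDiffOn_AdL_chart (c : G) :
    ContDiffOn ℝ ∞ (fun x => AdL (E := E) ((extChartAt 𝓘(ℝ, E) c).symm x))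
      (extChartAt 𝓘(ℝ, E) c).target := by
  have h := contDiffOn_fderiv_chart (E := E) (Φ := fun q : G × G => q.2 * q.1 * q.2⁻¹)
    (a := (1 : G)) (b := c) (c := 1) (z₀ := fun _ => extChartAt 𝓘(ℝ, E) (1 : G) 1)
    ((contMDiff_snd.mul contMDiff_fst).mul contMDiff_snd.inv) contDiffOn_const
    (fun _ _ => mem_extChartAt_target _) fun x _ => by
      simp only [extChartAt_to_inv, mul_one, mul_inv_cancel]
      exact mem_extChartAt_source _
  refine h.congr fun x _ => ContinuousLinearMap.ext fun v => ?_
  have h2 := tderiv_chart_comp (E := E) (b := (1 : G)) (c := 1)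
    (mdifferentiableAt_conj ((extChartAt 𝓘(ℝ, E) c).symm x) 1)
    (by rw [mul_one, mul_inv_cancel]; exact mem_extChartAt_source _) v
  rw [mul_one, mul_inv_cancel, tderiv_extChartAt_self] at h2
  exact h2

theorem contMDiff_AdL : ContMDiff 𝓘(ℝ, E) 𝓘(ℝ, E →L[ℝ] E) ∞ (AdL (E := E) (G := G)) := by
  intro c
  have h1 := (contDiffOn_AdL_chart (E := E) c).contDiffAt
    ((isOpen_chart_target c).mem_nhds (mem_extChartAt_target c))
  have h2 := ContMDiffAt.comp c h1.contMDiffAt (contMDiffAt_chart (mem_extChartAt_source c))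
  refine h2.congr_of_eventuallyEq ?_
  filter_upwards [extChartAt_source_mem_nhds (I := 𝓘(ℝ, E)) c] with a ha
  simp only [Function.comp_apply]
  rw [(extChartAt 𝓘(ℝ, E) c).left_inv ha]

theorem differentiableAt_chart_right {c : G} {x : E} (hx : x ∈ (extChartAt 𝓘(ℝ, E) c).target) :
    DifferentiableAt ℝ (fun z => extChartAt 𝓘(ℝ, E) c
      ((extChartAt 𝓘(ℝ, E) (1 : G)).symm z * (extChartAt 𝓘(ℝ, E) c).symm x))
      (extChartAt 𝓘(ℝ, E) (1 : G) 1) := by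
  have h := contDiffAt_chart_comp₂ (E := E) (G := G) contMDiff_mul_prod (a := 1) (b := c) (c := c)
    (z := (extChartAt 𝓘(ℝ, E) (1 : G) 1, x)) (mem_extChartAt_target _) hx (by
      simp only [extChartAt_to_inv, one_mul]
      exact (extChartAt 𝓘(ℝ, E) c).map_target hx)
  have h2 : ContDiffAt ℝ ∞ (fun z : E => (z, x)) (extChartAt 𝓘(ℝ, E) (1 : G) 1) :=
    contDiffAt_id.prodMk contDiffAt_const
  exact (ContDiffAt.comp (f := fun z : E => (z, x)) (extChartAt 𝓘(ℝ, E) (1 : G) 1) h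
    h2).differentiableAt (by simp)

/-- The derivative of `Ad` along right-invariant vector fields. -/
theorem fderiv_AdL_rightChart {c : G} {x : E} (hx : x ∈ (extChartAt 𝓘(ℝ, E) c).target) (u : E) :
    fderiv ℝ (fun x => AdL (E := E) ((extChartAt 𝓘(ℝ, E) c).symm x)) x (rightChart c x u) =
      (adL E G u).comp (AdL (E := E) ((extChartAt 𝓘(ℝ, E) c).symm x)) := by
  set a := (extChartAt 𝓘(ℝ, E) c).symm x with ha
  have has : a ∈ (extChartAt 𝓘(ℝ, E) c).source := (extChartAt 𝓘(ℝ, E) c).map_target hx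
  set p := extChartAt 𝓘(ℝ, E) (1 : G) 1
  have hm : (fun z => extChartAt 𝓘(ℝ, E) c ((extChartAt 𝓘(ℝ, E) (1 : G)).symm z * a)) p = x := by
    simp only [p, extChartAt_to_inv, one_mul, ha]
    exact (extChartAt 𝓘(ℝ, E) c).right_inv hx
  have hA : HasFDerivAt (fun x => AdL (E := E) ((extChartAt 𝓘(ℝ, E) c).symm x))
      (fderiv ℝ (fun x => AdL (E := E) ((extChartAt 𝓘(ℝ, E) c).symm x)) x)
      ((fun z => extChartAt 𝓘(ℝ, E) c ((extChartAt 𝓘(ℝ, E) (1 : G)).symm z * a)) p) := by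
    rw [hm]
    exact (((contDiffOn_AdL_chart c).contDiffAt
      ((isOpen_chart_target c).mem_nhds hx)).differentiableAt (by simp)).hasFDerivAt
  have h1 := hA.comp p (differentiableAt_chart_right hx).hasFDerivAt
  have h2 : HasFDerivAt (fun z => (AdL (E := E) ((extChartAt 𝓘(ℝ, E) (1 : G)).symm z)).comp
      (AdL (E := E) a))
      (((ContinuousLinearMap.compL ℝ E E E).flip (AdL a)).comp (adL E G)) p := by
    have h3 : HasFDerivAt (fun x => AdL (E := E) ((extChartAt 𝓘(ℝ, E) (1 : G)).symm x))
        (adL E G) p :=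
      (((contDiffOn_AdL_chart (E := E) (1 : G)).contDiffAt ((isOpen_chart_target _).mem_nhds
        (mem_extChartAt_target _))).differentiableAt (by simp)).hasFDerivAt
    exact ((ContinuousLinearMap.compL ℝ E E E).flip (AdL a)).hasFDerivAt.comp p h3
  have h4 : (fun z => (AdL (E := E) ((extChartAt 𝓘(ℝ, E) (1 : G)).symm z)).comp
      (AdL (E := E) a)) =ᶠ[𝓝 p]
      (fun x => AdL (E := E) ((extChartAt 𝓘(ℝ, E) c).symm x)) ∘
        (fun z => extChartAt 𝓘(ℝ, E) c ((extChartAt 𝓘(ℝ, E) (1 : G)).symm z * a)) := by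
    have := topologicalGroup_of_lieGroup 𝓘(ℝ, E) ∞ (G := G)
    have hcont : ContinuousAt (fun z => (extChartAt 𝓘(ℝ, E) (1 : G)).symm z * a) p :=
      (continuousAt_extChartAt_symm (I := 𝓘(ℝ, E)) (1 : G)).mul
        continuousAt_const
    have hsrc : (extChartAt 𝓘(ℝ, E) c).source ∈
        𝓝 ((fun z => (extChartAt 𝓘(ℝ, E) (1 : G)).symm z * a) p) := by
      simp only [p, extChartAt_to_inv, one_mul]
      exact (isOpen_extChartAt_source c).mem_nhds has
    filter_upwards [hcont hsrc] with z hz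
    simp only [Function.comp_apply]
    rw [(extChartAt 𝓘(ℝ, E) c).left_inv hz, AdL_mul]
  have h5 := (h1.congr_of_eventuallyEq h4).unique h2
  have h6 := congrArg (fun L => L u) h5
  simp only [ContinuousLinearMap.comp_apply, ContinuousLinearMap.flip_apply,
    ContinuousLinearMap.compL_apply] at h6
  exact h6

/-- Differentiating `rightChart ∘ Ad = leftChart` at the identity. -/
theorem fderiv_leftChart_sub_rightChart (v w : E) :
    fderiv ℝ (leftChart (E := E) (1 : G)) (extChartAt 𝓘(ℝ, E) (1 : G) 1) v w =
      fderiv ℝ (rightChart (E := E) (1 : G)) (extChartAt 𝓘(ℝ, E) (1 : G) 1) v w + adL E G v w := by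
  set p := extChartAt 𝓘(ℝ, E) (1 : G) 1 with hp
  have hn := (isOpen_chart_target (E := E) (1 : G)).mem_nhds (mem_extChartAt_target (1 : G))
  have hA : HasFDerivAt (rightChart (E := E) (1 : G)) _ p :=
    (((contDiffOn_rightChart (E := E) (1 : G)).contDiffAt hn).differentiableAt
      (by simp)).hasFDerivAt
  have hB : HasFDerivAt (leftChart (E := E) (1 : G)) _ p :=
    (((contDiffOn_leftChart (E := E) (1 : G)).contDiffAt hn).differentiableAt
      (by simp)).hasFDerivAt
  have hAd : HasFDerivAt (fun x => AdL (E := E) ((extChartAt 𝓘(ℝ, E) (1 : G)).symm x))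
      (adL E G) p :=
    (((contDiffOn_AdL_chart (E := E) (1 : G)).contDiffAt hn).differentiableAt
      (by simp)).hasFDerivAt
  have h1 := hA.clm_comp hAd
  have h2 : leftChart (E := E) (1 : G) =ᶠ[𝓝 p] fun x => (rightChart (1 : G) x).comp
      (AdL (E := E) ((extChartAt 𝓘(ℝ, E) (1 : G)).symm x)) := by
    filter_upwards [hn] with x hx
    exact ContinuousLinearMap.ext fun w => (rightChart_AdL hx w).symm
  have h3 := (h1.congr_of_eventuallyEq h2).unique hB
  have h4 := congrArg (fun L => L v w) h3
  simp only [_root_.add_apply, ContinuousLinearMap.comp_apply,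
    ContinuousLinearMap.compL_apply, ContinuousLinearMap.flip_apply] at h4
  rw [← h4, hp, rightChart_one, extChartAt_to_inv, AdL_one]
  simp [add_comm]

/-- Both sides are the mixed second derivative at `(1, 1)` of the multiplication read in the chart
at `1`, taken in the two possible orders. -/
theorem fderiv_rightChart_apply (v w : E) :
    fderiv ℝ (rightChart (E := E) (1 : G)) (extChartAt 𝓘(ℝ, E) (1 : G) 1) v w =
      fderiv ℝ (leftChart (E := E) (1 : G)) (extChartAt 𝓘(ℝ, E) (1 : G) 1) w v := by
  set φ := extChartAt 𝓘(ℝ, E) (1 : G) with hφ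
  set p := φ 1 with hp
  set μ : E × E → E := fun z => φ (φ.symm z.1 * φ.symm z.2) with hμ
  have hpt : p ∈ φ.target := mem_extChartAt_target (1 : G)
  have hsymm : φ.symm p = 1 := extChartAt_to_inv (1 : G)
  have hsmooth : ∀ x ∈ φ.target, ContDiffAt ℝ ∞ μ (p, x) ∧ ContDiffAt ℝ ∞ μ (x, p) := fun x hx =>
    ⟨contDiffAt_chart_comp₂ (E := E) (G := G) contMDiff_mul_prod (a := 1) (b := 1) (c := 1)
      (z := (p, x)) hpt hx (by
        simp only [← hφ, hsymm, one_mul]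
        exact φ.map_target hx),
     contDiffAt_chart_comp₂ (E := E) (G := G) contMDiff_mul_prod (a := 1) (b := 1) (c := 1)
      (z := (x, p)) hx hpt (by
        simp only [← hφ, hsymm, mul_one]
        exact φ.map_target hx)⟩
  have hD : HasFDerivAt (fderiv ℝ μ) (fderiv ℝ (fderiv ℝ μ) (p, p)) (p, p) :=
    (((hsmooth p hpt).1.fderiv_right (m := 1) (by norm_cast)).differentiableAt
      (by simp)).hasFDerivAt
  have hsym : IsSymmSndFDerivAt ℝ μ (p, p) :=
    (hsmooth p hpt).1.isSymmSndFDerivAt (by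
      rw [minSmoothness_of_isRCLikeNormedField]; norm_cast)
  have hn := (isOpen_chart_target (E := E) (1 : G)).mem_nhds (mem_extChartAt_target (1 : G))
  have hR : HasFDerivAt (fun x => rightChart (E := E) (1 : G) x w)
      (((fderiv ℝ (fderiv ℝ μ) (p, p)).comp (ContinuousLinearMap.inr ℝ E E)).flip (w, 0)) p := by
    have h1 : (fun x => rightChart (E := E) (1 : G) x w) =ᶠ[𝓝 p]
        fun x => fderiv ℝ μ (p, x) (w, 0) := by
      filter_upwards [hn] with x hx
      have h2 : HasFDerivAt (fun z : E => (z, x)) (ContinuousLinearMap.inl ℝ E E) p :=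
        hasFDerivAt_prodMk_left p x
      have h3 := (((hsmooth x hx).1.differentiableAt (by simp)).hasFDerivAt.comp p h2).fderiv
      exact congrArg (fun L => L w) h3
    refine HasFDerivAt.congr_of_eventuallyEq ?_ h1
    have h4 : HasFDerivAt (fun x : E => (p, x)) (ContinuousLinearMap.inr ℝ E E) p :=
      hasFDerivAt_prodMk_right p p
    have h5 := HasFDerivAt.comp (f := fun x : E => (p, x)) p hD h4
    exact (ContinuousLinearMap.apply ℝ E ((w, 0) : E × E)).hasFDerivAt.comp p h5
  have hL : HasFDerivAt (fun x => leftChart (E := E) (1 : G) x v)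
      (((fderiv ℝ (fderiv ℝ μ) (p, p)).comp (ContinuousLinearMap.inl ℝ E E)).flip (0, v)) p := by
    have h1 : (fun x => leftChart (E := E) (1 : G) x v) =ᶠ[𝓝 p]
        fun x => fderiv ℝ μ (x, p) (0, v) := by
      filter_upwards [hn] with x hx
      have h2 : HasFDerivAt (fun z : E => (x, z)) (ContinuousLinearMap.inr ℝ E E) p :=
        hasFDerivAt_prodMk_right x p
      have h3 := (((hsmooth x hx).2.differentiableAt (by simp)).hasFDerivAt.comp p h2).fderiv
      exact congrArg (fun L => L v) h3
    refine HasFDerivAt.congr_of_eventuallyEq ?_ h1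
    have h4 : HasFDerivAt (fun x : E => (x, p)) (ContinuousLinearMap.inl ℝ E E) p :=
      hasFDerivAt_prodMk_left p p
    have h5 := HasFDerivAt.comp (f := fun x : E => (x, p)) p hD h4
    exact (ContinuousLinearMap.apply ℝ E ((0, v) : E × E)).hasFDerivAt.comp p h5
  have hA := (((contDiffOn_rightChart (E := E) (1 : G)).contDiffAt hn).differentiableAt
      (by simp)).hasFDerivAt
  have hB := (((contDiffOn_leftChart (E := E) (1 : G)).contDiffAt hn).differentiableAt
      (by simp)).hasFDerivAt
  have hA' := hR.unique ((ContinuousLinearMap.apply ℝ E w).hasFDerivAt.comp p hA)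
  have hB' := hL.unique ((ContinuousLinearMap.apply ℝ E v).hasFDerivAt.comp p hB)
  have e1 := congrArg (fun L => L v) hA'
  have e2 := congrArg (fun L => L w) hB'
  have e3 := hsym (0, v) (w, 0)
  exact e1.symm.trans (e3.trans e2)

theorem mpullback_mulInvariantVectorField_chart {x : E}
    (hx : x ∈ (extChartAt 𝓘(ℝ, E) (1 : G)).target) (v : E) :
    VectorField.mpullbackWithin 𝓘(ℝ, E) 𝓘(ℝ, E) (extChartAt 𝓘(ℝ, E) (1 : G)).symm
      (mulInvariantVectorField (v : GroupLieAlgebra 𝓘(ℝ, E) G)) (range 𝓘(ℝ, E)) x =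
      leftChart (1 : G) x v := by
  have hs := (extChartAt 𝓘(ℝ, E) (1 : G)).map_target hx
  have h1 := mfderiv_extChartAt_comp_mfderivWithin_extChartAt_symm (I := 𝓘(ℝ, E)) hx
  have h2 := mfderivWithin_extChartAt_symm_comp_mfderiv_extChartAt (I := 𝓘(ℝ, E)) hx
  rw [VectorField.mpullbackWithin_apply, ContinuousLinearMap.inverse_eq h2 h1]
  have h3 := tderiv_chart_dLeft hs v
  rw [(extChartAt 𝓘(ℝ, E) (1 : G)).right_inv hx] at h3
  exact h3

/-- The bracket of the Lie algebra is the differential of the adjoint representation. -/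
theorem bracket_eq_adL (v w : GroupLieAlgebra 𝓘(ℝ, E) G) :
    ⁅v, w⁆ = adL E G v w := by
  set p := extChartAt 𝓘(ℝ, E) (1 : G) 1 with hp
  have hn := (isOpen_chart_target (E := E) (1 : G)).mem_nhds (mem_extChartAt_target (1 : G))
  have hV : ∀ v : E, VectorField.mpullbackWithin 𝓘(ℝ, E) 𝓘(ℝ, E) (extChartAt 𝓘(ℝ, E) (1 : G)).symm
      (mulInvariantVectorField (v : GroupLieAlgebra 𝓘(ℝ, E) G)) (range 𝓘(ℝ, E)) =ᶠ[𝓝 p]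
      fun x => leftChart (1 : G) x v := fun v => by
    filter_upwards [hn] with x hx
    exact mpullback_mulInvariantVectorField_chart hx v
  have hB : ∀ v : E, fderiv ℝ (fun x => leftChart (E := E) (1 : G) x v) p =
      (fderiv ℝ (leftChart (E := E) (1 : G)) p).flip v := fun v =>
    ((ContinuousLinearMap.apply ℝ E v).hasFDerivAt.comp p
      ((((contDiffOn_leftChart (E := E) (1 : G)).contDiffAt hn).differentiableAt
      (by simp)).hasFDerivAt)).fderiv
  have h0 : (extChartAt 𝓘(ℝ, E) (1 : G)).symm ⁻¹' univ ∩ range 𝓘(ℝ, E) = univ := by simp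
  rw [GroupLieAlgebra.bracket_def, ← VectorField.mlieBracketWithin_univ,
    VectorField.mlieBracketWithin_apply, h0]
  have h1 : (mfderiv 𝓘(ℝ, E) 𝓘(ℝ, E) (extChartAt 𝓘(ℝ, E) (1 : G)) 1).inverse =
      ContinuousLinearMap.id ℝ E := by
    have := tderiv_extChartAt_self (E := E) (1 : G)
    rw [tderiv] at this
    rw [this]
    exact ContinuousLinearMap.inverse_id
  rw [h1]
  have h2 : ∀ V W : E → E, VectorField.lieBracketWithin ℝ V W univ p =
      fderiv ℝ W p (V p) - fderiv ℝ V p (W p) := fun V W => by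
    rw [VectorField.lieBracketWithin_eq]; simp only [fderivWithin_univ]
  refine (h2 _ _).trans ?_
  rw [(hV v).fderiv_eq, (hV w).fderiv_eq, (hV v).eq_of_nhds, (hV w).eq_of_nhds]
  have key : ∀ v w : E, fderiv ℝ (fun x => leftChart (1 : G) x w) p (leftChart (1 : G) p v) -
      fderiv ℝ (fun x => leftChart (1 : G) x v) p (leftChart (1 : G) p w) = adL E G v w := by
    intro v w
    rw [hB, hB, hp, leftChart_one]
    simp only [ContinuousLinearMap.flip_apply, ContinuousLinearMap.id_apply]
    rw [fderiv_leftChart_sub_rightChart v w, fderiv_rightChart_apply]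
    abel
  exact key v w

end Ad

/-! ### Parallel paths -/

section ChartDerivatives

variable {E : Type*} [NormedAddCommGroup E] [NormedSpace ℝ E]
  {G : Type*} [TopologicalSpace G] [ChartedSpace E G] [IsManifold 𝓘(ℝ, E) ∞ G]

theorem differentiableAt_chart_comp {f : G → G} {a c d : G}
    (hf : MDifferentiableAt 𝓘(ℝ, E) 𝓘(ℝ, E) f a) (ha : a ∈ (extChartAt 𝓘(ℝ, E) c).source)
    (hd : f a ∈ (extChartAt 𝓘(ℝ, E) d).source) :
    DifferentiableAt ℝ (fun x => extChartAt 𝓘(ℝ, E) d (f ((extChartAt 𝓘(ℝ, E) c).symm x)))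
      (extChartAt 𝓘(ℝ, E) c a) := by
  have h1 := (contMDiffAt_chart_symm (E := E) (c := c)
    ((extChartAt 𝓘(ℝ, E) c).map_source ha)).mdifferentiableAt (by simp)
  have hl := (extChartAt 𝓘(ℝ, E) c).left_inv ha
  rw [← hl] at hf hd
  have h2 := hf.comp _ h1
  have h3 := MDifferentiableAt.comp (extChartAt 𝓘(ℝ, E) c a)
    (g := extChartAt 𝓘(ℝ, E) d) ((contMDiffAt_chart hd).mdifferentiableAt (by simp)) h2
  exact h3.differentiableAt

/-- The differential of a map at an arbitrary point of the domains of two charts. -/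
theorem fderiv_chart_comp {f : G → G} {a c d : G}
    (hf : MDifferentiableAt 𝓘(ℝ, E) 𝓘(ℝ, E) f a) (ha : a ∈ (extChartAt 𝓘(ℝ, E) c).source)
    (hd : f a ∈ (extChartAt 𝓘(ℝ, E) d).source) (v : E) :
    fderiv ℝ (fun x => extChartAt 𝓘(ℝ, E) d (f ((extChartAt 𝓘(ℝ, E) c).symm x)))
        (extChartAt 𝓘(ℝ, E) c a) (tderiv 𝓘(ℝ, E) 𝓘(ℝ, E) (extChartAt 𝓘(ℝ, E) c) a v) =
      tderiv 𝓘(ℝ, E) 𝓘(ℝ, E) (extChartAt 𝓘(ℝ, E) d) (f a) (tderiv 𝓘(ℝ, E) 𝓘(ℝ, E) f a v) := by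
  have h1 := tderiv_comp (I₃ := 𝓘(ℝ, E)) a (differentiableAt_chart_comp hf ha hd).mdifferentiableAt
    ((contMDiffAt_chart ha).mdifferentiableAt (by simp))
  have h2 := tderiv_comp a ((contMDiffAt_chart hd).mdifferentiableAt (by simp)) hf
  rw [← tderiv_vectorSpace, ← ContinuousLinearMap.comp_apply, ← ContinuousLinearMap.comp_apply,
    ← h1, ← h2]
  congr 1
  refine tderiv_congr ?_
  filter_upwards [(isOpen_extChartAt_source (I := 𝓘(ℝ, E)) c).mem_nhds ha] with x hx
  rw [(extChartAt 𝓘(ℝ, E) c).left_inv hx]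

/-- The two-variable version of `fderiv_chart_comp`. -/
theorem fderiv_chart_comp₂ {Φ : G × G → G}
    (hΦ : ContMDiff (𝓘(ℝ, E).prod 𝓘(ℝ, E)) 𝓘(ℝ, E) ∞ Φ) {a b c₁ c₂ d : G}
    (ha : a ∈ (extChartAt 𝓘(ℝ, E) c₁).source) (hb : b ∈ (extChartAt 𝓘(ℝ, E) c₂).source)
    (hd : Φ (a, b) ∈ (extChartAt 𝓘(ℝ, E) d).source) (v w : E) :
    fderiv ℝ (fun z : E × E => extChartAt 𝓘(ℝ, E) d
      (Φ ((extChartAt 𝓘(ℝ, E) c₁).symm z.1, (extChartAt 𝓘(ℝ, E) c₂).symm z.2)))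
      (extChartAt 𝓘(ℝ, E) c₁ a, extChartAt 𝓘(ℝ, E) c₂ b)
      (tderiv 𝓘(ℝ, E) 𝓘(ℝ, E) (extChartAt 𝓘(ℝ, E) c₁) a v,
        tderiv 𝓘(ℝ, E) 𝓘(ℝ, E) (extChartAt 𝓘(ℝ, E) c₂) b w) =
      tderiv 𝓘(ℝ, E) 𝓘(ℝ, E) (extChartAt 𝓘(ℝ, E) d) (Φ (a, b))
        (tderiv (𝓘(ℝ, E).prod 𝓘(ℝ, E)) 𝓘(ℝ, E) Φ (a, b) (v, w)) := by
  have hla := (extChartAt 𝓘(ℝ, E) c₁).left_inv ha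
  have hlb := (extChartAt 𝓘(ℝ, E) c₂).left_inv hb
  have hΦd : MDifferentiableAt (𝓘(ℝ, E).prod 𝓘(ℝ, E)) 𝓘(ℝ, E) Φ (a, b) :=
    hΦ.contMDiffAt.mdifferentiableAt (by simp)
  have hM := (contDiffAt_chart_comp₂ hΦ
    (z := (extChartAt 𝓘(ℝ, E) c₁ a, extChartAt 𝓘(ℝ, E) c₂ b)) (c := d)
    ((extChartAt 𝓘(ℝ, E) c₁).map_source ha) ((extChartAt 𝓘(ℝ, E) c₂).map_source hb)
    (by simpa only [hla, hlb] using hd)).differentiableAt (by simp)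
  have h1 : MDifferentiableAt 𝓘(ℝ, E) 𝓘(ℝ, E) (fun x => Φ (x, b)) a :=
    hΦd.comp a (mdifferentiableAt_id.prodMk mdifferentiableAt_const)
  have h2 : MDifferentiableAt 𝓘(ℝ, E) 𝓘(ℝ, E) (fun y => Φ (a, y)) b :=
    hΦd.comp b (mdifferentiableAt_const.prodMk mdifferentiableAt_id)
  have e0 : tderiv (𝓘(ℝ, E).prod 𝓘(ℝ, E)) 𝓘(ℝ, E) Φ (a, b) (v, w) =
      tderiv 𝓘(ℝ, E) 𝓘(ℝ, E) (fun x => Φ (x, b)) a v +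
        tderiv 𝓘(ℝ, E) 𝓘(ℝ, E) (fun y => Φ (a, y)) b w := mfderiv_prod_eq_add_apply hΦd
  have e1 := fderiv_chart_comp h1 ha hd v
  have e2 := fderiv_chart_comp h2 hb hd w
  have k1 := (HasFDerivAt.comp (f := fun x : E => (x, extChartAt 𝓘(ℝ, E) c₂ b)) _ hM.hasFDerivAt
    (hasFDerivAt_prodMk_left _ _)).fderiv
  have k2 := (HasFDerivAt.comp (f := fun x : E => (extChartAt 𝓘(ℝ, E) c₁ a, x)) _ hM.hasFDerivAt
    (hasFDerivAt_prodMk_right _ _)).fderiv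
  simp only [Function.comp_def, hla, hlb] at k1 k2
  rw [k1] at e1
  rw [k2] at e2
  rw [e0, map_add, ← e1, ← e2, ContinuousLinearMap.comp_apply, ContinuousLinearMap.comp_apply,
    ← map_add]
  simp

end ChartDerivatives

section Transport

variable {E : Type*} [NormedAddCommGroup E] [NormedSpace ℝ E]
  {G : Type*} [TopologicalSpace G] [ChartedSpace E G] [Group G]

/-- On `[a,b]` the path `γ` stays in the domain of the chart `c`, where it is an absolutely
continuous solution of `γ' = (R_γ)_* f`. -/
structure IsSolutionInChart (c : G) (f : ℝ → E) (γ : ℝ → G) (a b : ℝ) : Prop where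
  mapsTo : MapsTo γ (Icc a b) (extChartAt 𝓘(ℝ, E) c).source
  isPrimitiveOn : IsPrimitiveOn (fun t => extChartAt 𝓘(ℝ, E) c (γ t))
    (fun t => rightChart c (extChartAt 𝓘(ℝ, E) c (γ t)) (f t)) a b

/-- `γ` solves `γ' = (R_γ)_* f` on `[0,1]`, where the control `f` is merely of class `L²`. -/
structure IsTransport (f : ℝ → E) (γ : ℝ → G) : Prop where
  memLp : MemLp f 2 unitVol
  continuousOn : ContinuousOn γ (Icc 0 1)
  locally_solution : ∀ t₀ ∈ Icc (0 : ℝ) 1, ∃ c : G, ∃ δ > 0,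
    IsSolutionInChart c f γ (max 0 (t₀ - δ)) (min 1 (t₀ + δ))

variable {f f₁ f₂ : ℝ → E} {γ γ₁ γ₂ : ℝ → G}

theorem window_le {t₀ δ : ℝ} (ht₀ : t₀ ∈ Icc (0 : ℝ) 1) (hδ : 0 < δ) :
    max 0 (t₀ - δ) ≤ min 1 (t₀ + δ) :=
  max_le (le_min zero_le_one (by linarith [ht₀.1])) (le_min (by linarith [ht₀.2]) (by linarith))

theorem window_subset (t₀ δ : ℝ) : Icc (max 0 (t₀ - δ)) (min 1 (t₀ + δ)) ⊆ Icc (0 : ℝ) 1 :=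
  Icc_subset_Icc (le_max_left _ _) (min_le_left _ _)

/-- A path which is continuous on `[0,1]` stays in a given neighbourhood of `γ t₀` for a while. -/
theorem ContinuousOn.exists_window {X : Type*} [TopologicalSpace X] {γ : ℝ → X}
    (hγ : ContinuousOn γ (Icc 0 1)) {t₀ : ℝ} (ht₀ : t₀ ∈ Icc (0 : ℝ) 1) {V : Set X}
    (hV : V ∈ 𝓝 (γ t₀)) :
    ∃ δ > 0, MapsTo γ (Icc (max 0 (t₀ - δ)) (min 1 (t₀ + δ))) V := by
  obtain ⟨ε, hε, h⟩ := Metric.mem_nhdsWithin_iff.1 (hγ t₀ ht₀ hV)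
  refine ⟨ε / 2, half_pos hε, fun t ht => h ⟨?_, window_subset _ _ ht⟩⟩
  rw [Metric.mem_ball, Real.dist_eq, abs_lt]
  constructor
  · linarith [(le_max_right _ _).trans ht.1]
  · linarith [ht.2.trans (min_le_right _ _)]

theorem IsSolutionInChart.mono {c : G} {a b a' b' : ℝ} (h : IsSolutionInChart c f γ a b)
    (ha : a ≤ a') (hab : a' ≤ b') (hb : b' ≤ b) : IsSolutionInChart c f γ a' b' :=
  ⟨h.mapsTo.mono_left (Icc_subset_Icc ha hb), h.isPrimitiveOn.mono ha hab hb⟩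

/-- Control functions may be modified on a null set. -/
theorem IsTransport.congr_ae {g : ℝ → E} (h : IsTransport f γ) (hfg : f =ᵐ[unitVol] g) :
    IsTransport g γ := by
  refine ⟨h.memLp.ae_eq hfg, h.continuousOn, fun t₀ ht₀ => ?_⟩
  obtain ⟨c, δ, hδ, hm, hp⟩ := h.locally_solution t₀ ht₀
  refine ⟨c, δ, hδ, hm, hp.congr_ae (window_le ht₀ hδ) ?_⟩
  filter_upwards [ae_mono (Measure.restrict_mono (window_subset t₀ δ) le_rfl) hfg] with t ht
  rw [ht]

variable [LieGroup 𝓘(ℝ, E) ∞ G]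

/-- The adjoint representation along a solution is continuous. -/
theorem IsTransport.continuousOn_AdL (h : IsTransport f γ) :
    ContinuousOn (fun t => AdL (E := E) (γ t)) (Icc 0 1) :=
  (contMDiff_AdL (E := E)).continuous.comp_continuousOn h.continuousOn

theorem IsTransport.continuousOn_AdL_inv (h : IsTransport f γ) :
    ContinuousOn (fun t => AdL (E := E) (γ t)⁻¹) (Icc 0 1) :=
  ((contMDiff_AdL (E := E) (G := G)).continuous.comp
    (contMDiff_inv 𝓘(ℝ, E) ∞).continuous).comp_continuousOn h.continuousOn

variable [CompleteSpace E]

/-- A general mechanism: if `Φ` maps right-translates to right-translates along two solutions, the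
image of the two solutions is a solution. -/
theorem IsTransport.map₂ {Φ : G × G → G} (hΦ : ContMDiff (𝓘(ℝ, E).prod 𝓘(ℝ, E)) 𝓘(ℝ, E) ∞ Φ)
    (h₁ : IsTransport f₁ γ₁) (h₂ : IsTransport f₂ γ₂) (hf : MemLp f 2 unitVol)
    (hd : ∀ t ∈ Icc (0 : ℝ) 1, tderiv (𝓘(ℝ, E).prod 𝓘(ℝ, E)) 𝓘(ℝ, E) Φ (γ₁ t, γ₂ t)
      (dRight (γ₁ t) 1 (f₁ t), dRight (γ₂ t) 1 (f₂ t)) = dRight (Φ (γ₁ t, γ₂ t)) 1 (f t)) :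
    IsTransport f (fun t => Φ (γ₁ t, γ₂ t)) := by
  have hc : ContinuousOn (fun t => Φ (γ₁ t, γ₂ t)) (Icc 0 1) :=
    hΦ.continuous.comp_continuousOn (h₁.continuousOn.prodMk h₂.continuousOn)
  refine ⟨hf, hc, fun t₀ ht₀ => ?_⟩
  obtain ⟨c₁, δ₁, hδ₁, hs₁⟩ := h₁.locally_solution t₀ ht₀
  obtain ⟨c₂, δ₂, hδ₂, hs₂⟩ := h₂.locally_solution t₀ ht₀
  set d := Φ (γ₁ t₀, γ₂ t₀) with hdd
  obtain ⟨δ₃, hδ₃, hs₃⟩ := hc.exists_window ht₀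
    ((isOpen_extChartAt_source (I := 𝓘(ℝ, E)) d).mem_nhds (mem_extChartAt_source d))
  set δ := min δ₁ (min δ₂ δ₃) with hδd
  have hδ : 0 < δ := lt_min hδ₁ (lt_min hδ₂ hδ₃)
  have hw := window_le ht₀ hδ
  have hle : ∀ δ', δ ≤ δ' → max 0 (t₀ - δ') ≤ max 0 (t₀ - δ) ∧ min 1 (t₀ + δ) ≤ min 1 (t₀ + δ') :=
    fun δ' h => ⟨max_le_max le_rfl (by linarith), min_le_min le_rfl (by linarith)⟩
  obtain ⟨l₁, r₁⟩ := hle δ₁ (min_le_left _ _)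
  obtain ⟨l₂, r₂⟩ := hle δ₂ ((min_le_right _ _).trans (min_le_left _ _))
  obtain ⟨l₃, r₃⟩ := hle δ₃ ((min_le_right _ _).trans (min_le_right _ _))
  replace hs₁ := hs₁.mono l₁ hw r₁
  replace hs₂ := hs₂.mono l₂ hw r₂
  replace hs₃ : MapsTo _ _ _ := hs₃.mono_left (Icc_subset_Icc l₃ r₃)
  refine ⟨d, δ, hδ, hs₃, ?_⟩
  let U : Set (E × E) := (((extChartAt 𝓘(ℝ, E) c₁).target ×ˢ (extChartAt 𝓘(ℝ, E) c₂).target) ∩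
    (fun z : E × E => Φ ((extChartAt 𝓘(ℝ, E) c₁).symm z.1, (extChartAt 𝓘(ℝ, E) c₂).symm z.2)) ⁻¹'
      (extChartAt 𝓘(ℝ, E) d).source)
  have hU : IsOpen U := by
    refine ContinuousOn.isOpen_inter_preimage ?_
      ((isOpen_chart_target c₁).prod (isOpen_chart_target c₂)) (isOpen_extChartAt_source d)
    refine hΦ.continuous.comp_continuousOn (ContinuousOn.prodMk ?_ ?_)
    · exact (continuousOn_extChartAt_symm c₁).comp continuousOn_fst fun z hz => hz.1
    · exact (continuousOn_extChartAt_symm c₂).comp continuousOn_snd fun z hz => hz.2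
  have hΦU : ContDiffOn ℝ ∞ (fun z : E × E => extChartAt 𝓘(ℝ, E) d
      (Φ ((extChartAt 𝓘(ℝ, E) c₁).symm z.1, (extChartAt 𝓘(ℝ, E) c₂).symm z.2))) U :=
    fun z hz => (contDiffAt_chart_comp₂ hΦ hz.1.1 hz.1.2 hz.2).contDiffWithinAt
  have hmaps : MapsTo (fun t => (extChartAt 𝓘(ℝ, E) c₁ (γ₁ t), extChartAt 𝓘(ℝ, E) c₂ (γ₂ t)))
      (Icc (max 0 (t₀ - δ)) (min 1 (t₀ + δ))) U := fun t ht =>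
    ⟨⟨(extChartAt 𝓘(ℝ, E) c₁).map_source (hs₁.mapsTo ht),
      (extChartAt 𝓘(ℝ, E) c₂).map_source (hs₂.mapsTo ht)⟩, by
      simp only [mem_preimage, (extChartAt 𝓘(ℝ, E) c₁).left_inv (hs₁.mapsTo ht),
        (extChartAt 𝓘(ℝ, E) c₂).left_inv (hs₂.mapsTo ht)]
      exact hs₃ ht⟩
  have hp := (hs₁.isPrimitiveOn.prodMk hs₂.isPrimitiveOn hw).comp hw hU
    (hΦU.of_le (by exact_mod_cast le_top)) hmaps
  refine (hp.congr_fun hw fun t ht => ?_).congr_ae hw ?_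
  · simp only [(extChartAt 𝓘(ℝ, E) c₁).left_inv (hs₁.mapsTo ht),
      (extChartAt 𝓘(ℝ, E) c₂).left_inv (hs₂.mapsTo ht)]
  · refine (ae_restrict_iff' measurableSet_Icc).2 (Eventually.of_forall fun t ht => ?_)
    have := fderiv_chart_comp₂ hΦ (hs₁.mapsTo ht) (hs₂.mapsTo ht) (hs₃ ht)
      (dRight (γ₁ t) 1 (f₁ t)) (dRight (γ₂ t) 1 (f₂ t))
    rw [tderiv_chart_dRight (hs₁.mapsTo ht), tderiv_chart_dRight (hs₂.mapsTo ht),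
      hd t (window_subset _ _ ht), tderiv_chart_dRight (hs₃ ht)] at this
    exact this

/-- A solution is a solution in every chart. -/
theorem IsTransport.isSolutionInChart (h : IsTransport f γ) {c : G} {a b : ℝ} (ha : 0 ≤ a)
    (hab : a ≤ b) (hb : b ≤ 1) (hm : MapsTo γ (Icc a b) (extChartAt 𝓘(ℝ, E) c).source) :
    IsSolutionInChart c f γ a b := by
  have hsub : Icc a b ⊆ Icc 0 1 := Icc_subset_Icc ha hb
  have hec : ContinuousOn (fun t => extChartAt 𝓘(ℝ, E) c (γ t)) (Icc a b) :=
    (continuousOn_extChartAt c).comp (h.continuousOn.mono hsub) hm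
  refine ⟨hm, IsPrimitiveOn.of_locally ?_ fun t₀ ht₀ => ?_⟩
  · exact IsPrimitiveOn.intervalIntegrable_clm_apply
      ((contDiffOn_rightChart c).continuousOn.comp hec
      fun t ht => (extChartAt 𝓘(ℝ, E) c).map_source (hm ht))
      ((h.memLp.mono_measure (Measure.restrict_mono hsub le_rfl)).intervalIntegrable_Icc hab) hab
  · obtain ⟨c', δ, hδ, hs⟩ := h.locally_solution t₀ (hsub ht₀)
    have hw : max a (t₀ - δ) ≤ min b (t₀ + δ) :=
      max_le (le_min hab (by linarith [ht₀.1])) (le_min (by linarith [ht₀.2]) (by linarith))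
    replace hs := hs.mono (max_le_max ha le_rfl) hw (min_le_min hb le_rfl)
    have hm' : MapsTo γ (Icc (max a (t₀ - δ)) (min b (t₀ + δ))) (extChartAt 𝓘(ℝ, E) c).source :=
      hm.mono_left (Icc_subset_Icc (le_max_left _ _) (min_le_left _ _))
    refine ⟨δ, hδ, ?_⟩
    let U : Set E := (extChartAt 𝓘(ℝ, E) c').target ∩
      (extChartAt 𝓘(ℝ, E) c').symm ⁻¹' (extChartAt 𝓘(ℝ, E) c).source
    have hU : IsOpen U := (continuousOn_extChartAt_symm c').isOpen_inter_preimage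
      (isOpen_chart_target c') (isOpen_extChartAt_source c)
    have hΦU : ContDiffOn ℝ ∞ (fun z => extChartAt 𝓘(ℝ, E) c ((extChartAt 𝓘(ℝ, E) c').symm z)) U :=
      fun z hz => (((contMDiffAt_chart hz.2).comp z
        (contMDiffAt_chart_symm hz.1)).contDiffAt).contDiffWithinAt
    have hp := hs.isPrimitiveOn.comp hw hU (hΦU.of_le (by exact_mod_cast le_top)) fun t ht =>
      ⟨(extChartAt 𝓘(ℝ, E) c').map_source (hs.mapsTo ht), by
        simp only [mem_preimage, (extChartAt 𝓘(ℝ, E) c').left_inv (hs.mapsTo ht)]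
        exact hm' ht⟩
    refine (hp.congr_fun hw fun t ht => ?_).congr_ae hw ?_
    · simp only [(extChartAt 𝓘(ℝ, E) c').left_inv (hs.mapsTo ht)]
    · refine (ae_restrict_iff' measurableSet_Icc).2 (Eventually.of_forall fun t ht => ?_)
      have := fderiv_chart_comp (f := fun x : G => x) mdifferentiableAt_id (hs.mapsTo ht) (hm' ht)
        (dRight (γ t) 1 (f t))
      rw [tderiv_chart_dRight (hs.mapsTo ht), tderiv_id, ContinuousLinearMap.id_apply,
        tderiv_chart_dRight (hm' ht)] at this
      exact this

theorem IsTransport.exists_centered (h : IsTransport f γ) {t₀ : ℝ} (ht₀ : t₀ ∈ Icc (0 : ℝ) 1) :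
    ∃ δ > 0, IsSolutionInChart (γ t₀) f γ (max 0 (t₀ - δ)) (min 1 (t₀ + δ)) := by
  obtain ⟨δ, hδ, hm⟩ := h.continuousOn.exists_window ht₀
    ((isOpen_extChartAt_source (I := 𝓘(ℝ, E)) (γ t₀)).mem_nhds (mem_extChartAt_source (γ t₀)))
  exact ⟨δ, hδ, h.isSolutionInChart (le_max_left _ _) (window_le ht₀ hδ) (min_le_left _ _) hm⟩

/-- The product rule for solutions. -/
theorem IsTransport.mul (h₁ : IsTransport f₁ γ₁) (h₂ : IsTransport f₂ γ₂) :
    IsTransport (fun t => f₁ t + AdL (γ₁ t) (f₂ t)) (fun t => γ₁ t * γ₂ t) :=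
  IsTransport.map₂ (Φ := fun q : G × G => q.1 * q.2) contMDiff_mul_prod h₁ h₂
    (h₁.memLp.add (MemLp.clm_apply_Icc h₁.continuousOn_AdL h₂.memLp))
    fun _ _ => tderiv_mul_apply _ _ _ _

/-- Solutions with the same control function and the same initial value agree. -/
theorem IsTransport.eqOn (h₁ : IsTransport f γ₁) (h₂ : IsTransport f γ₂) (h0 : γ₁ 0 = γ₂ 0) :
    EqOn γ₁ γ₂ (Icc 0 1) := by
  have h : IsTransport (fun _ => (0 : E)) (fun t => (γ₁ t)⁻¹ * γ₂ t) :=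
    IsTransport.map₂ (Φ := fun q : G × G => q.1⁻¹ * q.2) contMDiff_inv_mul_prod h₁ h₂
      (memLp_const 0) fun _ _ => by rw [tderiv_inv_mul_apply, map_zero]
  intro t ht
  have key : (γ₁ t)⁻¹ * γ₂ t = (γ₁ 0)⁻¹ * γ₂ 0 := by
    refine eq_of_locally_eq (h := fun t => (γ₁ t)⁻¹ * γ₂ t) (fun t₀ ht₀ => ?_) ht
      (left_mem_Icc.2 zero_le_one)
    obtain ⟨c, δ, hδ, hm, hp⟩ := h.locally_solution t₀ ht₀
    refine ⟨δ, hδ, fun r hr => ?_⟩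
    have ht₀' : t₀ ∈ Icc (max 0 (t₀ - δ)) (min 1 (t₀ + δ)) :=
      ⟨max_le ht₀.1 (by linarith), le_min ht₀.2 (by linarith)⟩
    refine (extChartAt 𝓘(ℝ, E) c).injOn (hm hr) (hm ht₀') (sub_eq_zero.1 ?_)
    rw [hp.sub_eq ht₀' hr]
    simp
  rw [h0, inv_mul_cancel, inv_mul_eq_one] at key
  exact key

/-- `Ad(γ)' = ad(f) Ad(γ)` along a solution. -/
theorem IsTransport.isPrimitiveOn_AdL (h : IsTransport f γ) :
    IsPrimitiveOn (fun t => AdL (E := E) (γ t))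
      (fun t => (adL E G (f t)).comp (AdL (γ t))) 0 1 := by
  refine IsPrimitiveOn.of_locally ?_ fun t₀ ht₀ => ?_
  · have hL : ContinuousOn (fun t => ((ContinuousLinearMap.compL ℝ E E E).flip
        (AdL (E := E) (γ t))).comp (adL E G)) (Icc 0 1) :=
      (((ContinuousLinearMap.compL ℝ E E E).flip.continuous.comp_continuousOn
        h.continuousOn_AdL).clm_comp continuousOn_const)
    exact IsPrimitiveOn.intervalIntegrable_clm_apply hL
      (h.memLp.intervalIntegrable_Icc zero_le_one) zero_le_one
  · obtain ⟨c, δ, hδ, hm, hp⟩ := h.locally_solution t₀ ht₀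
    have hw := window_le ht₀ hδ
    refine ⟨δ, hδ, ?_⟩
    have hq := hp.comp hw (isOpen_chart_target c) ((contDiffOn_AdL_chart (E := E) c).of_le
      (by exact_mod_cast le_top)) fun t ht => (extChartAt 𝓘(ℝ, E) c).map_source (hm ht)
    refine (hq.congr_fun hw fun t ht => ?_).congr_ae hw ?_
    · simp only [(extChartAt 𝓘(ℝ, E) c).left_inv (hm ht)]
    · refine (ae_restrict_iff' measurableSet_Icc).2 (Eventually.of_forall fun t ht => ?_)
      have := fderiv_AdL_rightChart ((extChartAt 𝓘(ℝ, E) c).map_source (hm ht)) (f t)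
      rw [(extChartAt 𝓘(ℝ, E) c).left_inv (hm ht)] at this
      exact this

/-- Along a solution with control of class `H^s` the adjoint representation is of class
`H^{s+1}`. -/
theorem IsTransport.memSobolev_AdL (h : IsTransport f γ) {s : ℕ} {g : ℝ → E}
    (hg : MemSobolev s 0 1 g) (hgf : g =ᵐ[unitVol] f) :
    MemSobolev (s + 1) 0 1 (fun t => AdL (E := E) (γ t)) := by
  have hp := h.isPrimitiveOn_AdL.congr_ae zero_le_one
    (g' := fun t => (adL E G (g t)).comp (AdL (γ t))) (by
      filter_upwards [hgf] with t ht
      rw [ht])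
  have hL : ContinuousOn (fun t => ((ContinuousLinearMap.compL ℝ E E E).flip
      (AdL (E := E) (γ t))).comp (adL E G)) (Icc 0 1) :=
    (((ContinuousLinearMap.compL ℝ E E E).flip.continuous.comp_continuousOn
      h.continuousOn_AdL).clm_comp continuousOn_const)
  exact MemSobolev.of_ode zero_le_one isOpen_univ
    (Ψ := fun q : (E →L[ℝ] E) × E => (adL E G q.2).comp q.1)
    (((adL E G).contDiff.comp contDiff_snd).clm_comp contDiff_fst).contDiffOn
    (mapsTo_univ _ _) hg hp (MemLp.clm_apply_Icc hL (hg.memLp zero_le_one))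

end Transport

/-! ### Existence of parallel paths -/

theorem ae_unitVol_iff {p : ℝ → Prop} :
    (∀ᵐ t ∂unitVol, p t) ↔ ∀ᵐ t ∂(volume : Measure ℝ), t ∈ Ioo (0 : ℝ) 1 → p t := by
  rw [← ae_restrict_iff' measurableSet_Ioo, restrict_Ioo_eq_restrict_Icc]

section ParallelPath

variable {E : Type*} [NormedAddCommGroup E] [NormedSpace ℝ E]
  {G : Type*} [TopologicalSpace G] [ChartedSpace E G] [Group G] [LieGroup 𝓘(ℝ, E) ∞ G]
  {s : ℕ} {u : SobolevSpace E s} {γ : ℝ → G}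

theorem hasDerivAt_chart {c : G} {t : ℝ} {v : E} (hc : γ t ∈ (extChartAt 𝓘(ℝ, E) c).source)
    (h : HasMFDerivAt 𝓘(ℝ, ℝ) 𝓘(ℝ, E) γ t
      (ContinuousLinearMap.toSpanSingleton ℝ
        (rightTranslate (v : GroupLieAlgebra 𝓘(ℝ, E) G) (γ t)))) :
    HasDerivAt (fun t => extChartAt 𝓘(ℝ, E) c (γ t)) (rightChart c (extChartAt 𝓘(ℝ, E) c (γ t)) v)
      t := by
  have h1 := HasMFDerivAt.comp t
    (((contMDiffAt_chart hc).mdifferentiableAt (by simp)).hasMFDerivAt) h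
  have h2 : HasFDerivAt (fun t => extChartAt 𝓘(ℝ, E) c (γ t))
      ((tderiv 𝓘(ℝ, E) 𝓘(ℝ, E) (extChartAt 𝓘(ℝ, E) c) (γ t)).comp
        (ContinuousLinearMap.toSpanSingleton ℝ (dRight (γ t) 1 v))) t :=
    hasMFDerivAt_iff_hasFDerivAt.1 h1
  have h3 := tderiv_chart_dRight hc v
  have h4 : tderiv 𝓘(ℝ, E) 𝓘(ℝ, E) (extChartAt 𝓘(ℝ, E) c) (γ t) ((1 : ℝ) • dRight (γ t) 1 v) =
      rightChart c (extChartAt 𝓘(ℝ, E) c (γ t)) v := by rw [one_smul, h3]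
  rw [← h4]
  exact h2.hasDerivAt

theorem hasMFDerivAt_of_chart {c : G} {t : ℝ} {v : E} (hγ : ContinuousAt γ t)
    (hc : γ t ∈ (extChartAt 𝓘(ℝ, E) c).source)
    (h : HasDerivAt (fun t => extChartAt 𝓘(ℝ, E) c (γ t))
      (rightChart c (extChartAt 𝓘(ℝ, E) c (γ t)) v) t) :
    HasMFDerivAt 𝓘(ℝ, ℝ) 𝓘(ℝ, E) γ t
      (ContinuousLinearMap.toSpanSingleton ℝ
        (rightTranslate (v : GroupLieAlgebra 𝓘(ℝ, E) G) (γ t))) := by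
  have hl := (extChartAt 𝓘(ℝ, E) c).left_inv hc
  have hs := (contMDiffAt_chart_symm (E := E) (c := c)
    ((extChartAt 𝓘(ℝ, E) c).map_source hc)).mdifferentiableAt (by simp)
  have h1 := HasMFDerivAt.comp (g := (extChartAt 𝓘(ℝ, E) c).symm) t hs.hasMFDerivAt
    (hasMFDerivAt_iff_hasFDerivAt.2 h.hasFDerivAt)
  have h2 : γ =ᶠ[𝓝 t] (extChartAt 𝓘(ℝ, E) c).symm ∘ fun t => extChartAt 𝓘(ℝ, E) c (γ t) := by
    filter_upwards [hγ ((isOpen_extChartAt_source (I := 𝓘(ℝ, E)) c).mem_nhds hc)] with r hr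
    exact ((extChartAt 𝓘(ℝ, E) c).left_inv hr).symm
  have h3 := h1.congr_of_eventuallyEq h2
  have h4 : (tderiv 𝓘(ℝ, E) 𝓘(ℝ, E) (extChartAt 𝓘(ℝ, E) c).symm (extChartAt 𝓘(ℝ, E) c (γ t))).comp
      (ContinuousLinearMap.toSpanSingleton ℝ (rightChart c (extChartAt 𝓘(ℝ, E) c (γ t)) v)) =
      ContinuousLinearMap.toSpanSingleton ℝ (dRight (γ t) 1 v) := by
    rw [← tderiv_chart_dRight hc]
    have h5 := tderiv_comp (γ t) hs ((contMDiffAt_chart (E := E) hc).mdifferentiableAt (by simp))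
    have h6 : tderiv 𝓘(ℝ, E) 𝓘(ℝ, E) (fun y : G => (extChartAt 𝓘(ℝ, E) c).symm
        (extChartAt 𝓘(ℝ, E) c y)) (γ t) = ContinuousLinearMap.id ℝ E := by
      rw [← tderiv_id (I₁ := 𝓘(ℝ, E)) (γ t)]
      refine tderiv_congr ?_
      filter_upwards [(isOpen_extChartAt_source (I := 𝓘(ℝ, E)) c).mem_nhds hc] with x hx
      exact (extChartAt 𝓘(ℝ, E) c).left_inv hx
    rw [h6] at h5
    refine ContinuousLinearMap.ext fun r => ?_
    simp only [ContinuousLinearMap.comp_apply, ContinuousLinearMap.toSpanSingleton_apply, map_smul]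
    rw [← ContinuousLinearMap.comp_apply, ← h5, ContinuousLinearMap.id_apply]
  refine HasMFDerivAt.congr_mfderiv h3 ?_
  exact h4

variable [CompleteSpace E]

/-- A path of class `H^{s+1}` with right logarithmic derivative `u` solves the equation. -/
theorem IsParallelPath.isTransport (h : IsParallelPath u γ) : IsTransport (u.1 0) γ := by
  refine ⟨Lp.memLp _, h.mem.1, fun t₀ ht₀ => ?_⟩
  obtain ⟨δ, hδ, hm, hs⟩ := h.mem.2 t₀ ht₀
  have hw := window_le ht₀ hδ
  obtain ⟨x', -, hx'⟩ := hs.exists_primitive hw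
  refine ⟨γ t₀, δ, hδ, hm, hx'.congr_ae hw ?_⟩
  filter_upwards [hx'.ae_hasDerivAt hw, ae_restrict_mem measurableSet_Icc,
    ae_mono (Measure.restrict_mono (window_subset t₀ δ) le_rfl) h.deriv] with t h1 ht h2
  exact h1.unique (hasDerivAt_chart (hm t ht) h2)

/-- Solutions with control `u` of class `H^s` are of class `H^{s+1}`. -/
theorem IsTransport.isParallelPath (h : IsTransport (u.1 0) γ) (h0 : γ 0 = 1) :
    IsParallelPath u γ := by
  obtain ⟨f, hf, hfu⟩ := SobolevSpace.exists_memSobolev u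
  refine ⟨⟨h.continuousOn, fun t₀ ht₀ => ?_⟩, h0, ?_⟩
  · obtain ⟨δ, hδ, hm, hp⟩ := h.exists_centered ht₀
    have hw := window_le ht₀ hδ
    have hmt : MapsTo (fun t => extChartAt 𝓘(ℝ, E) (γ t₀) (γ t))
        (Icc (max 0 (t₀ - δ)) (min 1 (t₀ + δ))) (extChartAt 𝓘(ℝ, E) (γ t₀)).target :=
      fun t ht => (extChartAt 𝓘(ℝ, E) (γ t₀)).map_source (hm ht)
    refine ⟨δ, hδ, hm, ?_⟩
    replace hf := hf.mono (le_max_left 0 (t₀ - δ)) hw (min_le_left 1 (t₀ + δ))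
    refine MemSobolev.of_ode hw (isOpen_chart_target (γ t₀))
      (Ψ := fun q : E × E => rightChart (γ t₀) q.1 q.2) ?_ hmt hf (hp.congr_ae hw ?_) ?_
    · exact ((contDiffOn_rightChart (γ t₀)).comp contDiff_fst.contDiffOn
        fun q hq => hq.1).clm_apply contDiff_snd.contDiffOn
    · filter_upwards [ae_mono (Measure.restrict_mono (window_subset t₀ δ) le_rfl) hfu] with t ht
      rw [ht]
    · exact MemLp.clm_apply_Icc ((contDiffOn_rightChart (γ t₀)).continuousOn.comp
        (hp.continuousOn hw) hmt) (hf.memLp hw)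
  · refine ae_unitVol_iff.2 (ae_iff.2 ?_)
    refine measure_null_of_locally_null _ fun t₀ ht₀ => ?_
    simp only [mem_ofPred_eq, Classical.not_imp] at ht₀
    obtain ⟨δ, hδ, hm, hp⟩ := h.exists_centered (Ioo_subset_Icc_self ht₀.1)
    have hw := window_le (Ioo_subset_Icc_self ht₀.1) hδ
    refine ⟨_, inter_mem_nhdsWithin _ (Icc_mem_nhds (sub_lt_self t₀ hδ)
      (lt_add_of_pos_right t₀ hδ)), ?_⟩
    have h2 := (ae_restrict_iff' measurableSet_Icc).1 (hp.ae_hasDerivAt hw)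
    refine measure_mono_null (fun t ht => ?_) (ae_iff.1 h2)
    simp only [mem_inter_iff, mem_ofPred_eq, Classical.not_imp] at ht ⊢
    obtain ⟨⟨hI, hn⟩, hδt⟩ := ht
    have htw : t ∈ Icc (max 0 (t₀ - δ)) (min 1 (t₀ + δ)) :=
      ⟨max_le hI.1.le hδt.1, le_min hI.2.le hδt.2⟩
    exact ⟨htw, fun hd => hn (hasMFDerivAt_of_chart
      (h.continuousOn.continuousAt (Icc_mem_nhds hI.1 hI.2)) (hm htw) hd)⟩

theorem IsParallelPath.eqOn {γ₁ γ₂ : ℝ → G} (h₁ : IsParallelPath u γ₁) (h₂ : IsParallelPath u γ₂) :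
    EqOn γ₁ γ₂ (Icc 0 1) :=
  h₁.isTransport.eqOn h₂.isTransport (h₁.start.trans h₂.start.symm)

end ParallelPath

section Existence

variable (E : Type*) [NormedAddCommGroup E] [NormedSpace ℝ E] [FiniteDimensional ℝ E]
  (G : Type*) [TopologicalSpace G] [ChartedSpace E G] [Group G] [LieGroup 𝓘(ℝ, E) ∞ G]

/-- For small controls solutions exist, and their end point depends smoothly on the control. -/
theorem exists_smooth_endpoint : ∃ ψ : Lp E 2 unitVol → G,
    ContMDiffAt 𝓘(ℝ, Lp E 2 unitVol) 𝓘(ℝ, E) ∞ ψ 0 ∧ ψ 0 = 1 ∧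
    tderiv 𝓘(ℝ, Lp E 2 unitVol) 𝓘(ℝ, E) ψ 0 = integralLp ∧
    ∀ᶠ u : Lp E 2 unitVol in 𝓝 0, ∃ γ : ℝ → G, IsTransport u γ ∧ γ 0 = 1 ∧ γ 1 = ψ u := by
  set p := extChartAt 𝓘(ℝ, E) (1 : G) 1 with hp
  have hpt : p ∈ (extChartAt 𝓘(ℝ, E) (1 : G)).target := mem_extChartAt_target 1
  have hsymm : (extChartAt 𝓘(ℝ, E) (1 : G)).symm p = 1 := extChartAt_to_inv 1
  obtain ⟨y, hy, hdy, hy0, hsol⟩ := exists_smooth_solution (isOpen_chart_target (1 : G)) hpt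
    (contDiffOn_rightChart (E := E) (1 : G)) rightChart_one
  have hx : ContDiffAt ℝ ∞ (fun u => p + integralLp (y u)) 0 :=
    contDiffAt_const.add ((integralLp (F := E)).contDiff.contDiffAt.comp 0 hy)
  have hx0 : p + integralLp (y 0) = p := by rw [hy0, map_zero, add_zero]
  have hs : ContMDiffAt 𝓘(ℝ, E) 𝓘(ℝ, E) ∞ (extChartAt 𝓘(ℝ, E) (1 : G)).symm
      (p + integralLp (y 0)) := by
    rw [hx0]; exact contMDiffAt_chart_symm hpt
  refine ⟨fun u => (extChartAt 𝓘(ℝ, E) (1 : G)).symm (p + integralLp (y u)),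
    ContMDiffAt.comp 0 hs hx.contMDiffAt,
    (congrArg (extChartAt 𝓘(ℝ, E) (1 : G)).symm hx0).trans hsymm, ?_, ?_⟩
  · have h1 := tderiv_comp (I₁ := 𝓘(ℝ, Lp E 2 unitVol)) 0 (hs.mdifferentiableAt (by simp))
      (hx.contMDiffAt.mdifferentiableAt (by simp))
    have h2 : tderiv 𝓘(ℝ, Lp E 2 unitVol) 𝓘(ℝ, E) (fun u => p + integralLp (y u)) 0 =
        integralLp := by
      refine mfderiv_eq_fderiv.trans ?_
      have := ((integralLp (F := E)).hasFDerivAt.comp 0 hdy).const_add p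
      exact this.fderiv.trans (ContinuousLinearMap.comp_id _)
    have h3 : tderiv 𝓘(ℝ, E) 𝓘(ℝ, E) (extChartAt 𝓘(ℝ, E) (1 : G)).symm p =
        ContinuousLinearMap.id ℝ E := by
      have h4 := tderiv_comp (f := extChartAt 𝓘(ℝ, E) (1 : G)) (1 : G)
          ((contMDiffAt_chart_symm (E := E) hpt).mdifferentiableAt
        (by simp)) ((contMDiffAt_chart (E := E) (mem_extChartAt_source (1 : G))).mdifferentiableAt
        (by simp))
      rw [tderiv_extChartAt_self, ContinuousLinearMap.comp_id] at h4
      rw [← hp] at h4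
      rw [← h4, ← tderiv_id (I₁ := 𝓘(ℝ, E)) (1 : G)]
      refine tderiv_congr ?_
      filter_upwards [extChartAt_source_mem_nhds (I := 𝓘(ℝ, E)) (1 : G)] with x hx
      exact (extChartAt 𝓘(ℝ, E) (1 : G)).left_inv hx
    rw [h1, h2, hx0, h3, ContinuousLinearMap.id_comp]
  · filter_upwards [hsol] with u hu
    have hprim := isPrimitiveOn_integral_Lp (y u) p
    have hcont : ContinuousOn (fun t => (extChartAt 𝓘(ℝ, E) (1 : G)).symm
        (p + ∫ τ in (0 : ℝ)..t, y u τ)) (Icc 0 1) :=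
      (continuousOn_extChartAt_symm (1 : G)).comp (hprim.continuousOn zero_le_one) hu.1
    refine ⟨fun t => (extChartAt 𝓘(ℝ, E) (1 : G)).symm (p + ∫ τ in (0 : ℝ)..t, y u τ),
      ⟨Lp.memLp u, hcont, fun t₀ ht₀ => ⟨1, 1, one_pos, fun t ht =>
        (extChartAt 𝓘(ℝ, E) (1 : G)).map_target (hu.1 t (window_subset _ _ ht)), ?_⟩⟩, ?_, rfl⟩
    · have hw := window_le ht₀ one_pos
      refine ((hprim.mono (le_max_left _ _) hw (min_le_left _ _)).congr_fun hw
        fun t ht => ?_).congr_ae hw ?_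
      · exact ((extChartAt 𝓘(ℝ, E) (1 : G)).right_inv (hu.1 t (window_subset _ _ ht))).symm
      · filter_upwards [ae_restrict_mem measurableSet_Icc,
          ae_mono (Measure.restrict_mono (window_subset t₀ 1) le_rfl) hu.2] with t ht h
        rw [h, (extChartAt 𝓘(ℝ, E) (1 : G)).right_inv (hu.1 t (window_subset _ _ ht))]
    · simp only [intervalIntegral.integral_same, add_zero, hsymm]

end Existence

section Compact

variable {E : Type*} [NormedAddCommGroup E] [NormedSpace ℝ E]
  {G : Type*} [TopologicalSpace G] [ChartedSpace E G] [Group G] [LieGroup 𝓘(ℝ, E) ∞ G]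

variable (E G) in
theorem exists_norm_AdL_le [CompactSpace G] : ∃ C > 0, ∀ (a : G) (v : E), ‖AdL a v‖ ≤ C * ‖v‖ := by
  obtain ⟨C, hC⟩ :=
    (isCompact_range (contMDiff_AdL (E := E) (G := G)).continuous).isBounded.exists_norm_le
  refine ⟨max C 1, by positivity, fun a v => ((AdL a).le_opNorm v).trans ?_⟩
  exact mul_le_mul_of_nonneg_right ((hC _ (mem_range_self a)).trans (le_max_left _ _))
    (norm_nonneg v)

/-- The operator `w ↦ Ad(γ⁻¹) w` on `L²([0,1], 𝔤)`. -/
def adInvLp {γ : ℝ → G} {f : ℝ → E} (h : IsTransport f γ) : Lp E 2 unitVol →L[ℝ] Lp E 2 unitVol :=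
  mulLp (ContinuousLinearMap.id ℝ (E →L[ℝ] E)) (curveOfContinuousOn h.continuousOn_AdL_inv)

theorem coeFn_adInvLp {γ : ℝ → G} {f : ℝ → E} (h : IsTransport f γ) (w : Lp E 2 unitVol) :
    adInvLp h w =ᵐ[unitVol] fun t => AdL (γ t)⁻¹ (w t) :=
  coeFn_mulLp_curveOfContinuousOn h.continuousOn_AdL_inv w

variable [CompleteSpace E]

/-- Gauge transformation: a solution for the control `u` is obtained from one for `u₀` by
multiplication with a solution for `Ad(γ⁻¹) (u - u₀)`. -/
theorem IsTransport.mul_of_adInvLp {γ₀ γ : ℝ → G} {u₀ u : Lp E 2 unitVol} (h₀ : IsTransport u₀ γ₀)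
    (h : IsTransport (adInvLp h₀ (u - u₀)) γ) : IsTransport u (fun t => γ₀ t * γ t) := by
  refine (h₀.mul h).congr_ae ?_
  filter_upwards [coeFn_adInvLp h₀ (u - u₀), Lp.coeFn_sub u u₀] with t h1 h2
  rw [h1, h2, ← ContinuousLinearMap.comp_apply, AdL_comp_inv]
  simp

/-- Every control function of class `L²` has a solution. -/
theorem exists_isTransport [FiniteDimensional ℝ E] [CompactSpace G] (u : Lp E 2 unitVol) :
    ∃ γ : ℝ → G, IsTransport u γ ∧ γ 0 = 1 := by
  obtain ⟨C, hC, hCA⟩ := exists_norm_AdL_le E G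
  obtain ⟨ψ, -, -, -, hψ⟩ := exists_smooth_endpoint E G
  obtain ⟨ε, hε, hball⟩ := Metric.eventually_nhds_iff.1 hψ
  have hsmall : ∀ w : Lp E 2 unitVol, ‖w‖ < ε → ∃ γ : ℝ → G, IsTransport w γ ∧ γ 0 = 1 := by
    intro w hw
    obtain ⟨γ, h1, h2, -⟩ := hball (y := w) (by rwa [dist_zero_right])
    exact ⟨γ, h1, h2⟩
  -- the norm of `Ad(γ⁻¹) w` is bounded uniformly in `γ`, so solvability propagates in steps of
  -- uniform length
  have hstep : ∀ u₀ u : Lp E 2 unitVol, ‖u - u₀‖ < ε / C →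
      (∃ γ : ℝ → G, IsTransport u₀ γ ∧ γ 0 = 1) → ∃ γ : ℝ → G, IsTransport u γ ∧ γ 0 = 1 := by
    rintro u₀ u hu ⟨γ₀, h₀, h00⟩
    have hn : ‖adInvLp h₀ (u - u₀)‖ ≤ C * ‖u - u₀‖ := by
      refine Lp.norm_le_mul_norm_of_ae_le_mul ?_
      filter_upwards [coeFn_adInvLp h₀ (u - u₀)] with t ht
      rw [ht]
      exact hCA _ _
    obtain ⟨γ, h, h0⟩ := hsmall _ (hn.trans_lt (by rwa [lt_div_iff₀' hC] at hu))
    exact ⟨_, h₀.mul_of_adInvLp h, by rw [h00, h0, mul_one]⟩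
  obtain ⟨n, hn⟩ := exists_nat_gt (‖u‖ / (ε / C))
  have hn0 : (0 : ℝ) < n := lt_of_le_of_lt (by positivity) hn
  have hind : ∀ k : ℕ, ∃ γ : ℝ → G,
      IsTransport (((k : ℝ) / n) • u : Lp E 2 unitVol) γ ∧ γ 0 = 1 := by
    intro k
    induction k with
    | zero => exact hsmall _ (by simpa using hε)
    | succ k ih =>
      refine hstep _ _ ?_ ih
      rw [← sub_smul, norm_smul, ← sub_div, Nat.cast_succ, add_sub_cancel_left, norm_div, norm_one,
        Real.norm_of_nonneg hn0.le, one_div_mul_eq_div, div_lt_iff₀ hn0]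
      rwa [div_lt_iff₀ (by positivity), mul_comm] at hn
  have := hind n
  rwa [div_self hn0.ne', one_smul] at this

end Compact

section Endpoint

variable {E : Type*} [NormedAddCommGroup E] [NormedSpace ℝ E]
  {G : Type*} [TopologicalSpace G] [ChartedSpace E G] [Group G] [LieGroup 𝓘(ℝ, E) ∞ G] {s : ℕ}

variable (E s) in
/-- The inclusion of `H^s([0,1], E)` into `L²([0,1], E)`. -/
def sobolevToLp : SobolevSpace E s →L[ℝ] Lp E 2 unitVol :=
  (ContinuousLinearMap.proj 0).comp (SobolevSpace E s).subtypeL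

variable [CompleteSpace E]

theorem IsTransport.parallelTransport_eq {u : SobolevSpace E s} {γ : ℝ → G}
    (h : IsTransport (u.1 0) γ) (h0 : γ 0 = 1) : parallelTransport G s u = γ 1 := by
  have hex : ∃ γ : ℝ → G, IsParallelPath u γ := ⟨γ, h.isParallelPath h0⟩
  rw [parallelTransport, dif_pos hex]
  exact hex.choose_spec.eqOn (h.isParallelPath h0) (right_mem_Icc.2 zero_le_one)

variable [FiniteDimensional ℝ E]

theorem exists_isParallelPath [CompactSpace G] (u : SobolevSpace E s) :
    ∃ γ : ℝ → G, IsParallelPath u γ := by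
  obtain ⟨γ, h, h0⟩ := exists_isTransport (G := G) (u.1 0)
  exact ⟨γ, h.isParallelPath h0⟩

/-- Near `u₀`, the parallel transport map is a smooth function of `Ad(γ₀⁻¹) (u - u₀)`. -/
theorem contMDiffAt_and_tderiv_parallelTransport {u₀ : SobolevSpace E s} {γ₀ : ℝ → G}
    (h₀ : IsTransport (u₀.1 0) γ₀) (h00 : γ₀ 0 = 1) :
    ContMDiffAt 𝓘(ℝ, SobolevSpace E s) 𝓘(ℝ, E) ∞ (parallelTransport G s) u₀ ∧
    tderiv 𝓘(ℝ, SobolevSpace E s) 𝓘(ℝ, E) (parallelTransport G s) u₀ =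
      (dLeft (γ₀ 1) 1).comp (integralLp.comp ((adInvLp h₀).comp (sobolevToLp E s))) := by
  obtain ⟨ψ, hψ, hψ1, hdψ, hsol⟩ := exists_smooth_endpoint E G
  let M : SobolevSpace E s →L[ℝ] Lp E 2 unitVol := (adInvLp h₀).comp (sobolevToLp E s)
  have hM0 : M (u₀ - u₀) = 0 := by rw [sub_self, map_zero]
  have hMd : HasFDerivAt (fun u => M (u - u₀)) M u₀ :=
    (M.hasFDerivAt.comp u₀ ((hasFDerivAt_id u₀).sub_const u₀)).congr_fderiv
      (ContinuousLinearMap.comp_id M)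
  have hMs : ContDiff ℝ ∞ (fun u => M (u - u₀)) := M.contDiff.comp (contDiff_id.sub contDiff_const)
  have heq : parallelTransport G s =ᶠ[𝓝 u₀] fun u => γ₀ 1 * ψ (M (u - u₀)) := by
    have ht : Tendsto (fun u => M (u - u₀)) (𝓝 u₀) (𝓝 0) := by
      have := hMs.continuous.tendsto u₀
      rwa [hM0] at this
    filter_upwards [ht.eventually hsol] with u hu
    obtain ⟨γ, h, h0, h1⟩ := hu
    have h2 : IsTransport (u.1 0) (fun t => γ₀ t * γ t) := h₀.mul_of_adInvLp h
    rw [h2.parallelTransport_eq (by rw [h00, h0, mul_one]), h1]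
  have hψ' : ContMDiffAt 𝓘(ℝ, Lp E 2 unitVol) 𝓘(ℝ, E) ∞ ψ (M (u₀ - u₀)) := by rwa [hM0]
  have hc : ContMDiffAt 𝓘(ℝ, SobolevSpace E s) 𝓘(ℝ, E) ∞ (fun u => ψ (M (u - u₀))) u₀ :=
    ContMDiffAt.comp u₀ hψ' hMs.contMDiff.contMDiffAt
  have hl : ContMDiff 𝓘(ℝ, E) 𝓘(ℝ, E) ∞ (fun x : G => γ₀ 1 * x) :=
    contMDiff_mul_left (I := 𝓘(ℝ, E)) (n := ∞)
  refine ⟨(ContMDiffAt.comp u₀ (hl (ψ (M (u₀ - u₀)))) hc).congr_of_eventuallyEq heq, ?_⟩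
  rw [tderiv_congr heq, tderiv_comp (f := fun u => ψ (M (u - u₀))) u₀
    (mdifferentiableAt_leftMul (E := E) (γ₀ 1) (ψ (M (u₀ - u₀))))
    (hc.mdifferentiableAt (by simp)), tderiv_comp (f := fun u => M (u - u₀)) u₀
    (hψ'.mdifferentiableAt (by simp)) (hMs.contMDiff.contMDiffAt.mdifferentiableAt (by simp)), hM0,
    hdψ, hψ1]
  have : tderiv 𝓘(ℝ, SobolevSpace E s) 𝓘(ℝ, Lp E 2 unitVol) (fun u => M (u - u₀)) u₀ = M :=
    mfderiv_eq_fderiv.trans hMd.fderiv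
  rw [this]
  rfl

/-- The differential of the parallel transport map is `ξ ↦ (L_{γ(1)})_* ∫ Ad(γ⁻¹) ξ`. -/
theorem tderiv_parallelTransport {u : SobolevSpace E s} {γ : ℝ → G} (h : IsTransport (u.1 0) γ)
    (h0 : γ 0 = 1) (ξ : SobolevSpace E s) :
    tderiv 𝓘(ℝ, SobolevSpace E s) 𝓘(ℝ, E) (parallelTransport G s) u ξ =
      dLeft (γ 1) 1 (integralLp (adInvLp h (ξ.1 0))) := by
  rw [(contMDiffAt_and_tderiv_parallelTransport h h0).2]
  rfl

variable (E G) in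
/-- Every group element near `1` is the end point of the solution for a constant control. -/
theorem eventually_exists_const_control : ∀ᶠ a : G in 𝓝 1, ∃ (v : E) (γ : ℝ → G),
    IsTransport (fun _ => v) γ ∧ γ 0 = 1 ∧ γ 1 = a := by
  obtain ⟨ψ, hψ, hψ1, hdψ, hsol⟩ := exists_smooth_endpoint E G
  let c : E →L[ℝ] Lp E 2 unitVol := Lp.constL 2 unitVol ℝ
  have hc : ∀ v, c v =ᵐ[unitVol] fun _ => v := fun v => Lp.coeFn_const 2 unitVol v
  have hψ' : ContMDiffAt 𝓘(ℝ, Lp E 2 unitVol) 𝓘(ℝ, E) ∞ ψ (c 0) := by rwa [map_zero]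
  have hψc : ContMDiffAt 𝓘(ℝ, E) 𝓘(ℝ, E) ∞ (fun v => ψ (c v)) 0 :=
    ContMDiffAt.comp 0 hψ' c.contDiff.contMDiff.contMDiffAt
  have hψc0 : ψ (c 0) = 1 := by rw [map_zero, hψ1]
  have hch : ContMDiffAt 𝓘(ℝ, E) 𝓘(ℝ, E) ∞ (extChartAt 𝓘(ℝ, E) (1 : G)) (ψ (c 0)) := by
    rw [hψc0]; exact contMDiffAt_chart (mem_extChartAt_source (1 : G))
  have hF : ContDiffAt ℝ ∞ (fun v => extChartAt 𝓘(ℝ, E) (1 : G) (ψ (c v))) 0 :=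
    (ContMDiffAt.comp (f := fun v => ψ (c v)) 0 hch hψc).contDiffAt
  have hd : fderiv ℝ (fun v => extChartAt 𝓘(ℝ, E) (1 : G) (ψ (c v))) 0 =
      ContinuousLinearMap.id ℝ E := by
    rw [← tderiv_vectorSpace, tderiv_comp (f := fun v => ψ (c v)) 0
      (hch.mdifferentiableAt (by simp))
      (hψc.mdifferentiableAt (by simp)), tderiv_comp (f := fun v => c v) 0
      (hψ'.mdifferentiableAt (by simp)) (c.contDiff.contMDiff.contMDiffAt.mdifferentiableAt
      (n := ∞) (by simp)), map_zero, hψ1, tderiv_extChartAt_self, hdψ, ContinuousLinearMap.id_comp,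
      tderiv, mfderiv_eq_fderiv]
    refine ContinuousLinearMap.ext fun v => ?_
    rw [ContinuousLinearMap.fderiv, ContinuousLinearMap.comp_apply, integralLp_apply,
      intervalIntegral_congr_unitVol (hc v) (right_mem_Icc.2 zero_le_one)]
    simp
  have hmap := (hF.hasStrictFDerivAt (by simp)).map_nhds_eq_of_surj (by
    rw [hd]; exact LinearMap.range_eq_top.2 fun v => ⟨v, rfl⟩)
  simp only [hψc0] at hmap
  have hev : ∀ᶠ v in 𝓝 (0 : E), ψ (c v) ∈ (extChartAt 𝓘(ℝ, E) (1 : G)).source ∧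
      ∃ γ : ℝ → G, IsTransport (c v) γ ∧ γ 0 = 1 ∧ γ 1 = ψ (c v) := by
    refine (hψc.continuousAt.eventually ?_).and ?_
    · simp only [hψc0]
      exact extChartAt_source_mem_nhds (1 : G)
    · have := c.continuous.tendsto 0
      rw [map_zero] at this
      exact this.eventually hsol
  have h1 : ∀ᶠ x in 𝓝 (extChartAt 𝓘(ℝ, E) (1 : G) 1), ∃ v,
      (ψ (c v) ∈ (extChartAt 𝓘(ℝ, E) (1 : G)).source ∧
      ∃ γ : ℝ → G, IsTransport (c v) γ ∧ γ 0 = 1 ∧ γ 1 = ψ (c v)) ∧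
      extChartAt 𝓘(ℝ, E) (1 : G) (ψ (c v)) = x := by
    rw [← hmap]
    exact hev.mono fun v hv => ⟨v, hv, rfl⟩
  filter_upwards [(continuousAt_extChartAt (I := 𝓘(ℝ, E)) (1 : G)).eventually h1,
    extChartAt_source_mem_nhds (I := 𝓘(ℝ, E)) (1 : G)] with a ha has
  obtain ⟨v, ⟨hs, γ, h, h0, h1⟩, hv⟩ := ha
  exact ⟨v, γ, h.congr_ae (hc v), h0, h1.trans ((extChartAt 𝓘(ℝ, E) (1 : G)).injOn hs has hv)⟩

variable (E G s) in
/-- The image of the parallel transport map contains a neighbourhood of `1` and is closed under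
multiplication, hence is open and closed. -/
theorem surjective_parallelTransport [ConnectedSpace G] :
    Function.Surjective (parallelTransport (E := E) G s) := by
  let S : Set G := {a | ∃ (f : ℝ → E) (γ : ℝ → G), MemSobolev s 0 1 f ∧ IsTransport f γ ∧
    γ 0 = 1 ∧ γ 1 = a}
  have hmul : ∀ a ∈ S, ∀ b ∈ S, a * b ∈ S := by
    rintro _ ⟨f₁, γ₁, hf₁, h₁, h₁0, rfl⟩ _ ⟨f₂, γ₂, hf₂, h₂, h₂0, rfl⟩
    refine ⟨_, _, ?_, h₁.mul h₂, by rw [h₁0, h₂0, mul_one], rfl⟩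
    have h3 := MemSobolev.clm_apply zero_le_one (h₁.memSobolev_AdL hf₁ EventuallyEq.rfl) hf₂
    exact MemSobolev.clm_apply zero_le_one (MemSobolev.const (s + 1) 0 1
      (ContinuousLinearMap.fst ℝ E E + ContinuousLinearMap.snd ℝ E E)) (hf₁.prodMk h3 zero_le_one)
  have hone : S ∈ 𝓝 (1 : G) := by
    filter_upwards [eventually_exists_const_control E G] with a ha
    obtain ⟨v, γ, h, h0, h1⟩ := ha
    exact ⟨_, γ, MemSobolev.const s 0 1 v, h, h0, h1⟩
  have := topologicalGroup_of_lieGroup 𝓘(ℝ, E) ∞ (G := G)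
  have hopen : IsOpen S := isOpen_iff_mem_nhds.2 fun a ha => by
    have ht : Tendsto (fun x => a⁻¹ * x) (𝓝 a) (𝓝 1) := by
      have := (continuous_const_mul a⁻¹).tendsto a
      rwa [inv_mul_cancel] at this
    filter_upwards [ht hone] with x hx
    simpa using hmul a ha _ hx
  have hclosed : IsClosed S := isClosed_of_closure_subset fun x hx => by
    have ht : Tendsto (fun y => y⁻¹ * x) (𝓝 x) (𝓝 1) := by
      have := ((continuous_inv (G := G)).mul_const x).tendsto x
      rwa [inv_mul_cancel] at this
    obtain ⟨y, hy, hyS⟩ := mem_closure_iff_nhds.1 hx _ (ht hone)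
    simpa using hmul y hyS _ hy
  have huniv : S = univ := IsClopen.eq_univ ⟨hclosed, hopen⟩ ⟨1, mem_of_mem_nhds hone⟩
  intro a
  obtain ⟨f, γ, hf, h, h0, h1⟩ : a ∈ S := huniv ▸ mem_univ a
  obtain ⟨u, hu⟩ := SobolevSpace.exists_of_memSobolev hf
  exact ⟨u, ((h.congr_ae hu.symm).parallelTransport_eq h0).trans h1⟩

variable [CompactSpace G]

variable (E G s) in
theorem contMDiff_parallelTransport :
    ContMDiff 𝓘(ℝ, SobolevSpace E s) 𝓘(ℝ, E) ∞ (parallelTransport (E := E) G s) := by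
  intro u
  obtain ⟨γ, h, h0⟩ := exists_isTransport (G := G) (u.1 0)
  exact (contMDiffAt_and_tderiv_parallelTransport h h0).1

end Endpoint

/-! ### Components and representatives of Sobolev functions -/

section Components

theorem coeFn_sum_Lp {E ι : Type*} [NormedAddCommGroup E] (A : Finset ι) (f : ι → Lp E 2 unitVol) :
    ⇑(∑ i ∈ A, f i) =ᵐ[unitVol] fun t => ∑ i ∈ A, f i t := by
  classical
  induction A using Finset.induction_on with
  | empty =>
    filter_upwards [Lp.coeFn_zero E 2 unitVol] with t ht
    exact ht
  | insert a A ha ih =>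
    rw [Finset.sum_insert ha]
    filter_upwards [Lp.coeFn_add (f a) (∑ i ∈ A, f i), ih] with t h1 h2
    rw [h1, Pi.add_apply, h2, Finset.sum_insert ha]

variable {E : Type*} [NormedAddCommGroup E] [NormedSpace ℝ E] {s : ℕ}

variable (E s) in
/-- The `i`-th weak derivative, as an operator from `H^s` to `L²`; it is `0` for `i > s`. -/
def sobolevComponent (i : ℕ) : SobolevSpace E s →L[ℝ] Lp E 2 unitVol :=
  if h : i < s + 1 then (ContinuousLinearMap.proj (⟨i, h⟩ : Fin (s + 1))).comp
    (SobolevSpace E s).subtypeL else 0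

theorem sobolevComponent_apply {i : ℕ} (h : i < s + 1) (u : SobolevSpace E s) :
    sobolevComponent E s i u = u.1 ⟨i, h⟩ := by
  rw [sobolevComponent, dif_pos h]
  rfl

variable (E) in
/-- The inclusion of the continuous curves into `L²`. -/
def curveToL2 : C(Icc (0 : ℝ) 1, E) →L[ℝ] Lp E 2 unitVol :=
  (mulLp (ContinuousLinearMap.lsmul ℝ ℝ : ℝ →L[ℝ] E →L[ℝ] E).flip).flip
    (Lp.const 2 unitVol (1 : ℝ))

theorem coeFn_curveToL2 (x : C(Icc (0 : ℝ) 1, E)) :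
    curveToL2 E x =ᵐ[unitVol] IccExtend zero_le_one x := by
  filter_upwards [coeFn_mulLp (ContinuousLinearMap.lsmul ℝ ℝ : ℝ →L[ℝ] E →L[ℝ] E).flip x
    (Lp.const 2 unitVol (1 : ℝ)), Lp.coeFn_const 2 unitVol (1 : ℝ)] with t h1 h2
  refine h1.trans ?_
  rw [h2]
  simp

variable (E s) in
/-- The continuous representative of the `i`-th derivative, for `i < s`. Its constant of integration
is found by averaging over `[0,1]`. -/
def sobolevCurve (i : ℕ) : SobolevSpace E s →L[ℝ] C(Icc (0 : ℝ) 1, E) :=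
  let path := integralPath.comp (sobolevComponent E s (i + 1))
  path + (ContinuousLinearMap.const ℝ (Icc (0 : ℝ) 1)).comp
    (integralLp.comp (sobolevComponent E s i - (curveToL2 E).comp path))

theorem coeFn_sobolevCurve [CompleteSpace E] {i : ℕ} (h : i < s) (u : SobolevSpace E s) :
    IccExtend zero_le_one (sobolevCurve E s i u) =ᵐ[unitVol] sobolevComponent E s i u := by
  obtain ⟨c, hc⟩ := u.2 ⟨i, h⟩
  have h1 : sobolevComponent E s i u = u.1 (Fin.castSucc ⟨i, h⟩) := sobolevComponent_apply _ u
  have h2 : sobolevComponent E s (i + 1) u = u.1 (Fin.succ ⟨i, h⟩) :=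
    sobolevComponent_apply (Nat.succ_lt_succ h) u
  rw [← h1, ← h2] at hc
  set x := integralPath (sobolevComponent E s (i + 1) u) with hx
  have hxe : ∀ t ∈ Icc (0 : ℝ) 1, IccExtend zero_le_one x t =
      ∫ τ in (0 : ℝ)..t, sobolevComponent E s (i + 1) u τ := fun t ht => by
    rw [IccExtend_of_mem _ _ ht]; rfl
  have hconst : integralLp (sobolevComponent E s i u - curveToL2 E x) = c := by
    have h3 : ⇑(sobolevComponent E s i u - curveToL2 E x) =ᵐ[unitVol] fun _ => c := by
      filter_upwards [Lp.coeFn_sub (sobolevComponent E s i u) (curveToL2 E x), hc,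
        coeFn_curveToL2 x, ae_restrict_mem measurableSet_Icc] with t h3 h4 h5 ht
      rw [h3, Pi.sub_apply, h4, h5, hxe t ht, add_sub_cancel_right]
    rw [integralLp_apply, intervalIntegral_congr_unitVol h3 (right_mem_Icc.2 zero_le_one)]
    simp
  filter_upwards [hc, ae_restrict_mem measurableSet_Icc] with t h4 ht
  rw [h4, ← hxe t ht, ← hconst, IccExtend_of_mem _ _ ht, IccExtend_of_mem _ _ ht]
  exact add_comm _ _

end Components

/-! ### The covariant derivative as an operator -/

section CovariantDerivative

variable {E : Type*} [NormedAddCommGroup E] [NormedSpace ℝ E]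
  (G : Type*) [TopologicalSpace G] [ChartedSpace E G] [Group G]

/-- The operator `ξ ↦ (∇_u^k ξ)^{(j)}` from `H^s` to `L²`, for `k + j ≤ s`, by the recursion of
`covJet`. The derivatives `u^{(i)}` enter through their continuous representatives, so that they
multiply `L²` into itself and the operator depends smoothly on `u`; they all have `i < s`. -/
def covOperator (s : ℕ) : ℕ → ℕ → SobolevSpace E s → (SobolevSpace E s →L[ℝ] Lp E 2 unitVol)
  | 0, j, _ => sobolevComponent E s j
  | k + 1, j, u => covOperator s k (j + 1) u - ∑ i ∈ Finset.range (j + 1),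
      (j.choose i : ℝ) • (mulLp (adL E G) (sobolevCurve E s i u)).comp (covOperator s k (j - i) u)

theorem contDiff_covOperator (s k j : ℕ) : ContDiff ℝ ∞ (covOperator (E := E) G s k j) := by
  induction k generalizing j with
  | zero => exact contDiff_const
  | succ k ih =>
    refine (ih (j + 1)).sub (ContDiff.sum fun i _ =>
      ContDiff.const_smul (j.choose i : ℝ) (ContDiff.clm_comp ?_ (ih (j - i))))
    exact (mulLp (adL E G)).contDiff.comp (sobolevCurve E s i).contDiff

theorem sobolevJet_apply {s i : ℕ} (h : i < s + 1) (u : SobolevSpace E s) (t : ℝ) :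
    sobolevJet G u t i = sobolevComponent E s i u t :=
  (dif_pos h).trans (by rw [sobolevComponent_apply h])

variable [LieGroup 𝓘(ℝ, E) ∞ G] [CompleteSpace E]

theorem coeFn_covOperator {s k j : ℕ} (h : k + j ≤ s) (u ξ : SobolevSpace E s) :
    ∀ᵐ t ∂unitVol, covOperator G s k j u ξ t =
      (covJet (sobolevJet G u t))^[k] (sobolevJet G ξ t) j := by
  induction k generalizing j with
  | zero =>
    refine Eventually.of_forall fun t => ?_
    exact (sobolevJet_apply G (by omega) ξ t).symm
  | succ k ih =>
    have h1 : ∀ i ∈ Finset.range (j + 1), ∀ᵐ t ∂unitVol, ((j.choose i : ℝ) •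
        (mulLp (adL E G) (sobolevCurve E s i u)).comp (covOperator G s k (j - i) u)) ξ t =
        (j.choose i) • ⁅sobolevJet G u t i, (covJet (sobolevJet G u t))^[k] (sobolevJet G ξ t)
          (j - i)⁆ := by
      intro i hi
      have hij : i ≤ j := Nat.lt_succ_iff.1 (Finset.mem_range.1 hi)
      have his : i < s := by omega
      have his' : i < s + 1 := by omega
      filter_upwards [Lp.coeFn_smul (j.choose i : ℝ)
        (mulLp (adL E G) (sobolevCurve E s i u) (covOperator G s k (j - i) u ξ)),
        coeFn_mulLp (adL E G) (sobolevCurve E s i u) (covOperator G s k (j - i) u ξ),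
        coeFn_sobolevCurve his u, ih (j := j - i) (by omega)] with t e1 e2 e3 e4
      refine e1.trans ?_
      rw [Pi.smul_apply, e2, e3, e4, bracket_eq_adL, sobolevJet_apply G his',
        Nat.cast_smul_eq_nsmul]
      rfl
    have h2 : ∀ᵐ t ∂unitVol, (∑ i ∈ Finset.range (j + 1), (j.choose i : ℝ) •
        (mulLp (adL E G) (sobolevCurve E s i u)).comp (covOperator G s k (j - i) u)) ξ t =
        ∑ i ∈ Finset.range (j + 1), (j.choose i) •
          ⁅sobolevJet G u t i, (covJet (sobolevJet G u t))^[k] (sobolevJet G ξ t) (j - i)⁆ := by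
      rw [_root_.sum_apply]
      filter_upwards [coeFn_sum_Lp (Finset.range (j + 1)) fun i => ((j.choose i : ℝ) •
        (mulLp (adL E G) (sobolevCurve E s i u)).comp (covOperator G s k (j - i) u)) ξ,
        (Filter.eventually_all_finset _).2 h1] with t e1 e2
      rw [e1]
      exact Finset.sum_congr rfl e2
    filter_upwards [Lp.coeFn_sub (covOperator G s k (j + 1) u ξ) ((∑ i ∈ Finset.range (j + 1),
      (j.choose i : ℝ) • (mulLp (adL E G) (sobolevCurve E s i u)).comp
        (covOperator G s k (j - i) u)) ξ), h2, ih (j := j + 1) (by omega)] with t e1 e2 e3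
    refine e1.trans ?_
    rw [Pi.sub_apply, e2, e3, Function.iterate_succ_apply']
    rfl

theorem coeFn_covOperator_zero {s k : ℕ} (h : k ≤ s) (u ξ : SobolevSpace E s) :
    covOperator G s k 0 u ξ =ᵐ[unitVol] covDeriv G k u ξ :=
  coeFn_covOperator G (by omega) u ξ

end CovariantDerivative

/-! ### The metric on the Sobolev space -/

section Coercivity

variable {E : Type*} [NormedAddCommGroup E] [NormedSpace ℝ E]
  {G : Type*} [TopologicalSpace G] [ChartedSpace E G] [Group G]

/-- The derivatives of `ξ` are controlled by its covariant derivatives: the recursion for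
`(∇_u^{k+1} ξ)^{(j)}` is solved for its leading term `(∇_u^k ξ)^{(j+1)}`. -/
theorem exists_norm_covOperator_le (s : ℕ) (u : SobolevSpace E s) (j k : ℕ) (hkj : k + j ≤ s) :
    ∃ C : ℝ, 0 ≤ C ∧ ∀ (ξ : SobolevSpace E s) (N : ℝ), (∀ l ≤ s, ‖covOperator G s l 0 u ξ‖ ≤ N) →
      ‖covOperator G s k j u ξ‖ ≤ C * N := by
  induction j using Nat.strong_induction_on generalizing k with
  | _ j ih =>
    cases j with
    | zero => exact ⟨1, zero_le_one, fun ξ N h => by rw [one_mul]; exact h k (by omega)⟩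
    | succ j =>
      obtain ⟨C₀, hC₀, h₀⟩ := ih j (by omega) (k + 1) (by omega)
      have h1 : ∀ i, ∃ C : ℝ, 0 ≤ C ∧ ∀ (ξ : SobolevSpace E s) (N : ℝ),
          (∀ l ≤ s, ‖covOperator G s l 0 u ξ‖ ≤ N) → ‖covOperator G s k (j - i) u ξ‖ ≤ C * N :=
        fun i => ih (j - i) (by omega) k (by omega)
      choose D hD h using h1
      refine ⟨C₀ + ∑ i ∈ Finset.range (j + 1), (j.choose i : ℝ) *
        (‖mulLp (adL E G) (sobolevCurve E s i u)‖ * D i), add_nonneg hC₀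
          (Finset.sum_nonneg fun i _ =>
          mul_nonneg (Nat.cast_nonneg _) (mul_nonneg (norm_nonneg _) (hD i))), fun ξ N hN => ?_⟩
      have e : covOperator G s k (j + 1) u ξ = covOperator G s (k + 1) j u ξ +
          ∑ i ∈ Finset.range (j + 1), (j.choose i : ℝ) •
            mulLp (adL E G) (sobolevCurve E s i u) (covOperator G s k (j - i) u ξ) := by
        rw [covOperator, _root_.sub_apply, _root_.sum_apply]
        exact (sub_add_cancel _ _).symm
      rw [e, add_mul, Finset.sum_mul]
      refine (norm_add_le _ _).trans (add_le_add (h₀ ξ N hN) ((norm_sum_le _ _).trans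
        (Finset.sum_le_sum fun i _ => ?_)))
      rw [norm_smul, Real.norm_of_nonneg (Nat.cast_nonneg _), mul_assoc, mul_assoc]
      refine mul_le_mul_of_nonneg_left ?_ (Nat.cast_nonneg _)
      exact ((mulLp (adL E G) (sobolevCurve E s i u)).le_opNorm _).trans
        (mul_le_mul_of_nonneg_left (h i ξ N hN) (norm_nonneg _))

/-- The Sobolev norm of `ξ` is controlled by the `L²` norms of its covariant derivatives. -/
theorem exists_norm_sobolev_le (s : ℕ) (u : SobolevSpace E s) :
    ∃ C : ℝ, 0 < C ∧ ∀ (ξ : SobolevSpace E s) (N : ℝ), 0 ≤ N →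
      (∀ l ≤ s, ‖covOperator G s l 0 u ξ‖ ≤ N) → ‖ξ‖ ≤ C * N := by
  have h1 : ∀ j : Fin (s + 1), ∃ C : ℝ, 0 ≤ C ∧ ∀ (ξ : SobolevSpace E s) (N : ℝ),
      (∀ l ≤ s, ‖covOperator G s l 0 u ξ‖ ≤ N) → ‖covOperator G s 0 j u ξ‖ ≤ C * N :=
    fun j => exists_norm_covOperator_le s u j 0 (by omega)
  choose C hC h using h1
  have hC1 : 0 < 1 + ∑ j, C j := add_pos_of_pos_of_nonneg one_pos
      (Finset.sum_nonneg fun j _ => hC j)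
  refine ⟨1 + ∑ j, C j, hC1, fun ξ N hN hξ => ?_⟩
  have h2 : ‖ξ.1‖ ≤ (1 + ∑ j, C j) * N := by
    refine (pi_norm_le_iff_of_nonneg (mul_nonneg hC1.le hN)).2 fun j => ?_
    have h3 := h j ξ N hξ
    have h4 : covOperator G s 0 j u ξ = ξ.1 j := sobolevComponent_apply j.2 ξ
    rw [h4] at h3
    refine h3.trans (mul_le_mul_of_nonneg_right ?_ hN)
    exact (Finset.single_le_sum (fun i _ => hC i) (Finset.mem_univ j)).trans
      (le_add_of_nonneg_left zero_le_one)
  exact h2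

end Coercivity

section SmoothMetric

variable {E : Type*} [NormedAddCommGroup E] [NormedSpace ℝ E]
  {M : Type*} [TopologicalSpace M] [ChartedSpace E M] [IsManifold 𝓘(ℝ, E) ∞ M]

/-- A field of bilinear forms on the tangent spaces is smooth if it is so when read in charts. -/
theorem contMDiffAt_bilinear_section
    {g : ∀ x : M, TangentSpace 𝓘(ℝ, E) x →L[ℝ] TangentSpace 𝓘(ℝ, E) x →L[ℝ] ℝ}
    {b : M → E →L[ℝ] E →L[ℝ] ℝ} {x₀ : M} (hb : ContMDiffAt 𝓘(ℝ, E) 𝓘(ℝ, E →L[ℝ] E →L[ℝ] ℝ) ∞ b x₀)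
    (h : ∀ x ∈ (extChartAt 𝓘(ℝ, E) x₀).source, ∀ v w : E, b x v w =
      g x (tderiv 𝓘(ℝ, E) 𝓘(ℝ, E) (extChartAt 𝓘(ℝ, E) x₀).symm (extChartAt 𝓘(ℝ, E) x₀ x) v)
        (tderiv 𝓘(ℝ, E) 𝓘(ℝ, E) (extChartAt 𝓘(ℝ, E) x₀).symm (extChartAt 𝓘(ℝ, E) x₀ x) w)) :
    ContMDiffAt 𝓘(ℝ, E) (𝓘(ℝ, E).prod 𝓘(ℝ, E →L[ℝ] E →L[ℝ] ℝ)) ∞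
      (fun x => Bundle.TotalSpace.mk' (E →L[ℝ] E →L[ℝ] ℝ)
        (E := fun x => TangentSpace 𝓘(ℝ, E) x →L[ℝ] TangentSpace 𝓘(ℝ, E) x →L[ℝ] ℝ) x
          (g x)) x₀ := by
  refine (Bundle.contMDiffAt_section x₀).2 (hb.congr_of_eventuallyEq ?_)
  filter_upwards [extChartAt_source_mem_nhds (I := 𝓘(ℝ, E)) x₀] with x hx
  have hx' : x ∈ (chartAt E x₀).source := by rwa [extChartAt_source] at hx
  refine ContinuousLinearMap.ext fun v => ContinuousLinearMap.ext fun w => ?_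
  rw [h x hx]
  have key := inCoordinates_apply_eq₂ (𝕜 := ℝ) (F₁ := E) (F₂ := E) (F₃ := ℝ)
    (E₁ := fun x : M => TangentSpace 𝓘(ℝ, E) x) (E₂ := fun x : M => TangentSpace 𝓘(ℝ, E) x)
    (E₃ := Bundle.Trivial M ℝ) (x₀ := x₀) (x := x) (ϕ := g x) (v := v) (w := w) hx' hx' (mem_univ _)
  refine key.trans ?_
  have hs := TangentBundle.symmL_trivializationAt (I := 𝓘(ℝ, E)) hx'
  have hs' : ∀ v : E, (trivializationAt E (TangentSpace 𝓘(ℝ, E)) x₀).symm x v =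
      tderiv 𝓘(ℝ, E) 𝓘(ℝ, E) (extChartAt 𝓘(ℝ, E) x₀).symm (extChartAt 𝓘(ℝ, E) x₀ x) v := by
    intro v
    have := congrArg (fun L => L v) hs
    rw [modelWithCornersSelf_coe, range_id, mfderivWithin_univ] at this
    exact ((trivializationAt E (TangentSpace 𝓘(ℝ, E)) x₀).symmL_apply
      (R := ℝ) hx' v).symm.trans this
  rw [hs', hs']
  exact congrArg (fun L : ℝ →ₗ[ℝ] ℝ => L _)
    (Bundle.Trivial.linearMapAt_trivialization ℝ (B := M) (F := ℝ) x)

end SmoothMetric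

section VectorSpaceMetric

variable {H : Type*} [NormedAddCommGroup H] [NormedSpace ℝ H]

/-- The Riemannian metric on a normed space given by a smooth family of symmetric coercive forms. -/
def vectorSpaceMetric (b : H → H →L[ℝ] H →L[ℝ] ℝ) (hb : ContDiff ℝ ∞ b)
    (hsymm : ∀ x v w, b x v w = b x w v) (hcoer : ∀ x, ∃ C > 0, ∀ v, ‖v‖ ^ 2 ≤ C * b x v v) :
    Bundle.ContMDiffRiemannianMetric 𝓘(ℝ, H) ∞ H (fun x : H => TangentSpace 𝓘(ℝ, H) x) where
  inner x := b x
  symm x v w := hsymm x v w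
  pos x := by
    have key : ∀ v : H, v ≠ 0 → 0 < b x v v := fun v hv => by
      obtain ⟨C, hC, h⟩ := hcoer x
      exact pos_of_mul_pos_right ((pow_pos (norm_pos_iff.2 hv) 2).trans_le (h v)) hC.le
    exact key
  isVonNBounded x := by
    obtain ⟨C, hC, h⟩ := hcoer x
    change Bornology.IsVonNBounded ℝ {v : H | b x v v < 1}
    refine (NormedSpace.isVonNBounded_closedBall ℝ H (Real.sqrt C)).subset fun v hv => ?_
    rw [mem_closedBall_zero_iff]
    exact Real.le_sqrt_of_sq_le ((h v).trans (mul_le_of_le_one_right hC.le (le_of_lt hv)))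
  contMDiff := fun x => contMDiffAt_bilinear_section (b := b) hb.contDiffAt.contMDiffAt
    fun y _ v w => by
      have h1 : tderiv 𝓘(ℝ, H) 𝓘(ℝ, H) (extChartAt 𝓘(ℝ, H) x).symm (extChartAt 𝓘(ℝ, H) x y) =
          ContinuousLinearMap.id ℝ H := tderiv_id y
      rw [h1]
      rfl

end VectorSpaceMetric

section PullbackForm

variable {H L : Type*} [NormedAddCommGroup H] [NormedSpace ℝ H] [NormedAddCommGroup L]
  [NormedSpace ℝ L]

/-- The pullback `(v, w) ↦ b (T v) (T w)` of a bilinear form. -/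
def pullbackForm (b : L →L[ℝ] L →L[ℝ] ℝ) (T : H →L[ℝ] L) : H →L[ℝ] H →L[ℝ] ℝ :=
  ((ContinuousLinearMap.compL ℝ H L ℝ).flip T).comp (b.comp T)

theorem pullbackForm_apply (b : L →L[ℝ] L →L[ℝ] ℝ) (T : H →L[ℝ] L) (v w : H) :
    pullbackForm b T v w = b (T v) (T w) := rfl

theorem contDiff_pullbackForm (b : L →L[ℝ] L →L[ℝ] ℝ) :
    ContDiff ℝ ∞ (pullbackForm b : (H →L[ℝ] L) → H →L[ℝ] H →L[ℝ] ℝ) :=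
  (ContinuousLinearMap.contDiff _).clm_comp (contDiff_const.clm_comp contDiff_id)

end PullbackForm

section SobolevMetric

instance SobolevSpace.normedAddCommGroupDual {E : Type*} [NormedAddCommGroup E] [NormedSpace ℝ E]
    {s : ℕ} : NormedAddCommGroup (SobolevSpace E s →L[ℝ] ℝ) := inferInstance

instance SobolevSpace.normedSpaceDual {E : Type*} [NormedAddCommGroup E] [NormedSpace ℝ E]
    {s : ℕ} : NormedSpace ℝ (SobolevSpace E s →L[ℝ] ℝ) := inferInstance

variable {E : Type*} [NormedAddCommGroup E] [NormedSpace ℝ E] [FiniteDimensional ℝ E]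
  {G : Type*} [TopologicalSpace G] [ChartedSpace E G] [Group G]
  (B : LinearMap.BilinForm ℝ (GroupLieAlgebra 𝓘(ℝ, E) G))

/-- A bilinear form on the Lie algebra as a continuous bilinear map on the model space. -/
def formCLM : E →L[ℝ] E →L[ℝ] ℝ := LinearMap.toContinuousBilinearMap (E := E) (F := E) B

theorem formCLM_apply (v w : E) : formCLM B v w = B v w := rfl

/-- The bilinear form `sobolevForm` at `u`, as a continuous bilinear map. -/
def sobolevInner (s : ℕ) (u : SobolevSpace E s) : SobolevSpace E s →L[ℝ] SobolevSpace E s →L[ℝ] ℝ :=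
  ∑ k ∈ Finset.range (s + 1), (s.choose k : ℝ) •
    pullbackForm ((formCLM B).lpPairing unitVol 2 2) (covOperator G s k 0 u)

theorem contDiff_sobolevInner (s : ℕ) : ContDiff ℝ ∞ (sobolevInner B s) := by
  exact ContDiff.sum fun k _ => ContDiff.const_smul (s.choose k : ℝ)
    ((contDiff_pullbackForm _).comp (contDiff_covOperator G s k 0))

theorem sobolevInner_apply (s : ℕ) (u ξ ζ : SobolevSpace E s) :
    sobolevInner B s u ξ ζ = ∑ k ∈ Finset.range (s + 1), (s.choose k : ℝ) *
      ∫ t, B (covOperator G s k 0 u ξ t) (covOperator G s k 0 u ζ t) ∂unitVol := by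
  simp only [sobolevInner, _root_.sum_apply]
  refine Finset.sum_congr rfl fun k _ => ?_
  exact congrArg ((s.choose k : ℝ) * ·)
    ((formCLM B).lpPairing_eq_integral (covOperator G s k 0 u ξ) (covOperator G s k 0 u ζ))

theorem norm_sq_Lp {F : Type*} [NormedAddCommGroup F] (w : Lp F 2 unitVol) :
    ‖w‖ ^ 2 = ∫ t, ‖w t‖ ^ 2 ∂unitVol := by
  have h := (Lp.memLp w).eLpNorm_eq_integral_rpow_norm (by norm_num) (by norm_num)
  rw [Lp.norm_def, h, ENNReal.toReal_ofReal (by positivity)]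
  simp only [ENNReal.toReal_ofNat, Real.rpow_ofNat]
  rw [← Real.rpow_natCast, ← Real.rpow_mul (by positivity)]
  norm_num

theorem integral_unitVol {F : Type*} [NormedAddCommGroup F] [NormedSpace ℝ F] (f : ℝ → F) :
    ∫ t, f t ∂unitVol = ∫ t in (0 : ℝ)..1, f t := by
  rw [intervalIntegral.integral_of_le zero_le_one, integral_Icc_eq_integral_Ioc]

theorem sobolevInner_eq_sobolevForm [LieGroup 𝓘(ℝ, E) ∞ G] (s : ℕ) (u ξ ζ : SobolevSpace E s) :
    sobolevInner B s u ξ ζ = sobolevForm B s u ξ ζ := by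
  rw [sobolevInner_apply, sobolevForm]
  refine Finset.sum_congr rfl fun k hk => ?_
  have hks : k ≤ s := Nat.lt_succ_iff.1 (Finset.mem_range.1 hk)
  rw [← integral_unitVol]
  refine congrArg ((s.choose k : ℝ) * ·) (integral_congr_ae ?_)
  filter_upwards [coeFn_covOperator_zero G hks u ξ, coeFn_covOperator_zero G hks u ζ] with t h1 h2
  rw [h1, h2]

variable {B}

/-- By compactness of the unit sphere, the inner product dominates the norm of `E`. -/
theorem IsAdInvariantInner.exists_le (hB : IsAdInvariantInner B) :
    ∃ c > 0, ∀ v : E, c * ‖v‖ ^ 2 ≤ B v v := by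
  have hcont : Continuous fun v : E => formCLM B v v :=
    (formCLM B).continuous.clm_apply continuous_id
  obtain ⟨c, hc, h⟩ := (isCompact_sphere (0 : E) 1).exists_forall_le' (a := 0) hcont.continuousOn
    fun v hv => hB.pos v fun h0 : v = 0 => by simp [h0] at hv
  refine ⟨c, hc, fun v => ?_⟩
  by_cases hv : v = 0
  · rw [hv, norm_zero]
    simp only [ne_eq, OfNat.ofNat_ne_zero, not_false_eq_true, zero_pow, mul_zero]
    exact le_of_eq (LinearMap.map_zero₂ (formCLM B).toLinearMap₁₂ (0 : E)).symm
  · have hn : ‖v‖ ≠ 0 := norm_ne_zero_iff.2 hv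
    have h1 := h (‖v‖⁻¹ • v) (by simp [norm_smul, hn])
    rw [map_smul, map_smul, _root_.smul_apply, smul_eq_mul, smul_eq_mul] at h1
    have h2 : c * ‖v‖ ^ 2 ≤ (‖v‖⁻¹ * (‖v‖⁻¹ * formCLM B v v)) * ‖v‖ ^ 2 :=
      mul_le_mul_of_nonneg_right h1 (sq_nonneg _)
    refine h2.trans_eq ?_
    rw [formCLM_apply]
    field_simp

/-- The metric dominates the Sobolev norm, hence defines the topology of `H^s`. -/
theorem exists_norm_sq_le_sobolevInner (hB : IsAdInvariantInner B) (s : ℕ) (u : SobolevSpace E s) :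
    ∃ C > 0, ∀ ξ : SobolevSpace E s, ‖ξ‖ ^ 2 ≤ C * sobolevInner B s u ξ ξ := by
  obtain ⟨c, hc, hcB⟩ := hB.exists_le
  obtain ⟨C, hC, hCξ⟩ := exists_norm_sobolev_le (G := G) s u
  have hterm : ∀ (k : ℕ) (ξ : SobolevSpace E s), c * ‖covOperator G s k 0 u ξ‖ ^ 2 ≤
      ∫ t, B (covOperator G s k 0 u ξ t) (covOperator G s k 0 u ξ t) ∂unitVol := by
    intro k ξ
    set w := covOperator G s k 0 u ξ
    have h2 := Lp.memLp w
    have h3 : ‖w‖ ^ 2 = ∫ t, ‖w t‖ ^ 2 ∂unitVol := norm_sq_Lp w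
    rw [h3, ← integral_const_mul]
    refine integral_mono (h2.integrable_norm_pow (by simp) |>.const_mul c) ?_ fun t => hcB _
    exact ((formCLM B).memLp_of_bilin (p := 2) (q := 2) 1 h2 h2).integrable le_rfl
  have hnn : ∀ (k : ℕ) (ξ : SobolevSpace E s), 0 ≤
      ∫ t, B (covOperator G s k 0 u ξ t) (covOperator G s k 0 u ξ t) ∂unitVol := fun k ξ =>
    le_trans (by positivity) (hterm k ξ)
  refine ⟨C ^ 2 / c, by positivity, fun ξ => ?_⟩
  set Q := sobolevInner B s u ξ ξ with hQ
  have hQ' : ∀ k ≤ s, c * ‖covOperator G s k 0 u ξ‖ ^ 2 ≤ Q := by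
    intro k hk
    rw [hQ, sobolevInner_apply]
    refine le_trans ?_ (Finset.single_le_sum (fun i _ => mul_nonneg (Nat.cast_nonneg _) (hnn i ξ))
      (Finset.mem_range.2 (Nat.lt_succ_of_le hk)))
    refine (hterm k ξ).trans (le_mul_of_one_le_left (hnn k ξ) ?_)
    exact_mod_cast Nat.choose_pos hk
  have hQ0 : 0 ≤ Q := le_trans (by positivity) (hQ' 0 (Nat.zero_le _))
  have h := hCξ ξ (Real.sqrt (Q / c)) (Real.sqrt_nonneg _) fun k hk => by
    refine Real.le_sqrt_of_sq_le ?_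
    rw [le_div_iff₀ hc, mul_comm]
    exact hQ' k hk
  calc ‖ξ‖ ^ 2 ≤ (C * Real.sqrt (Q / c)) ^ 2 := pow_le_pow_left₀ (norm_nonneg _) h 2
    _ = C ^ 2 / c * Q := by rw [mul_pow, Real.sq_sqrt (by positivity)]; ring

theorem sobolevInner_symm (hB : IsAdInvariantInner B) (s : ℕ) (u ξ ζ : SobolevSpace E s) :
    sobolevInner B s u ξ ζ = sobolevInner B s u ζ ξ := by
  rw [sobolevInner_apply, sobolevInner_apply]
  exact Finset.sum_congr rfl fun k _ => congrArg ((s.choose k : ℝ) * ·)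
    (integral_congr_ae (Eventually.of_forall fun t => hB.symm _ _))

/-- The metric `g_s^o`. -/
def sobolevMetric (hB : IsAdInvariantInner B) (s : ℕ) :
    Bundle.ContMDiffRiemannianMetric 𝓘(ℝ, SobolevSpace E s) ∞ (SobolevSpace E s)
      (fun u : SobolevSpace E s => TangentSpace 𝓘(ℝ, SobolevSpace E s) u) :=
  vectorSpaceMetric (sobolevInner B s) (contDiff_sobolevInner B s) (sobolevInner_symm hB s)
    (exists_norm_sq_le_sobolevInner hB s)

end SobolevMetric

/-! ### The bi-invariant metric on the group -/

section Translations

variable {E : Type*} [NormedAddCommGroup E] [NormedSpace ℝ E]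
  {G : Type*} [TopologicalSpace G] [ChartedSpace E G] [Group G] [LieGroup 𝓘(ℝ, E) ∞ G]

theorem dLeft_comp_inv (x : G) :
    (dLeft (E := E) x 1).comp (dLeft x⁻¹ x) = ContinuousLinearMap.id ℝ E := by
  have h := dLeft_inv_comp (E := E) x⁻¹ x
  rwa [inv_inv, inv_mul_cancel] at h

theorem dLeft_inv_comp_one (x : G) :
    (dLeft (E := E) x⁻¹ x).comp (dLeft x 1) = ContinuousLinearMap.id ℝ E := by
  have h := dLeft_inv_comp (E := E) x 1
  rwa [mul_one] at h

theorem dLeft_inv_comp_dRight (a x : G) :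
    (dLeft (E := E) (x * a)⁻¹ (x * a)).comp (dRight a x) = (AdL a⁻¹).comp (dLeft x⁻¹ x) := by
  have h1 := dLeft_mul (E := E) a⁻¹ x⁻¹ (x * a)
  have h2 := dLeft_comp_dRight (E := E) x⁻¹ a x
  have h3 := dLeft_comp_dRight (E := E) a⁻¹ a 1
  have h4 := AdL_eq (E := E) a⁻¹
  rw [inv_mul_cancel_left] at h1
  rw [inv_mul_cancel] at h2
  rw [one_mul, mul_one] at h3
  rw [inv_inv] at h4
  rw [mul_inv_rev, h1, ContinuousLinearMap.comp_assoc, h2, ← ContinuousLinearMap.comp_assoc, h3, h4]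

end Translations

section GroupMetric

variable {E : Type*} [NormedAddCommGroup E] [NormedSpace ℝ E] [FiniteDimensional ℝ E]
  {G : Type*} [TopologicalSpace G] [ChartedSpace E G] [Group G]
  {B : LinearMap.BilinForm ℝ (GroupLieAlgebra 𝓘(ℝ, E) G)}

variable (B) in
/-- The form on `T_x G` obtained from `B` by left translation. -/
def groupInner (x : G) : E →L[ℝ] E →L[ℝ] ℝ := pullbackForm (formCLM B) (dLeft x⁻¹ x)

theorem groupInner_apply (x : G) (v w : E) :
    groupInner B x v w = formCLM B (dLeft x⁻¹ x v) (dLeft x⁻¹ x w) := rfl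

theorem groupInner_symm (hB : IsAdInvariantInner B) (x : G) (v w : E) :
    groupInner B x v w = groupInner B x w v := by
  have h : ∀ v w : E, formCLM B v w = formCLM B w v := fun v w => hB.symm v w
  exact h _ _

variable [LieGroup 𝓘(ℝ, E) ∞ G]

theorem groupInner_dLeft_one (x : G) (v w : E) :
    groupInner B x (dLeft x 1 v) (dLeft x 1 w) = formCLM B v w := by
  have h : ∀ v : E, dLeft x⁻¹ x (dLeft x 1 v) = v :=
    fun v => congrArg (fun L => L v) (dLeft_inv_comp_one x)
  rw [groupInner_apply, h, h]

theorem groupInner_left (a x : G) (v w : E) :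
    groupInner B (a * x) (dLeft a x v) (dLeft a x w) = groupInner B x v w := by
  have h : (dLeft (E := E) (a * x)⁻¹ (a * x)).comp (dLeft a x) = dLeft x⁻¹ x := by
    rw [← dLeft_mul, mul_inv_rev, inv_mul_cancel_right]
  rw [groupInner_apply, groupInner_apply, ← h]
  rfl

theorem groupInner_right (hB : IsAdInvariantInner B) (a x : G) (v w : E) :
    groupInner B (x * a) (dRight a x v) (dRight a x w) = groupInner B x v w := by
  have h : ∀ v : E, dLeft (x * a)⁻¹ (x * a) (dRight a x v) = AdL a⁻¹ (dLeft x⁻¹ x v) :=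
    fun v => congrArg (fun L => L v) (dLeft_inv_comp_dRight a x)
  rw [groupInner_apply, groupInner_apply, h, h]
  have hinv : ∀ v w : E, formCLM B (AdL a⁻¹ v) (AdL a⁻¹ w) = formCLM B v w :=
    fun v w => hB.ad_invariant a⁻¹ v w
  exact hinv _ _

theorem exists_norm_sq_le_groupInner (hB : IsAdInvariantInner B) (x : G) :
    ∃ C > 0, ∀ v : E, ‖v‖ ^ 2 ≤ C * groupInner B x v v := by
  obtain ⟨c, hc, hcB⟩ := hB.exists_le
  refine ⟨(‖dLeft (E := E) x 1‖ ^ 2 + 1) / c, by positivity, fun v => ?_⟩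
  have h : dLeft x 1 (dLeft x⁻¹ x v) = v := congrArg (fun L => L v) (dLeft_comp_inv x)
  have h1 : c * ‖dLeft x⁻¹ x v‖ ^ 2 ≤ groupInner B x v v := hcB _
  have h2 := (dLeft x 1).le_opNorm (dLeft x⁻¹ x v)
  rw [h] at h2
  calc ‖v‖ ^ 2 ≤ (‖dLeft (E := E) x 1‖ * ‖dLeft x⁻¹ x v‖) ^ 2 :=
        pow_le_pow_left₀ (norm_nonneg _) h2 2
    _ ≤ (‖dLeft (E := E) x 1‖ ^ 2 + 1) * ‖dLeft x⁻¹ x v‖ ^ 2 := by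
      nlinarith [sq_nonneg ‖dLeft x⁻¹ x v‖]
    _ = (‖dLeft (E := E) x 1‖ ^ 2 + 1) / c * (c * ‖dLeft x⁻¹ x v‖ ^ 2) := by field_simp
    _ ≤ _ := mul_le_mul_of_nonneg_left h1 (by positivity)

variable (B) in
theorem contMDiff_groupInner (c : G) :
    ContMDiffAt 𝓘(ℝ, E) (𝓘(ℝ, E).prod 𝓘(ℝ, E →L[ℝ] E →L[ℝ] ℝ)) ∞
      (fun x => Bundle.TotalSpace.mk' (E →L[ℝ] E →L[ℝ] ℝ)
        (E := fun x => TangentSpace 𝓘(ℝ, E) x →L[ℝ] TangentSpace 𝓘(ℝ, E) x →L[ℝ] ℝ) x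
        (groupInner (E := E) B x)) c := by
  -- `K` is the differential of `z ↦ x⁻¹ z` at `z = x`, read in the chart at `c`.
  let K : E → E →L[ℝ] E := fun y => fderiv ℝ (fun z => extChartAt 𝓘(ℝ, E) (1 : G)
    (((extChartAt 𝓘(ℝ, E) c).symm y)⁻¹ * (extChartAt 𝓘(ℝ, E) c).symm z)) y
  have hK : ContDiffOn ℝ ∞ K (extChartAt 𝓘(ℝ, E) c).target :=
    contDiffOn_fderiv_chart (Φ := fun q : G × G => q.2⁻¹ * q.1) (a := c) (b := c) (c := 1)
      (z₀ := fun y => y) (contMDiff_snd.inv.mul contMDiff_fst) contDiffOn_id (fun _ h => h)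
      fun y _ => by
        simp only [inv_mul_cancel]
        exact mem_extChartAt_source (1 : G)
  have hKx : ∀ x ∈ (extChartAt 𝓘(ℝ, E) c).source, ∀ v : E, K (extChartAt 𝓘(ℝ, E) c x) v =
      dLeft x⁻¹ x (tderiv 𝓘(ℝ, E) 𝓘(ℝ, E) (extChartAt 𝓘(ℝ, E) c).symm
        (extChartAt 𝓘(ℝ, E) c x) v) := by
    intro x hx v
    have h1 := fderiv_chart_comp (E := E) (d := (1 : G)) (mdifferentiableAt_leftMul x⁻¹ x) hx
      (by rw [inv_mul_cancel]; exact mem_extChartAt_source (1 : G))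
      (tderiv 𝓘(ℝ, E) 𝓘(ℝ, E) (extChartAt 𝓘(ℝ, E) c).symm (extChartAt 𝓘(ℝ, E) c x) v)
    rw [inv_mul_cancel, tderiv_extChartAt_self] at h1
    have hxt := (extChartAt 𝓘(ℝ, E) c).map_source hx
    have hl := (extChartAt 𝓘(ℝ, E) c).left_inv hx
    have h2 := tderiv_comp (f := (extChartAt 𝓘(ℝ, E) c).symm) (g := extChartAt 𝓘(ℝ, E) c)
      (extChartAt 𝓘(ℝ, E) c x)
      ((contMDiffAt_chart (E := E) (by rwa [hl])).mdifferentiableAt (by simp))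
      ((contMDiffAt_chart_symm (E := E) hxt).mdifferentiableAt (by simp))
    have h3 : tderiv 𝓘(ℝ, E) 𝓘(ℝ, E) (fun y => extChartAt 𝓘(ℝ, E) c
        ((extChartAt 𝓘(ℝ, E) c).symm y)) (extChartAt 𝓘(ℝ, E) c x) =
        ContinuousLinearMap.id ℝ E := by
      rw [← tderiv_id (I₁ := 𝓘(ℝ, E)) (extChartAt 𝓘(ℝ, E) c x)]
      refine tderiv_congr ?_
      filter_upwards [(isOpen_chart_target c).mem_nhds hxt] with y hy
      exact (extChartAt 𝓘(ℝ, E) c).right_inv hy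
    rw [h3, hl] at h2
    have h4 := congrArg (fun L => L v) h2
    simp only [ContinuousLinearMap.comp_apply, ContinuousLinearMap.id_apply] at h4
    rw [← h4] at h1
    simp only [K, hl]
    exact h1
  refine contMDiffAt_bilinear_section (E := E) (g := fun x : G => groupInner (E := E) B x)
    (b := fun x : G => pullbackForm (H := E) (L := E) (formCLM B) (K (extChartAt 𝓘(ℝ, E) c x)))
    ?_ fun x hx v w => ?_
  · have h0 : ContDiff ℝ ∞ (pullbackForm (H := E) (L := E) (formCLM B)) :=
      contDiff_pullbackForm (H := E) (L := E) (formCLM B)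
    have h1 : ContDiffAt ℝ ∞ (fun y => pullbackForm (H := E) (L := E) (formCLM B) (K y))
        (extChartAt 𝓘(ℝ, E) c c) := h0.contDiffAt.comp _
      (hK.contDiffAt ((isOpen_chart_target c).mem_nhds (mem_extChartAt_target c)))
    exact ContMDiffAt.comp c h1.contMDiffAt (contMDiffAt_chart (mem_extChartAt_source c))
  · rw [pullbackForm_apply, hKx x hx, hKx x hx]
    rfl

/-- The bi-invariant Riemannian metric induced by an `Ad`-invariant inner product. -/
def groupMetric (hB : IsAdInvariantInner B) :
    Bundle.ContMDiffRiemannianMetric 𝓘(ℝ, E) ∞ E (fun x : G => TangentSpace 𝓘(ℝ, E) x) where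
  inner x := groupInner (E := E) B x
  symm x := by exact groupInner_symm hB x
  pos x := by
    have key : ∀ v : E, v ≠ 0 → 0 < groupInner B x v v := fun v hv => by
      obtain ⟨C, hC, h⟩ := exists_norm_sq_le_groupInner hB x
      exact pos_of_mul_pos_right ((pow_pos (norm_pos_iff.2 hv) 2).trans_le (h v)) hC.le
    exact key
  isVonNBounded x := by
    obtain ⟨C, hC, h⟩ := exists_norm_sq_le_groupInner hB x
    have key : Bornology.IsVonNBounded ℝ {v : E | groupInner B x v v < 1} := by
      refine (NormedSpace.isVonNBounded_closedBall ℝ E (Real.sqrt C)).subset fun v hv => ?_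
      rw [mem_closedBall_zero_iff]
      exact Real.le_sqrt_of_sq_le ((h v).trans (mul_le_of_le_one_right hC.le (le_of_lt hv)))
    exact key
  contMDiff := contMDiff_groupInner B

theorem isBiInvariantMetric_groupMetric (hB : IsAdInvariantInner B) :
    IsBiInvariantMetric B (groupMetric hB) where
  inner_one := by
    have h : ∀ v w : E, groupInner B (1 : G) v w = formCLM B v w := fun v w => by
      have h := groupInner_dLeft_one (B := B) (1 : G) v w
      rwa [dLeft_one] at h
    exact h
  left a x := by
    have h : ∀ v w : E, groupInner B (a * x) (dLeft a x v) (dLeft a x w) = groupInner B x v w :=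
      groupInner_left a x
    exact h
  right a x := by
    have h : ∀ v w : E, groupInner B (x * a) (dRight a x v) (dRight a x w) = groupInner B x v w :=
      groupInner_right hB a x
    exact h

end GroupMetric

/-! ### Horizontal lifts -/

section LeibnizRule

theorem IsPrimitiveOn.finset_sum {F ι : Type*} [NormedAddCommGroup F] [NormedSpace ℝ F]
    {a b : ℝ} {A : Finset ι} {f f' : ι → ℝ → F} (hab : a ≤ b)
    (h : ∀ i ∈ A, IsPrimitiveOn (f i) (f' i) a b) :
    IsPrimitiveOn (fun t => ∑ i ∈ A, f i t) (fun t => ∑ i ∈ A, f' i t) a b := by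
  refine ⟨?_, fun t ht => ?_⟩
  · have h1 := IntervalIntegrable.sum A fun i hi => (h i hi).1
    rwa [show ∑ i ∈ A, f' i = fun t => ∑ i ∈ A, f' i t from funext fun t => Finset.sum_apply t A f']
      at h1
  rw [intervalIntegral.integral_finsetSum fun i hi =>
    (h i hi).intervalIntegrable_of_mem (left_mem_Icc.2 hab) ht, ← Finset.sum_add_distrib]
  exact Finset.sum_congr rfl fun i hi => (h i hi).2 t ht

variable {E F H : Type*} [NormedAddCommGroup E] [NormedSpace ℝ E] [CompleteSpace E]
  [NormedAddCommGroup F] [NormedSpace ℝ F] [CompleteSpace F]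
  [NormedAddCommGroup H] [NormedSpace ℝ H] [CompleteSpace H] {a b : ℝ}

theorem IsPrimitiveOn.bilinear (A : E →L[ℝ] F →L[ℝ] H) {f f' : ℝ → E} {g g' : ℝ → F}
    (hab : a ≤ b) (hf : IsPrimitiveOn f f' a b) (hg : IsPrimitiveOn g g' a b) :
    IsPrimitiveOn (fun t => A (f t) (g t)) (fun t => A (f t) (g' t) + A (f' t) (g t)) a b := by
  have h := (hf.prodMk hg hab).comp hab (U := univ) isOpen_univ
    (Φ := fun p : E × F => A p.1 p.2) A.isBoundedBilinearMap.contDiff.contDiffOn (mapsTo_univ _ _)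
  convert h using 2 with t
  exact (congrArg (fun L : E × F →L[ℝ] H => L (f' t, g' t))
    (A.isBoundedBilinearMap.fderiv (f t, g t))).symm

/-- The Leibniz rule for the iterated derivatives of a product. -/
theorem isPrimitiveOn_sum_choose (A : E →L[ℝ] F →L[ℝ] H) {U : ℕ → ℝ → E} {X : ℕ → ℝ → F} {j : ℕ}
    (hab : a ≤ b) (hU : ∀ i ≤ j, IsPrimitiveOn (U i) (U (i + 1)) a b)
    (hX : ∀ i ≤ j, IsPrimitiveOn (X i) (X (i + 1)) a b) :
    IsPrimitiveOn (fun t => ∑ i ∈ Finset.range (j + 1), j.choose i • A (U i t) (X (j - i) t))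
      (fun t => ∑ i ∈ Finset.range (j + 2), (j + 1).choose i • A (U i t)
        (X (j + 1 - i) t)) a b := by
  have h := IsPrimitiveOn.finset_sum (A := Finset.range (j + 1)) hab fun i hi =>
    IsPrimitiveOn.bilinear (j.choose i • A) hab (hU i (Nat.lt_succ_iff.1 (Finset.mem_range.1 hi)))
      (hX (j - i) (Nat.sub_le j i))
  convert h using 2 with t t
  · rfl
  rw [← Finset.Nat.sum_antidiagonal_eq_sum_range_succ
      (fun i k => (j + 1).choose i • A (U i t) (X k t)) (j + 1),
    Finset.sum_antidiagonal_choose_succ_nsmul (fun i k => A (U i t) (X k t)) j,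
    Finset.sum_add_distrib,
    ← Finset.Nat.sum_antidiagonal_eq_sum_range_succ
      (fun i k => (j.choose i • A) (U i t) (X (k + 1) t)) j,
    ← Finset.Nat.sum_antidiagonal_eq_sum_range_succ
      (fun i k => (j.choose i • A) (U (i + 1) t) (X k t)) j]
  congr 1
  refine Finset.sum_congr rfl fun p hp => ?_
  rw [Nat.choose_symm_of_eq_add (Finset.HasAntidiagonal.mem_antidiagonal.1 hp).symm]
  rfl

end LeibnizRule

section Horizontal

variable {E : Type*} [NormedAddCommGroup E] [NormedSpace ℝ E] {s : ℕ}

theorem SobolevSpace.exists_representatives (u : SobolevSpace E s) : ∃ U : ℕ → ℝ → E,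
    (∀ i < s, IsPrimitiveOn (U i) (U (i + 1)) 0 1) ∧
    ∀ i ≤ s, U i =ᵐ[unitVol] sobolevComponent E s i u := by
  have h : ∀ i : ℕ, ∃ f : ℝ → E,
      (i < s → IsPrimitiveOn f (sobolevComponent E s (i + 1) u) 0 1) ∧
      f =ᵐ[unitVol] sobolevComponent E s i u := by
    intro i
    by_cases hi : i < s
    · obtain ⟨f, h1, h2⟩ := SobolevSpace.exists_isPrimitiveOn u ⟨i, hi⟩
      rw [sobolevComponent_apply (by omega : i < s + 1),
        sobolevComponent_apply (by omega : i + 1 < s + 1)]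
      exact ⟨f, fun _ => h1, h2⟩
    · exact ⟨_, fun h => absurd h hi, EventuallyEq.rfl⟩
  choose U hU hUi using h
  exact ⟨U, fun i hi => (hU i hi).congr_ae zero_le_one (hUi (i + 1)).symm, fun i _ => hUi i⟩

theorem IsPrimitiveOn.eqOn_of_ae {f f' g g' : ℝ → E} (hf : IsPrimitiveOn f f' 0 1)
    (hg : IsPrimitiveOn g g' 0 1) (h : f =ᵐ[unitVol] g) : EqOn f g (Icc 0 1) :=
  Measure.eqOn_Icc_of_ae_eq volume zero_ne_one h (hf.continuousOn zero_le_one)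
    (hg.continuousOn zero_le_one)

variable [FiniteDimensional ℝ E] {G : Type*} [TopologicalSpace G] [ChartedSpace E G] [Group G]
  [LieGroup 𝓘(ℝ, E) ∞ G]
  {γ : ℝ → G} {u : SobolevSpace E s}

/-- The derivatives of the parallel section `Ad(γ) v` are given by the Leibniz rule for
`ξ' = [u, ξ]`. -/
theorem IsTransport.sobolevComponent_succ (h : IsTransport (u.1 0) γ) {v : E}
    {ξ : SobolevSpace E s} (hξ : ξ.1 0 =ᵐ[unitVol] fun t => AdL (γ t) v) {j : ℕ} (hj : j + 1 ≤ s) :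
    sobolevComponent E s (j + 1) ξ =ᵐ[unitVol] fun t => ∑ i ∈ Finset.range (j + 1), j.choose i •
      adL E G (sobolevComponent E s i u t) (sobolevComponent E s (j - i) ξ t) := by
  obtain ⟨U, hU, hUi⟩ := SobolevSpace.exists_representatives u
  obtain ⟨X, hX, hXi⟩ := SobolevSpace.exists_representatives ξ
  have hsection : IsPrimitiveOn (fun t => AdL (γ t) v)
      (fun t => adL E G (u.1 0 t) (AdL (γ t) v)) 0 1 := by
    have h1 := h.isPrimitiveOn_AdL.comp zero_le_one (U := univ) isOpen_univ
      (ContinuousLinearMap.apply ℝ E v).contDiff.contDiffOn (mapsTo_univ _ _)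
    convert h1 using 2 with t t
    · rfl
    rw [ContinuousLinearMap.fderiv]
    rfl
  have key : ∀ j, j + 1 ≤ s → X (j + 1) =ᵐ[unitVol] fun t => ∑ i ∈ Finset.range (j + 1),
      j.choose i • adL E G (U i t) (X (j - i) t) := by
    intro j
    induction j with
    | zero =>
      intro hj
      have hU0 : U 0 =ᵐ[unitVol] u.1 0 := hUi 0 (Nat.zero_le s)
      have hX0 : X 0 =ᵐ[unitVol] fun t => AdL (γ t) v :=
        (hXi 0 (Nat.zero_le s)).trans hξ
      have hXe := (hX 0 hj).eqOn_of_ae hsection hX0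
      filter_upwards [((hX 0 hj).congr_fun zero_le_one hXe).ae_unique hsection zero_le_one, hU0,
        hX0]
        with t h1 h2 h3
      simp [h1, h2, h3]
    | succ j ih =>
      intro hj
      have hsum := isPrimitiveOn_sum_choose (adL E G) (U := U) (X := X) (j := j) zero_le_one
        (fun i hi => hU i (by omega)) fun i hi => hX i (by omega)
      have hXe := (hX (j + 1) hj).eqOn_of_ae hsum (ih (by omega))
      exact ((hX (j + 1) hj).congr_fun zero_le_one hXe).ae_unique hsum zero_le_one
  have hUae : ∀ᵐ t ∂unitVol, ∀ i ∈ Finset.range (j + 1), U i t = sobolevComponent E s i u t :=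
    (Filter.eventually_all_finset _).2 fun i hi =>
      hUi i (by have := Finset.mem_range.1 hi; omega)
  have hXae : ∀ᵐ t ∂unitVol, ∀ i ∈ Finset.range (j + 1), X i t = sobolevComponent E s i ξ t :=
    (Filter.eventually_all_finset _).2 fun i hi =>
      hXi i (by have := Finset.mem_range.1 hi; omega)
  filter_upwards [hXi (j + 1) hj, key j hj, hUae, hXae] with t h1 h2 h3 h4
  rw [← h1, h2]
  refine Finset.sum_congr rfl fun i hi => ?_
  rw [h3 i hi, h4 (j - i) (Finset.mem_range.2 (by omega))]

/-- The covariant derivatives of a parallel section vanish. -/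
theorem IsTransport.covOperator_eq_zero (h : IsTransport (u.1 0) γ) {v : E}
    {ξ : SobolevSpace E s} (hξ : ξ.1 0 =ᵐ[unitVol] fun t => AdL (γ t) v) {k j : ℕ}
    (hkj : k + 1 + j ≤ s) : covOperator G s (k + 1) j u ξ = 0 := by
  induction k generalizing j with
  | zero =>
    refine Lp.ext ?_
    filter_upwards [coeFn_covOperator G hkj u ξ, h.sobolevComponent_succ hξ (j := j) (by omega),
      Lp.coeFn_zero E 2 unitVol] with t h1 h2 h3
    rw [h1, h3]
    have h4 : sobolevJet G ξ t (j + 1) =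
        ∑ i ∈ Finset.range (j + 1), j.choose i •
          ⁅sobolevJet G u t i, sobolevJet G ξ t (j - i)⁆ := by
      rw [sobolevJet_apply G (by omega : j + 1 < s + 1), h2]
      refine Finset.sum_congr rfl fun i hi => ?_
      have hij := Finset.mem_range.1 hi
      rw [bracket_eq_adL, sobolevJet_apply G (by omega : i < s + 1),
        sobolevJet_apply G (by omega : j - i < s + 1)]
      rfl
    exact sub_eq_zero.2 h4
  | succ k ih =>
    rw [covOperator, _root_.sub_apply, _root_.sum_apply, ih (by omega), zero_sub, neg_eq_zero]
    refine Finset.sum_eq_zero fun i hi => ?_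
    rw [_root_.smul_apply, ContinuousLinearMap.comp_apply, ih (by omega), map_zero, smul_zero]

/-- Parallel sections are of class `H^s`. -/
theorem IsTransport.exists_parallelSection (h : IsTransport (u.1 0) γ) (v : E) :
    ∃ ξ : SobolevSpace E s, ξ.1 0 =ᵐ[unitVol] fun t => AdL (γ t) v := by
  obtain ⟨g, hg, hgu⟩ := SobolevSpace.exists_memSobolev u
  exact SobolevSpace.exists_of_memSobolev
    ((h.memSobolev_AdL hg hgu).clm_apply zero_le_one (MemSobolev.const s 0 1 v))

theorem IsTransport.integralLp_parallelSection (h : IsTransport (u.1 0) γ) {v : E}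
    {ξ : SobolevSpace E s} (hξ : ξ.1 0 =ᵐ[unitVol] fun t => AdL (γ t) v) :
    integralLp (adInvLp h (ξ.1 0)) = v := by
  have h1 : adInvLp h (ξ.1 0) =ᵐ[unitVol] fun _ => v := by
    filter_upwards [coeFn_adInvLp h (ξ.1 0), hξ] with t h1 h2
    rw [h1, h2, ← ContinuousLinearMap.comp_apply, AdL_inv_comp]
    rfl
  rw [integralLp_apply, intervalIntegral_congr_unitVol h1 (right_mem_Icc.2 zero_le_one)]
  simp

variable {B : LinearMap.BilinForm ℝ (GroupLieAlgebra 𝓘(ℝ, E) G)}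

/-- The inner product with a parallel section depends on the differential of the parallel transport
map only. -/
theorem IsTransport.sobolevInner_parallelSection (hB : IsAdInvariantInner B)
    (h : IsTransport (u.1 0) γ) {v : E} {ξ : SobolevSpace E s}
    (hξ : ξ.1 0 =ᵐ[unitVol] fun t => AdL (γ t) v) (ζ : SobolevSpace E s) :
    sobolevInner B s u ξ ζ = formCLM B v (integralLp (adInvLp h (ζ.1 0))) := by
  have hinv : ∀ (a : G) (v w : E), formCLM B (AdL a v) w = formCLM B v (AdL a⁻¹ w) := by
    intro a v w
    have h1 : ∀ v w : E, formCLM B (AdL a v) (AdL a w) = formCLM B v w :=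
      fun v w => hB.ad_invariant a v w
    have h2 : AdL a (AdL a⁻¹ w) = w := congrArg (fun L => L w) (AdL_comp_inv a)
    rw [← h1 v (AdL a⁻¹ w), h2]
  rw [sobolevInner, _root_.sum_apply, _root_.sum_apply, Finset.sum_eq_single 0]
  · have hae : (fun t => formCLM B (ξ.1 0 t) (ζ.1 0 t)) =ᵐ[unitVol]
        fun t => formCLM B v (adInvLp h (ζ.1 0) t) := by
      filter_upwards [hξ, coeFn_adInvLp h (ζ.1 0)] with t h1 h2
      rw [h1, h2, hinv]
    have h1 : (formCLM B).lpPairing unitVol 2 2 (ξ.1 0) (ζ.1 0) =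
        formCLM B v (integralLp (adInvLp h (ζ.1 0))) := by
      refine ((formCLM B).lpPairing_eq_integral _ _).trans ?_
      rw [integral_congr_ae hae, integralLp_apply, ← integral_unitVol]
      exact (formCLM B v).integral_comp_comm ((Lp.memLp _).integrable (by norm_num))
    rw [_root_.smul_apply, _root_.smul_apply, Nat.choose_zero_right, Nat.cast_one, one_smul]
    exact h1
  · intro k hk hk0
    obtain ⟨k, rfl⟩ := Nat.exists_eq_succ_of_ne_zero hk0
    have := Finset.mem_range.1 hk
    rw [_root_.smul_apply, _root_.smul_apply, pullbackForm_apply,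
      h.covOperator_eq_zero hξ (by omega), map_zero, _root_.zero_apply, smul_zero]
  · exact fun h0 => absurd (Finset.mem_range.2 (Nat.succ_pos s)) h0

/-- A horizontal vector is a parallel section. -/
theorem IsTransport.ae_eq_of_horizontal (hB : IsAdInvariantInner B)
    (h : IsTransport (u.1 0) γ) {η : SobolevSpace E s}
    (hη : ∀ κ : SobolevSpace E s, integralLp (adInvLp h (κ.1 0)) = 0 → sobolevInner B s u η κ = 0) :
    η.1 0 =ᵐ[unitVol] fun t => AdL (γ t) (integralLp (adInvLp h (η.1 0))) := by
  obtain ⟨ξ, hξ⟩ := h.exists_parallelSection (integralLp (adInvLp h (η.1 0)))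
  -- The difference of `η` and the parallel section is both horizontal and vertical.
  have hvert : integralLp (adInvLp h ((η - ξ).1 0)) = 0 := by
    have h1 : (η - ξ).1 0 = η.1 0 - ξ.1 0 := rfl
    rw [h1, map_sub, map_sub, h.integralLp_parallelSection hξ, sub_self]
  have h0 : sobolevInner B s u (η - ξ) (η - ξ) = 0 := by
    rw [map_sub (sobolevInner B s u), _root_.sub_apply, hη _ hvert,
      h.sobolevInner_parallelSection hB hξ, hvert, map_zero,
      sub_zero]
  obtain ⟨C, hC, hcoer⟩ := exists_norm_sq_le_sobolevInner hB s u
  have h2 := hcoer (η - ξ)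
  rw [h0, mul_zero] at h2
  have h3 : η = ξ := sub_eq_zero.1 (norm_eq_zero.1 (pow_eq_zero_iff two_ne_zero |>.1
    (le_antisymm h2 (sq_nonneg _))))
  rwa [← h3] at hξ

end Horizontal

/-! ### The parallel transport map on horizontal vectors -/

section Submersion

variable {E : Type*} [NormedAddCommGroup E] [NormedSpace ℝ E] [FiniteDimensional ℝ E] {s : ℕ}
  {G : Type*} [TopologicalSpace G] [ChartedSpace E G] [Group G] [LieGroup 𝓘(ℝ, E) ∞ G]
  {γ : ℝ → G} {u : SobolevSpace E s}
  {B : LinearMap.BilinForm ℝ (GroupLieAlgebra 𝓘(ℝ, E) G)}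

theorem IsTransport.tderiv_eq_zero_iff (h : IsTransport (u.1 0) γ) (h0 : γ 0 = 1)
    (κ : SobolevSpace E s) :
    tderiv 𝓘(ℝ, SobolevSpace E s) 𝓘(ℝ, E) (parallelTransport G s) u κ = 0 ↔
      integralLp (adInvLp h (κ.1 0)) = 0 := by
  rw [tderiv_parallelTransport h h0]
  refine ⟨fun hκ => ?_, fun hκ => by rw [hκ, map_zero]⟩
  have h1 : ∀ v : E, dLeft (γ 1)⁻¹ (γ 1) (dLeft (γ 1) 1 v) = v :=
    fun v => congrArg (fun L => L v) (dLeft_inv_comp_one (γ 1))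
  rw [← h1 (integralLp (adInvLp h (κ.1 0))), hκ, map_zero]

theorem IsTransport.exists_horizontal (hB : IsAdInvariantInner B) (h : IsTransport (u.1 0) γ)
    (h0 : γ 0 = 1) (w : E) :
    ∃ ξ : SobolevSpace E s,
      (∀ κ : SobolevSpace E s,
        tderiv 𝓘(ℝ, SobolevSpace E s) 𝓘(ℝ, E) (parallelTransport G s) u κ = 0 →
        sobolevInner B s u ξ κ = 0) ∧
      tderiv 𝓘(ℝ, SobolevSpace E s) 𝓘(ℝ, E) (parallelTransport G s) u ξ = w := by
  obtain ⟨ξ, hξ⟩ := h.exists_parallelSection (dLeft (γ 1)⁻¹ (γ 1) w)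
  refine ⟨ξ, fun κ hκ => ?_, ?_⟩
  · rw [h.sobolevInner_parallelSection hB hξ, (h.tderiv_eq_zero_iff h0 κ).1 hκ, map_zero]
  · rw [tderiv_parallelTransport h h0, h.integralLp_parallelSection hξ]
    exact congrArg (fun L => L w) (dLeft_comp_inv (γ 1))

theorem IsTransport.isometry_horizontal (hB : IsAdInvariantInner B) (h : IsTransport (u.1 0) γ)
    (h0 : γ 0 = 1) (ξ : SobolevSpace E s)
    (hξ : ∀ κ : SobolevSpace E s,
      tderiv 𝓘(ℝ, SobolevSpace E s) 𝓘(ℝ, E) (parallelTransport G s) u κ = 0 →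
      sobolevInner B s u ξ κ = 0) (ζ : SobolevSpace E s) :
    groupInner B (parallelTransport G s u)
      (tderiv 𝓘(ℝ, SobolevSpace E s) 𝓘(ℝ, E) (parallelTransport G s) u ξ)
      (tderiv 𝓘(ℝ, SobolevSpace E s) 𝓘(ℝ, E) (parallelTransport G s) u ζ) =
    sobolevInner B s u ξ ζ := by
  rw [tderiv_parallelTransport h h0, tderiv_parallelTransport h h0, h.parallelTransport_eq h0,
    groupInner_dLeft_one]
  refine (h.sobolevInner_parallelSection hB (h.ae_eq_of_horizontal hB fun κ hκ =>
    hξ κ ((h.tderiv_eq_zero_iff h0 κ).2 hκ)) ζ).symm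

end Submersion

end

theorem proposition3p3 {E : Type*} [NormedAddCommGroup E] [NormedSpace ℝ E] [FiniteDimensional ℝ E]
    {G : Type*} [TopologicalSpace G] [ChartedSpace E G] [Group G] [LieGroup 𝓘(ℝ, E) ∞ G]
    [T2Space G] [CompactSpace G] [ConnectedSpace G]
    (B : LinearMap.BilinForm ℝ (GroupLieAlgebra 𝓘(ℝ, E) G)) (hB : IsAdInvariantInner B) (s : ℕ) :
    -- the path `g_u` defining the parallel transport map exists and is unique
    (∀ u : SobolevSpace E s, ∃ γ : ℝ → G, IsParallelPath u γ) ∧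
    (∀ (u : SobolevSpace E s) (γ₁ γ₂ : ℝ → G), IsParallelPath u γ₁ → IsParallelPath u γ₂ →
      EqOn γ₁ γ₂ (Icc 0 1)) ∧
    ∃ (gs : Bundle.ContMDiffRiemannianMetric 𝓘(ℝ, SobolevSpace E s) ∞ (SobolevSpace E s)
        (fun u : SobolevSpace E s => TangentSpace 𝓘(ℝ, SobolevSpace E s) u))
      (gG : Bundle.ContMDiffRiemannianMetric 𝓘(ℝ, E) ∞ E (fun x : G => TangentSpace 𝓘(ℝ, E) x)),
      (∀ u ξ ζ : SobolevSpace E s, gs.inner u ξ ζ = sobolevForm B s u ξ ζ) ∧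
      IsBiInvariantMetric B gG ∧
      IsRiemannianSubmersion gs gG (parallelTransport G s) := by
  refine ⟨exists_isParallelPath, fun u γ₁ γ₂ h₁ h₂ => h₁.eqOn h₂, sobolevMetric hB s,
    groupMetric hB, sobolevInner_eq_sobolevForm B s, isBiInvariantMetric_groupMetric hB, ?_⟩
  have hpath : ∀ u : SobolevSpace E s, ∃ γ : ℝ → G, IsTransport (u.1 0) γ ∧ γ 0 = 1 := fun u =>
    exists_isTransport (u.1 0)
  exact
  { contMDiff := contMDiff_parallelTransport E G s
    surjective := surjective_parallelTransport E G s
    exists_horizontal := fun u => by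
      obtain ⟨γ, h, h0⟩ := hpath u
      have hlift := h.exists_horizontal hB h0
      exact hlift
    isometry := fun u => by
      obtain ⟨γ, h, h0⟩ := hpath u
      exact fun ξ hξ ζ _ => h.isometry_horizontal hB h0 ξ hξ ζ }
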